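/- **Setting.** Let $a,b$ be integers with $2\le a$ and $2a\le b$, let $K$ be a linearly ordered set of keys. Any number of threads run asynchronously on a sequentially consistent shared memory; a step of a thread accesses one field of one shared node (incrementing or decrementing a field and acquiring a free lock are single steps; new nodes are private and are created in one step; memory is not reused). *Nodes.* A node is a Leaf, an Internal node or a TaggedInternal node; its type never changes. It has arrays $keys$, and $vals$ (leaf) or $ptrs$ (Internal, TaggedInternal), of $b$ entries, each possibly empty ($\bot$); a field $size$ (number of keys of a leaf, number of child pointers of an internal node); a bit $marked$; a lock; a fixed key $searchKey$ (chosen arbitrarily when the node is created); and, if it is a leaf, a version $ver$. Leaves are unsorted and may have empty entries between keys. New nodes are unlocked and unmarked. The sentinel $entry$ is an Internal node with no keys and one child, the root. Initially the root is an empty leaf and all threads are idle. Idle threads may invoke find, insert or delete, with any arguments, at any time. "Retry" means: unlock everything held and start again. *search(key, target):* starts with $n=entry$ and $gp=p=\mathrm{NULL}$. While $n$ is neither a leaf nor $target$: set $gp:=p$, $p:=n$; with $i:=0$, increase $i$ while $i<n.size-1$ and $key\ge n.keys[i]$; set $n:=n.ptrs[i]$. It takes no locks and returns $gp,p,n$,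 the index $pIdx$ of $p$ in $gp.ptrs$ and the index $nIdx$ of $n$ in $p.ptrs$. *searchLeaf(leaf, key):* reads $ver$ until it is even, scans the leaf for $key$ and reads the associated value, rereads $ver$, and starts again if it has changed. *find(key):* search(key, NULL), then searchLeaf on the leaf found. *insert(key, val):* search(key, NULL) and searchLeaf; return the value if key is found. Lock the leaf; if it is marked, retry. Scan it for key; if key is found, unlock and return its value. If $size<b$: find an empty entry $i$; do $ver{+}{+}$, $keys[i]:=key$, $vals[i]:=val$, $size{+}{+}$, $ver{+}{+}$; unlock and return. Otherwise lock the parent $p$; if it is marked, retry. Create two leaves sharing evenly, in key order, the contents of the leaf and the new pair, and a node $w$ with these two children, separated by the least key of the right one; $w$ is TaggedInternal, or Internal if $p=entry$. Set $p.ptrs[nIdx]:=w$, then mark the leaf, unlock both nodes, and call fixTagged($w$). *delete(key):* search(key, NULL) and searchLeaf; return if key is not found. Lock the leaf; if it is marked, retry. Scan it for key; if key is found at $i$, do $ver{+}{+}$, $keys[i]:=\bot$, $size{-}{-}$, $ver{+}{+}$. Unlock; if a key was removed and now $size<a$, call fixUnderfull(leaf). *fixTagged(x):* return if $x$ is marked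 or not tagged. search(x.searchKey, x); return if it does not end at $x$. Lock $x,p,gp$; if one of them is marked or $p$ is tagged, retry. Mark $x$ and $p$. Let $S$ be the sequence of children and routing keys of $p$ with those of $x$ substituted for the pointer to $x$. If $p.size+1\le b$, create an Internal node $w$ with contents $S$. Otherwise create two Internal nodes that share the children in $S$ evenly, and a node $w$ with these two children and the routing key of $S$ between them; $w$ is TaggedInternal, or Internal if $gp=entry$. Set $gp.ptrs[pIdx]:=w$, unlock, and in the second case call fixTagged($w$). *fixUnderfull(x):* return if $x$ is $entry$ or $entry.ptrs[0]$. Then (retries begin here) search(x.searchKey, x); return if it does not end at $x$. The sibling $s$ is the left neighbour of $x$ in $p$, or the right one if $nIdx=0$ (retry if $p$ has no such child). Lock $x,s$ (left to right), $p,gp$. Unlock and return if $x.size\ge a$; retry if $p.size<a$, or one of the four nodes is marked, or $x$, $s$ or $p$ is tagged. If $x.size+s.size\ge 2a$, create two nodes sharing evenly the contents of $x$ and $s$ (internal nodes: together with the routing key of $p$ between them), and let $w$ be a copy of $p$ with these two nodes, and the key between them, in place of $x$, $s$ and the key between them. Otherwise create the merged node $y$ of $x$ and $s$; if $gp=entry$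 and $p.size=2$ let $w=y$, else let $w$ be a copy of $p$ with $y$ in place of $x$, $s$ and the key between them. Set $gp.ptrs[pIdx]:=w$, then mark $x$, $p$ and $s$, unlock, and, if $w$ is a copy of $p$ with $y$ in it, call fixUnderfull($y$) and then fixUnderfull($w$). **Definitions.** A node is *reachable* in a configuration if it can be reached from $entry$ by following child pointers; it is *once-reachable* if it is or was reachable. The *key range* of $entry$ is the universe of keys. If a reachable internal node with key range $[L,R)$ has keys $k_1,\dots,k_m$, the key ranges of its children are, from left to right, $[L,k_1),[k_1,k_2),\dots,[k_m,R)$ (just $[L,R)$ if $m=0$). An unreachable once-reachable node keeps its key range. A *relaxed $(a,b)$-tree* is a tree in which leaves have at most $b$ keys; internal nodes have $c$ children and $c-1$ increasing routing keys for some $1\le c\le b$ ($c=2$ for tagged nodes); all leaves have the same number of untagged nodes on the path to them; and, for every key $k$ of an internal node, all keys in the subtrees to the left of $k$ are $<k$ and all keys in the subtrees to the right are $\ge k$. **Theorem.** In every configuration of every execution of the OCC-ABtree: 1. The reachable nodes form a relaxed $(a,b)$-tree (below the sentinel, which has no keys and one child). 2. The key range of a once-reachable node never changes. 3. A once-reachable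 node that is not reachable has the same keys and values (and pointers and size) as in the last configuration in which it was reachable and unlocked. 4. A key appears at most once in a leaf. 5. A once-reachable node that is unmarked is still reachable, except for a node that an insert or fixUnderfull holding its lock has just unlinked by its pointer write and is about to mark. 6. If a once-reachable node is unlocked, its $size$ field is the number of keys it contains (leaf), respectively the number of its child pointers, which is the number of its keys plus one (internal node). 7. At every moment of a call search(key, target), the current node $n$ is once-reachable and its key range contains key. -/

import Mathlib

namespace OCCABTree

/-! ## Shared memory -/

/-- Addresses of nodes. -/
abbrev Addr := ℕ

/-- The address of the sentinel node. -/
abbrev entry : Addr := 0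

/-- The three node types `Leaf`, `Internal`, `TaggedInternal`. The type of a node never changes. -/
inductive Kind
  | leaf
  | internal
  | tagged
  deriving DecidableEq

/-- The arrays of a node and its `size` field; `none` is `⊥` (an empty entry).
The capacity `b` of the arrays is not built into the type: that only positions below `b` are ever
used is part of what has to be proved. A leaf has no pointers, an internal node no values. -/
structure Contents (K V : Type*) where
  keys : ℕ → Option K
  vals : ℕ → Option V
  ptrs : ℕ → Option Addr
  size : ℕ

/-- A node. `lock = some t` means that thread `t` holds the lock. `searchKey` is fixed when the
node is created; rebalancing steps use it to search for the node. -/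
structure Node (K V T : Type*) where
  kind : Kind
  searchKey : K
  data : Contents K V
  ver : ℕ
  marked : Bool
  lock : Option T

/-- The shared memory. The addresses below `next` are allocated; memory is never reused. -/
structure Memory (K V T : Type*) where
  node : Addr → Node K V T
  next : Addr

/-- Write to the node at address `x`. -/
def Memory.modify {K V T : Type*} (m : Memory K V T) (x : Addr) (f : Node K V T → Node K V T) :
    Memory K V T :=
  { m with node := Function.update m.node x (f (m.node x)) }

/-- Write to the arrays or the size of the node at address `x`. -/
def Memory.modifyData {K V T : Type*} (m : Memory K V T) (x : Addr)
    (f : Contents K V → Contents K V) : Memory K V T :=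
  m.modify x fun nd => { nd with data := f nd.data }

/-- Create new (unlocked, unmarked) nodes at the addresses `next, next + 1, …`. -/
def Memory.alloc {K V T : Type*} (m : Memory K V T) (searchKey : ℕ → K)
    (news : List (Kind × Contents K V)) : Memory K V T where
  node := fun x =>
    if x < m.next then m.node x
    else match news[x - m.next]? with
      | some (kd, d) =>
          { kind := kd, searchKey := searchKey (x - m.next), data := d, ver := 0,
            marked := false, lock := none }
      | none => m.node x
  next := m.next + news.length

/-! ## Thread-local state -/

/-- The routines: the three dictionary operations and the two rebalancing steps. -/
inductive Routine (K V : Type*)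
  | find (key : K)
  | insert (key : K) (val : V)
  | delete (key : K)
  | fixTagged (x : Addr)
  | fixUnderfull (x : Addr)

/-- The local variables of `search`, which are also its result `PathInfo`. -/
structure Path where
  gp : Option Addr
  p : Option Addr
  pIdx : ℕ
  n : Addr
  nIdx : ℕ

/-- The values of the local variables when `search` begins. -/
def Path.start : Path := ⟨none, none, 0, entry, 0⟩

/-- Program points of `search`: the head of the outer loop, the reads of `n.size` and of
`n.keys[nIdx]` in the inner loop, and the read of `n.ptrs[nIdx]`. -/
inductive SearchPoint
  | head
  | size
  | key
  | ptr

/-- An update that replaces nodes, with the nodes and indices found by its search: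
a splitting insert, `fixTagged`, or `fixUnderfull`. -/
inductive Update (K V : Type*)
  | split (key : K) (val : V) (leaf p : Addr) (nIdx : ℕ)
  | tagged (x p gp : Addr) (nIdx pIdx : ℕ)
  | underfull (x sibling p gp : Addr) (nIdx sIdx pIdx : ℕ)

/-- A test that an update performs while it holds its locks. -/
inductive Test
  | sizeBelow (x : Addr)
  | sizeNotBelow (x : Addr)
  | unmarked (x : Addr)
  | untagged (x : Addr)

/-- A single memory cell of `Contents`. -/
inductive Cell
  | size
  | key (i : ℕ)
  | val (i : ℕ)
  | ptr (i : ℕ)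

/-- Program counters, with the local variables that are live there.
`start r` is the beginning of the routine `r`, and `retry r` is its label `RETRY`. -/
inductive PC (K V : Type*)
  | idle
  | start (r : Routine K V)
  | retry (r : Routine K V)
  | ret
  | search (r : Routine K V) (key : K) (target : Option Addr) (path : Path) (pt : SearchPoint)
  | leafVer (r : Routine K V) (key : K) (path : Path)
  | leafKey (r : Routine K V) (key : K) (path : Path) (ver1 i : ℕ)
  | leafVal (r : Routine K V) (key : K) (path : Path) (ver1 i : ℕ)
  | leafVer2 (r : Routine K V) (key : K) (path : Path) (ver1 : ℕ) (val : Option V)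
  | insLock (key : K) (val : V) (path : Path)
  | insMarked (key : K) (val : V) (path : Path)
  | insScan (key : K) (val : V) (path : Path) (i : ℕ)
  | insFound (path : Path) (i : ℕ)
  | insSize (key : K) (val : V) (path : Path)
  | insEmpty (key : K) (val : V) (path : Path) (i : ℕ)
  | insBegin (key : K) (val : V) (leaf : Addr) (i : ℕ)
  | insKey (key : K) (val : V) (leaf : Addr) (i : ℕ)
  | insVal (val : V) (leaf : Addr) (i : ℕ)
  | insInc (leaf : Addr)
  | insEnd (leaf : Addr)
  | delLock (key : K) (leaf : Addr)
  | delMarked (key : K) (leaf : Addr)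
  | delScan (key : K) (leaf : Addr) (i : ℕ)
  | delVal (leaf : Addr) (i : ℕ)
  | delBegin (leaf : Addr) (i : ℕ)
  | delKey (leaf : Addr) (i : ℕ)
  | delDec (leaf : Addr)
  | delEnd (leaf : Addr)
  | delSize (leaf : Addr)
  | sibling (x p gp : Addr) (nIdx sIdx pIdx : ℕ)
  | acquire (u : Update K V) (todo : List Addr)
  | test (u : Update K V) (todo : List Test)
  | premark (u : Update K V) (todo : List Addr)
  | copy (u : Update K V) (todo : List (Addr × Cell)) (buf : Addr → Contents K V)
  | link (u : Update K V) (x : Addr) (i : ℕ) (new : Addr)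
  | postmark (u : Update K V) (todo : List Addr)
  | release (todo : List Addr) (after : PC K V)

/-- A thread: its program counter, the rebalancing steps that it still has to call before its
current operation returns, and the return value of the operation. -/
structure Thread (K V : Type*) where
  pc : PC K V
  stack : List (Routine K V)
  result : Option V

/-- Continue at another program point. -/
def Thread.goto {K V : Type*} (s : Thread K V) (pc : PC K V) : Thread K V := { s with pc := pc }

/-! ## Construction of the new nodes of an update -/

section Build

variable {K V : Type*}

/-- No contents. -/
def Contents.empty : Contents K V := ⟨fun _ => none, fun _ => none, fun _ => none, 0⟩

/-- Copy a single cell of `src` to `dst`. -/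
def Contents.copyCell (src dst : Contents K V) : Cell → Contents K V
  | .size => { dst with size := src.size }
  | .key i => { dst with keys := Function.update dst.keys i (src.keys i) }
  | .val i => { dst with vals := Function.update dst.vals i (src.vals i) }
  | .ptr i => { dst with ptrs := Function.update dst.ptrs i (src.ptrs i) }

/-- All cells of a node with arrays of capacity `b`. -/
def cells (b : ℕ) : List Cell :=
  .size :: (List.range b).flatMap fun i => [.key i, .val i, .ptr i]

/-- The key-value pairs in a leaf. -/
def Contents.entries (b : ℕ) (d : Contents K V) : List (K × Option V) :=
  (List.range b).filterMap fun i => (d.keys i).map fun k => (k, d.vals i)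

/-- The routing keys of an internal node. -/
def Contents.routing (d : Contents K V) : List K := (List.range (d.size - 1)).filterMap d.keys

/-- The child pointers of an internal node. -/
def Contents.children (d : Contents K V) : List Addr := (List.range d.size).filterMap d.ptrs

/-- The contents of a new leaf with the given key-value pairs. -/
def leafOf (l : List (K × Option V)) : Contents K V :=
  ⟨fun i => (l[i]?).map Prod.fst, fun i => (l[i]?).bind Prod.snd, fun _ => none, l.length⟩

/-- The contents of a new internal node with the given routing keys and child pointers. -/
def innerOf (ks : List K) (ps : List Addr) : Contents K V :=
  ⟨fun i => ks[i]?, fun _ => none, fun i => ps[i]?, ps.length⟩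

/-- The routine that an update belongs to. -/
def Update.routine : Update K V → Routine K V
  | .split k v _ _ _ => .insert k v
  | .tagged x _ _ _ _ => .fixTagged x
  | .underfull x _ _ _ _ _ _ => .fixUnderfull x

/-- The nodes that an update locks, from bottom to top and from left to right. -/
def Update.locks : Update K V → List Addr
  | .split _ _ leaf p _ => [leaf, p]
  | .tagged x p gp _ _ => [x, p, gp]
  | .underfull x s p gp nIdx sIdx _ => if nIdx < sIdx then [x, s, p, gp] else [s, x, p, gp]

/-- The tests of an update after it has acquired all its locks. -/
def Update.tests : Update K V → List Test
  | .split _ _ _ p _ => [.unmarked p]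
  | .tagged x p gp _ _ => [.unmarked x, .unmarked p, .unmarked gp, .untagged p]
  | .underfull x s p gp _ _ _ =>
      [.sizeBelow x, .sizeNotBelow p, .unmarked x, .unmarked s, .unmarked p, .unmarked gp,
        .untagged x, .untagged s, .untagged p]

/-- The nodes that an update marks before it writes the new pointer. -/
def Update.premarks : Update K V → List Addr
  | .tagged x p _ _ _ => [x, p]
  | _ => []

/-- The nodes that an update marks after it has written the new pointer. -/
def Update.postmarks : Update K V → List Addr
  | .split _ _ leaf _ _ => [leaf]
  | .tagged _ _ _ _ _ => []
  | .underfull x s p _ _ _ _ => [x, p, s]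

/-- The nodes whose contents an update reads in order to construct its new nodes. -/
def Update.sources : Update K V → List Addr
  | .split _ _ leaf _ _ => [leaf]
  | .tagged x p _ _ _ => [x, p]
  | .underfull x s p _ _ _ _ => [x, s, p]

/-- What an update is going to do: the nodes to create, at the addresses `base, base + 1, …`; the
node `target` and the index `idx` of the pointer that is to be set to `base`; and the rebalancing
steps to call afterwards. -/
structure Plan (K V : Type*) where
  news : List (Kind × Contents K V)
  target : Addr
  idx : ℕ
  calls : List (Routine K V)

variable [LinearOrder K]

/-- Sort key-value pairs by key. -/
def sortEntries (l : List (K × Option V)) : List (K × Option V) :=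
  l.insertionSort fun x y => x.1 ≤ y.1

/-- The plan of an update, from the local copies `buf` of the contents of the nodes involved.
`half n` is the number of items that go to the left node when `n` items are shared evenly. -/
def plan (a b : ℕ) (half : ℕ → ℕ) (kind : Addr → Kind) (buf : Addr → Contents K V)
    (base : Addr) : Update K V → Plan K V
  | .split k v leaf p nIdx =>
      let es := sortEntries ((k, some v) :: (buf leaf).entries b)
      let h := half es.length
      { news :=
          [(if p = entry then .internal else .tagged,
              innerOf (((es.drop h).map Prod.fst).take 1) [base + 1, base + 2]),
            (.leaf, leafOf (es.take h)),
            (.leaf, leafOf (es.drop h))]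
        target := p
        idx := nIdx
        calls := [.fixTagged base] }
  | .tagged x p gp nIdx pIdx =>
      let ks := (buf p).routing.take nIdx ++ (buf x).routing ++ (buf p).routing.drop nIdx
      let cs := (buf p).children.take nIdx ++ (buf x).children ++ (buf p).children.drop (nIdx + 1)
      if (buf p).size + 1 ≤ b then
        { news := [(.internal, innerOf ks cs)]
          target := gp
          idx := pIdx
          calls := [] }
      else
        let h := half cs.length
        { news :=
            [(if gp = entry then .internal else .tagged,
                innerOf ((ks.drop (h - 1)).take 1) [base + 1, base + 2]),
              (.internal, innerOf (ks.take (h - 1)) (cs.take h)),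
              (.internal, innerOf (ks.drop h) (cs.drop h))]
          target := gp
          idx := pIdx
          calls := [.fixTagged base] }
  | .underfull x s p gp nIdx sIdx pIdx =>
      -- `l` and `r` are the left and the right one of the two nodes, `i` is the index of `l`
      let l := buf (if nIdx < sIdx then x else s)
      let r := buf (if nIdx < sIdx then s else x)
      let i := min nIdx sIdx
      let pk := (buf p).routing
      let pc := (buf p).children
      let es := l.entries b ++ r.entries b
      let ks := l.routing ++ (pk.drop i).take 1 ++ r.routing
      let cs := l.children ++ r.children
      if 2 * a ≤ (buf x).size + (buf s).size then
        let parts : Contents K V × List K × Contents K V :=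
          if kind x = .leaf then
            let h := half es.length
            (leafOf ((sortEntries es).take h),
              (((sortEntries es).drop h).map Prod.fst).take 1,
              leafOf ((sortEntries es).drop h))
          else
            let h := half cs.length
            (innerOf (ks.take (h - 1)) (cs.take h),
              (ks.drop (h - 1)).take 1,
              innerOf (ks.drop h) (cs.drop h))
        { news :=
            [(.internal, innerOf (pk.take i ++ parts.2.1 ++ pk.drop (i + 1))
                (pc.take i ++ [base + 1, base + 2] ++ pc.drop (i + 2))),
              (kind x, parts.1),
              (kind x, parts.2.2)]
          target := gp
          idx := pIdx
          calls := [] }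
      else
        let merged : Kind × Contents K V :=
          (kind x, if kind x = .leaf then leafOf es else innerOf ks cs)
        if gp = entry ∧ (buf p).size = 2 then
          { news := [merged]
            target := gp
            idx := pIdx
            calls := [] }
        else
          { news :=
              [(.internal, innerOf (pk.take i ++ pk.drop (i + 1))
                  (pc.take i ++ [base + 1] ++ pc.drop (i + 2))),
                merged]
            target := gp
            idx := pIdx
            calls := [.fixUnderfull (base + 1), .fixUnderfull base] }

end Build

/-! ## Steps of a thread -/

/-- The dictionary operations. -/
inductive Operation (K V : Type*)
  | find (key : K)
  | insert (key : K) (val : V)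
  | delete (key : K)

/-- The nondeterministic choices in a step: the operation that an idle thread invokes, whether the
extra item goes to the left node when an odd number of items is shared evenly, and the search keys
of new nodes. -/
structure Choice (K V : Type*) where
  op : Operation K V
  extraLeft : Bool
  searchKey : ℕ → K

/-- The routine that carries out an operation. -/
def Operation.routine {K V : Type*} : Operation K V → Routine K V
  | .find k => .find k
  | .insert k v => .insert k v
  | .delete k => .delete k

section Step

variable {K V T : Type*} [LinearOrder K]

/-- The program point after `search` has returned `path` to the routine `r`. -/
def afterSearch (r : Routine K V) (key : K) (path : Path) : PC K V :=
  match r with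
  | .fixTagged x =>
      if path.n = x then
        match path.p, path.gp with
        | some p, some gp =>
            .acquire (.tagged x p gp path.nIdx path.pIdx) [x, p, gp]
        | _, _ => .ret
      else .ret
  | .fixUnderfull x =>
      if path.n = x then
        match path.p, path.gp with
        | some p, some gp =>
            .sibling x p gp path.nIdx (if path.nIdx = 0 then 1 else path.nIdx - 1) path.pIdx
        | _, _ => .ret
      else .ret
  | r => .leafVer r key path

/-- Outcome of a test, with parameter `a` (the minimum size). -/
def Test.holds (a : ℕ) (m : Memory K V T) : Test → Bool
  | .sizeBelow x => decide ((m.node x).data.size < a)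
  | .sizeNotBelow x => decide (a ≤ (m.node x).data.size)
  | .unmarked x => !(m.node x).marked
  | .untagged x => decide ((m.node x).kind ≠ .tagged)

/-- What an update does, after it has released its locks, when the test fails. -/
def Test.onFailure (u : Update K V) : Test → PC K V
  | .sizeBelow _ => .ret
  | _ => .retry u.routine

/-- One step of thread `t` in local state `s` and shared memory `m`; `none` if no step is possible
(a lock is not available). Every step accesses at most one field of one shared node, apart from
the creation of new nodes, which no other thread can access yet. -/
def step (a b : ℕ) (ch : Choice K V) (t : T) (m : Memory K V T) (s : Thread K V) :
    Option (Memory K V T × Thread K V) :=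
  match s.pc with
  | .idle => some (m, s.goto (.start ch.op.routine))
  | .start (.fixUnderfull x) =>
      if x = entry ∨ (m.node entry).data.ptrs 0 = some x then some (m, s.goto .ret)
      else some (m, s.goto (.retry (.fixUnderfull x)))
  | .start r => some (m, s.goto (.retry r))
  | .retry r =>
      match r with
      | .find k => some (m, s.goto (.search r k none Path.start .head))
      | .insert k _ => some (m, s.goto (.search r k none Path.start .head))
      | .delete k => some (m, s.goto (.search r k none Path.start .head))
      | .fixTagged x =>
          if (m.node x).marked ∨ (m.node x).kind ≠ .tagged then some (m, s.goto .ret)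
          else some (m, s.goto (.search r (m.node x).searchKey (some x) Path.start .head))
      | .fixUnderfull x =>
          some (m, s.goto (.search r (m.node x).searchKey (some x) Path.start .head))
  | .ret =>
      match s.stack with
      | [] => some (m, s.goto .idle)
      | r :: rs => some (m, { s with pc := .start r, stack := rs })
  -- search
  | .search r key target path .head =>
      if (m.node path.n).kind = .leaf ∨ target = some path.n then
        some (m, s.goto (afterSearch r key path))
      else
        some (m, s.goto (.search r key target ⟨path.p, some path.n, path.nIdx, path.n, 0⟩ .size))
  | .search r key target path .size =>
      if path.nIdx < (m.node path.n).data.size - 1 then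
        some (m, s.goto (.search r key target path .key))
      else some (m, s.goto (.search r key target path .ptr))
  | .search r key target path .key =>
      match (m.node path.n).data.keys path.nIdx with
      | some k =>
          if k ≤ key then
            some (m, s.goto (.search r key target { path with nIdx := path.nIdx + 1 } .size))
          else some (m, s.goto (.search r key target path .ptr))
      | none => none
  | .search r key target path .ptr =>
      match (m.node path.n).data.ptrs path.nIdx with
      | some c => some (m, s.goto (.search r key target { path with n := c } .head))
      | none => none
  -- searchLeaf
  | .leafVer r key path =>
      if (m.node path.n).ver % 2 = 1 then some (m, s)
      else some (m, s.goto (.leafKey r key path (m.node path.n).ver 0))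
  | .leafKey r key path ver1 i =>
      if i < b then
        if (m.node path.n).data.keys i = some key then
          some (m, s.goto (.leafVal r key path ver1 i))
        else some (m, s.goto (.leafKey r key path ver1 (i + 1)))
      else some (m, s.goto (.leafVer2 r key path ver1 none))
  | .leafVal r key path ver1 i =>
      some (m, s.goto (.leafVer2 r key path ver1 ((m.node path.n).data.vals i)))
  | .leafVer2 r key path ver1 val =>
      if (m.node path.n).ver ≠ ver1 then some (m, s.goto (.leafVer r key path))
      else
        match r, val with
        | .find _, _ => some (m, { s with pc := .ret, result := val })
        | .insert _ _, some w => some (m, { s with pc := .ret, result := some w })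
        | .insert k v, none => some (m, s.goto (.insLock k v path))
        | .delete _, none => some (m, { s with pc := .ret, result := none })
        | .delete k, some _ => some (m, s.goto (.delLock k path.n))
        | _, _ => none
  -- insert
  | .insLock k v path =>
      if (m.node path.n).lock.isNone then
        some (m.modify path.n fun nd => { nd with lock := some t }, s.goto (.insMarked k v path))
      else none
  | .insMarked k v path =>
      if (m.node path.n).marked then
        some (m, s.goto (.release [path.n] (.retry (.insert k v))))
      else some (m, s.goto (.insScan k v path 0))
  | .insScan k v path i =>
      if i < b then
        if (m.node path.n).data.keys i = some k then some (m, s.goto (.insFound path i))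
        else some (m, s.goto (.insScan k v path (i + 1)))
      else some (m, s.goto (.insSize k v path))
  | .insFound path i =>
      some (m, { s with pc := .release [path.n] .ret, result := (m.node path.n).data.vals i })
  | .insSize k v path =>
      if (m.node path.n).data.size < b then some (m, s.goto (.insEmpty k v path 0))
      else
        match path.p with
        | some p => some (m, s.goto (.acquire (.split k v path.n p path.nIdx) [p]))
        | none => none
  | .insEmpty k v path i =>
      if i < b then
        if (m.node path.n).data.keys i = none then some (m, s.goto (.insBegin k v path.n i))
        else some (m, s.goto (.insEmpty k v path (i + 1)))
      else some (m, s.goto (.release [path.n] .ret))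
  | .insBegin k v leaf i =>
      some (m.modify leaf fun nd => { nd with ver := nd.ver + 1 }, s.goto (.insKey k v leaf i))
  | .insKey k v leaf i =>
      some (m.modifyData leaf fun d => { d with keys := Function.update d.keys i (some k) },
        s.goto (.insVal v leaf i))
  | .insVal v leaf i =>
      some (m.modifyData leaf fun d => { d with vals := Function.update d.vals i (some v) },
        s.goto (.insInc leaf))
  | .insInc leaf =>
      some (m.modifyData leaf fun d => { d with size := d.size + 1 }, s.goto (.insEnd leaf))
  | .insEnd leaf =>
      some (m.modify leaf fun nd => { nd with ver := nd.ver + 1 },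
        { s with pc := .release [leaf] .ret, result := none })
  -- delete
  | .delLock k leaf =>
      if (m.node leaf).lock.isNone then
        some (m.modify leaf fun nd => { nd with lock := some t }, s.goto (.delMarked k leaf))
      else none
  | .delMarked k leaf =>
      if (m.node leaf).marked then some (m, s.goto (.release [leaf] (.retry (.delete k))))
      else some (m, s.goto (.delScan k leaf 0))
  | .delScan k leaf i =>
      if i < b then
        if (m.node leaf).data.keys i = some k then some (m, s.goto (.delVal leaf i))
        else some (m, s.goto (.delScan k leaf (i + 1)))
      else some (m, { s with pc := .release [leaf] .ret, result := none })
  | .delVal leaf i =>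
      some (m, { s with pc := .delBegin leaf i, result := (m.node leaf).data.vals i })
  | .delBegin leaf i =>
      some (m.modify leaf fun nd => { nd with ver := nd.ver + 1 }, s.goto (.delKey leaf i))
  | .delKey leaf i =>
      some (m.modifyData leaf fun d => { d with keys := Function.update d.keys i none },
        s.goto (.delDec leaf))
  | .delDec leaf =>
      some (m.modifyData leaf fun d => { d with size := d.size - 1 }, s.goto (.delEnd leaf))
  | .delEnd leaf =>
      some (m.modify leaf fun nd => { nd with ver := nd.ver + 1 }, s.goto (.delSize leaf))
  | .delSize leaf =>
      if (m.node leaf).data.size < a then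
        some (m, { s with pc := .release [leaf] .ret, stack := .fixUnderfull leaf :: s.stack })
      else some (m, s.goto (.release [leaf] .ret))
  -- the updates that replace nodes
  | .sibling x p gp nIdx sIdx pIdx =>
      match (m.node p).data.ptrs sIdx with
      | some sib =>
          let u : Update K V := .underfull x sib p gp nIdx sIdx pIdx
          some (m, s.goto (.acquire u u.locks))
      | none => some (m, s.goto (.retry (.fixUnderfull x)))
  | .acquire u [] => some (m, s.goto (.test u u.tests))
  | .acquire u (x :: xs) =>
      if (m.node x).lock.isNone then
        some (m.modify x fun nd => { nd with lock := some t }, s.goto (.acquire u xs))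
      else none
  | .test u [] => some (m, s.goto (.premark u u.premarks))
  | .test u (c :: cs) =>
      if c.holds a m then some (m, s.goto (.test u cs))
      else some (m, s.goto (.release u.locks (c.onFailure u)))
  | .premark u [] =>
      some (m, s.goto (.copy u (u.sources.flatMap fun x => (cells b).map fun c => (x, c))
        fun _ => Contents.empty))
  | .premark u (x :: xs) =>
      some (m.modify x fun nd => { nd with marked := true }, s.goto (.premark u xs))
  | .copy u ((x, c) :: cs) buf =>
      some (m, s.goto (.copy u cs
        (Function.update buf x (Contents.copyCell (m.node x).data (buf x) c))))
  | .copy u [] buf =>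
      let pl := plan a b (fun n => if ch.extraLeft then (n + 1) / 2 else n / 2)
        (fun x => (m.node x).kind) buf m.next u
      some (m.alloc ch.searchKey pl.news,
        { s with pc := .link u pl.target pl.idx m.next, stack := pl.calls ++ s.stack })
  | .link u x i new =>
      some (m.modifyData x fun d => { d with ptrs := Function.update d.ptrs i (some new) },
        s.goto (.postmark u u.postmarks))
  | .postmark u (x :: xs) =>
      some (m.modify x fun nd => { nd with marked := true }, s.goto (.postmark u xs))
  | .postmark u [] =>
      match u with
      | .split _ _ _ _ _ => some (m, { s with pc := .release u.locks .ret, result := none })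
      | _ => some (m, s.goto (.release u.locks .ret))
  | .release (x :: xs) after =>
      some (m.modify x fun nd => { nd with lock := none }, s.goto (.release xs after))
  | .release [] after => some (m, s.goto after)

end Step

/-! ## Executions -/

/-- A configuration: the shared memory and the local states of all threads. -/
structure Config (K V T : Type*) where
  mem : Memory K V T
  thread : T → Thread K V

section Execution

variable {K V T : Type*}

/-- The initial configurations: the root, below the sentinel node, is an empty leaf, and all
threads are idle. -/
def Config.IsInitial (c : Config K V T) : Prop :=
  (∃ k₀, c.mem.node entry =
    { kind := .internal, searchKey := k₀, data := innerOf [] [1], ver := 0, marked := false,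
      lock := none }) ∧
  (∃ k₁, c.mem.node 1 =
    { kind := .leaf, searchKey := k₁, data := leafOf [], ver := 0, marked := false,
      lock := none }) ∧
  c.mem.next = 2 ∧
  ∀ t, c.thread t = { pc := .idle, stack := [], result := none }

/-- One thread performs one step. -/
def Config.Step [LinearOrder K] [DecidableEq T] (a b : ℕ) (c c' : Config K V T) : Prop :=
  ∃ (t : T) (ch : Choice K V) (m' : Memory K V T) (s' : Thread K V),
    step a b ch t c.mem (c.thread t) = some (m', s') ∧
    c' = { mem := m', thread := Function.update c.thread t s' }

/-- `e 0, …, e N` are the first `N + 1` configurations of an execution. -/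
def IsExecution [LinearOrder K] [DecidableEq T] (a b : ℕ) (e : ℕ → Config K V T) (N : ℕ) : Prop :=
  (e 0).IsInitial ∧ ∀ i < N, (e i).Step a b (e (i + 1))

/-! ## The notions in the invariants -/

/-- `c` is the child of `x` at index `i`. -/
def Memory.Child (m : Memory K V T) (x : Addr) (i : ℕ) (c : Addr) : Prop :=
  (m.node x).kind ≠ .leaf ∧ (m.node x).data.ptrs i = some c

/-- `y` can be reached from `x` by following child pointers. -/
def Memory.ReachableFrom (m : Memory K V T) : Addr → Addr → Prop :=
  Relation.ReflTransGen fun x y => ∃ i, m.Child x i y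

/-- `x` can be reached from the sentinel node by following child pointers. -/
def Memory.Reachable (m : Memory K V T) (x : Addr) : Prop := m.ReachableFrom entry x

/-- Key ranges `[L, R)`; the bounds `⊥` and `⊤` mean that there is no bound. -/
structure Range (K : Type*) where
  left : WithBot K
  right : WithTop K

/-- `k ∈ [L, R)`. -/
def Range.Contains [LT K] [LE K] (I : Range K) (k : K) : Prop :=
  I.left ≤ (k : WithBot K) ∧ (k : WithTop K) < I.right

/-- The key range of the child at index `i` of an internal node with contents `d` and range `I`. -/
def childRange (d : Contents K V) (I : Range K) (i : ℕ) : Range K where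
  left := match i with
    | 0 => I.left
    | j + 1 => match d.keys j with
      | some k => (k : WithBot K)
      | none => I.left
  right := match d.keys i with
    | some k => (k : WithTop K)
    | none => I.right

/-- `I` is the key range of the (reachable) node `x`. -/
inductive Memory.KeyRange (m : Memory K V T) : Addr → Range K → Prop
  | entry : m.KeyRange entry ⟨⊥, ⊤⟩
  | child {x : Addr} {I : Range K} {i : ℕ} {c : Addr} :
      m.KeyRange x I → m.Child x i c → m.KeyRange c (childRange (m.node x).data I i)

/-- There is a path from the sentinel node to `x` with `d` untagged nodes below the sentinel
node, `x` included. -/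
inductive Memory.RelaxedDepth (m : Memory K V T) : Addr → ℕ → Prop
  | entry : m.RelaxedDepth entry 0
  | child {x : Addr} {d i : ℕ} {c : Addr} :
      m.RelaxedDepth x d → m.Child x i c →
      m.RelaxedDepth c (d + if (m.node c).kind = .tagged then 0 else 1)

/-- The reachable nodes form a tree: no child pointer leads to the sentinel node, and every other
reachable node is the target of just one child pointer of a reachable node. -/
def Memory.IsTree (m : Memory K V T) : Prop :=
  (∀ x i, m.Reachable x → ¬ m.Child x i entry) ∧
  ∀ x i y j c, m.Reachable x → m.Reachable y → m.Child x i c → m.Child y j c → x = y ∧ i = j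

/-- The search tree property, for all keys in the subtrees (routing keys included): the keys in
the subtrees to the left of a key `k` are less than `k`, and those in the subtrees to the right of
`k` are greater than or equal to `k`. -/
def Memory.IsSearchTree [LinearOrder K] (m : Memory K V T) : Prop :=
  ∀ x i k, m.Reachable x → (m.node x).kind ≠ .leaf → (m.node x).data.keys i = some k →
    ∀ j c, m.Child x j c → ∀ y, m.ReachableFrom c y →
      ∀ i' k', (m.node y).data.keys i' = some k' → (j ≤ i → k' < k) ∧ (i < j → k ≤ k')

/-- The shape of a node of a relaxed `(a,b)`-tree. A leaf has at most `b` keys. An internal node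
has `c` children, `1 ≤ c ≤ b`, and `c - 1` routing keys in increasing order. A tagged node has
exactly two children. -/
def Memory.WellShaped [LinearOrder K] (m : Memory K V T) (b : ℕ) (x : Addr) : Prop :=
  let nd := m.node x
  if nd.kind = .leaf then
    (∀ i, (nd.data.keys i).isSome → i < b) ∧ ∀ i, nd.data.ptrs i = none
  else
    ∃ c, 1 ≤ c ∧ c ≤ b ∧ (nd.kind = .tagged → c = 2) ∧
      (∀ i, (nd.data.ptrs i).isSome ↔ i < c) ∧
      (∀ i, (nd.data.keys i).isSome ↔ i + 1 < c) ∧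
      ∀ i j k l, i < j → nd.data.keys i = some k → nd.data.keys j = some l → k < l

/-- The reachable nodes form a relaxed `(a,b)`-tree below the sentinel node, which has no keys and
just one child: a search tree in which all nodes have the right shape and all leaves have the same
relaxed depth (tagged nodes do not count for the relaxed depth). In a relaxed tree, nodes may have
fewer than `a` keys or children. -/
structure Memory.IsRelaxedABTree [LinearOrder K] (m : Memory K V T) (b : ℕ) : Prop where
  isTree : m.IsTree
  sentinel : (m.node OCCABTree.entry).kind = .internal ∧
    (∀ i, (m.node OCCABTree.entry).data.keys i = none) ∧
    ∀ i, ((m.node OCCABTree.entry).data.ptrs i).isSome ↔ i = 0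
  isSearchTree : m.IsSearchTree
  wellShaped : ∀ x, m.Reachable x → m.WellShaped b x
  relaxedDepth : ∀ x y d d', (m.node x).kind = .leaf → (m.node y).kind = .leaf →
    m.RelaxedDepth x d → m.RelaxedDepth y d' → d = d'

/-- The node `x` is reachable and unlocked. -/
def Memory.ReachableUnlocked (m : Memory K V T) (x : Addr) : Prop :=
  m.Reachable x ∧ (m.node x).lock = none

/-- The node `x` was reachable in one of the configurations `e 0, …, e N`. -/
def OnceReachable (e : ℕ → Config K V T) (N : ℕ) (x : Addr) : Prop :=
  ∃ i ≤ N, (e i).mem.Reachable x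

/-- The number of keys in the keys array. -/
def Contents.numKeys (d : Contents K V) (b : ℕ) : ℕ :=
  ((Finset.range b).filter fun i => (d.keys i).isSome).card

/-- The number of pointers in the pointer array. -/
def Contents.numPtrs (d : Contents K V) (b : ℕ) : ℕ :=
  ((Finset.range b).filter fun i => (d.ptrs i).isSome).card

/-- The `size` field is correct: for a leaf it is the number of keys, and for an internal node the
number of child pointers, which is one more than the number of keys. -/
def Node.SizeCorrect (nd : Node K V T) (b : ℕ) : Prop :=
  if nd.kind = .leaf then nd.data.size = nd.data.numKeys b
  else nd.data.size = nd.data.numPtrs b ∧ nd.data.size = nd.data.numKeys b + 1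

/-- Some thread that holds the lock of `x` has performed the pointer write of an update that
removes `x`, and has not yet performed the write to the mark of `x` that comes next in that
update (possibly after the marks of the other removed nodes). -/
def Config.AboutToMark (c : Config K V T) (x : Addr) : Prop :=
  ∃ t u todo, (c.mem.node x).lock = some t ∧ (c.thread t).pc = .postmark u todo ∧ x ∈ todo

end Execution

end OCCABTree

/-!
The proof maintains an invariant along the execution, with auxiliary data (`Ghost`) that no thread
uses: every allocated node has a fixed key range and a fixed *weight*, the number of untagged nodes
on each path from it down to a leaf, and there are the sets of the nodes that have been reachable
(`once`) and of those that have been unlinked (`dead`).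

*The tree.* All conditions in `MInv` on allocated nodes are local: the ranges of the children of an
internal node partition its range, and its weight exceeds theirs by one (by zero if the node is
tagged). That the reachable nodes form a relaxed tree follows from them. The children on the search
path of a key are unique, and along the path the pair of weight and range decreases
(`MInv.searchStep_decreasing`). Since ranges are not empty, two parents of a node would lie on one
search path, which would then run through a cycle (`MInv.isTree`). The relaxed depth of a leaf is
the weight of the root (`MInv.relaxedDepth_weight`).

*Updates.* The nodes that an update creates have a topmost node with the range and the weight of the
topmost node `r` that it removes (only a new root may have another weight), and they lead to all
nodes to which the removed ones lead (`Fragment`, proved for the three updates in `fragment_split`,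
`fragment_tagged` and `fragment_underfull`). Hence the pointer write keeps the local conditions,
and, parents being unique, it unlinks just the removed nodes (`MInv.reachable_link`). For this the
update must know, at the time of its write, that the nodes which it has found are still children of
one another, that its target is reachable, and that it has copied current contents.

*Concurrency.* A search finds nodes without locks, and its knowledge may be out of date. But routing
keys and key ranges are constant, and if `n` was the child of `p` at index `i`, then it still is, or
`n` is unlinked (`Edge`). This knowledge is stable under all steps (`Extends`). A node that is
unmarked and locked by a thread that is not about to mark it is not unlinked (`CInv.not_dead`), so
the tests for marks turn it into current knowledge (`CInv.tested`), which then persists because only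
the holder of a lock changes the node (`PCInv.frame`). `CInv` combines the invariant of the memory
with what each thread knows at its program counter (`PCInv`), and with the discipline of locks,
marks, sizes and last unlocked contents; `CInv.advance` reduces its preservation to conditions on
the thread that takes the step. The statements about the past (that key ranges are constant, that
unlinked nodes keep their contents, and that searches stay within their ranges) need a record of the
execution in addition (`History`).
-/

set_option linter.unusedSectionVars false

namespace OCCABTree

/-! ### Key ranges of adjacent children -/

section Tiles

variable {K V : Type*}

/-- The key range contains at least one key. -/
def Range.Nonempty [LinearOrder K] (I : Range K) : Prop := ∃ k, I.Contains k

/-- The ranges of the nodes `cs` are adjacent, they are separated by the keys `ks`, and together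
they make up `[L, R)`. -/
inductive Tiles (rg : Addr → Range K) :
    WithBot K → WithTop K → List K → List Addr → Prop
  | single {L : WithBot K} {R : WithTop K} {c : Addr} :
      rg c = ⟨L, R⟩ → Tiles rg L R [] [c]
  | cons {L : WithBot K} {R : WithTop K} {k : K} {c : Addr} {ks : List K} {cs : List Addr} :
      rg c = ⟨L, (k : WithTop K)⟩ → Tiles rg (k : WithBot K) R ks cs →
        Tiles rg L R (k :: ks) (c :: cs)

variable {rg rg' : Addr → Range K} {L : WithBot K} {R : WithTop K} {ks ks₁ ks₂ : List K}
  {cs cs₁ cs₂ : List Addr} {k : K}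

theorem Tiles.length_eq (h : Tiles rg L R ks cs) : cs.length = ks.length + 1 := by
  induction h with
  | single _ => rfl
  | cons _ _ ih => simp [ih]

theorem Tiles.congr (h : Tiles rg L R ks cs) (hc : ∀ c ∈ cs, rg' c = rg c) :
    Tiles rg' L R ks cs := by
  induction h with
  | single h => exact .single (by rw [hc _ (by simp), h])
  | cons h _ ih =>
      exact .cons (by rw [hc _ (by simp), h]) (ih fun c hc' => hc c (List.mem_cons_of_mem _ hc'))

theorem Tiles.append (h₁ : Tiles rg L (k : WithTop K) ks₁ cs₁)
    (h₂ : Tiles rg (k : WithBot K) R ks₂ cs₂) :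
    Tiles rg L R (ks₁ ++ k :: ks₂) (cs₁ ++ cs₂) := by
  generalize hR : (k : WithTop K) = R' at h₁
  induction h₁ with
  | single h => subst hR; exact .cons h h₂
  | cons h _ ih => exact .cons h (ih hR)

theorem Tiles.of_append (h : Tiles rg L R (ks₁ ++ k :: ks₂) (cs₁ ++ cs₂))
    (hl : cs₁.length = ks₁.length + 1) :
    Tiles rg L (k : WithTop K) ks₁ cs₁ ∧ Tiles rg (k : WithBot K) R ks₂ cs₂ := by
  induction ks₁ generalizing cs₁ L with
  | nil =>
      obtain ⟨c, rfl⟩ := List.length_eq_one_iff.1 (by simpa using hl)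
      cases h with
      | cons h1 h2 => exact ⟨.single h1, h2⟩
  | cons k' ks ih =>
      cases cs₁ with
      | nil => simp at hl
      | cons c cs₁ =>
          cases h with
          | cons h1 h2 =>
              obtain ⟨h3, h4⟩ := ih h2 (by simpa using hl)
              exact ⟨.cons h1 h3, h4⟩

/-- A run of adjacent children can be replaced by any other run that makes up the same range. -/
theorem Tiles.replace {A : List K} {B : List Addr}
    (h : Tiles rg L R (ks₁ ++ A ++ ks₂) (cs₁ ++ B ++ cs₂))
    (h₁ : ks₁.length = cs₁.length) (h₂ : B.length = A.length + 1) :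
    ∃ L' R', Tiles rg L' R' A B ∧ ∀ A' B', Tiles rg L' R' A' B' →
      Tiles rg L R (ks₁ ++ A' ++ ks₂) (cs₁ ++ B' ++ cs₂) := by
  induction ks₁ generalizing cs₁ L with
  | nil =>
      obtain rfl : cs₁ = [] := by simpa using h₁.symm
      simp only [List.nil_append] at h ⊢
      cases ks₂ with
      | nil =>
          have := h.length_eq
          obtain rfl : cs₂ = [] := by
            simp only [List.length_append, List.length_nil] at this
            exact List.length_eq_zero_iff.1 (by omega)
          simp only [List.append_nil] at h ⊢
          exact ⟨L, R, h, fun _ _ h => h⟩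
      | cons k ks =>
          obtain ⟨h3, h4⟩ := h.of_append h₂
          exact ⟨L, k, h3, fun _ _ h => h.append h4⟩
  | cons k ks ih =>
      cases cs₁ with
      | nil => simp at h₁
      | cons c cs₁ =>
          cases h with
          | cons h5 h6 =>
              obtain ⟨L', R', h3, h4⟩ := ih h6 (by simpa using h₁)
              exact ⟨L', R', h3, fun A' B' h => .cons h5 (h4 A' B' h)⟩

theorem Tiles.set (h : Tiles rg L R ks cs) {i : ℕ} {c c' : Addr} (hi : cs[i]? = some c)
    (hc : rg c' = rg c) : Tiles rg L R ks (cs.set i c') := by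
  induction h generalizing i with
  | single h =>
      cases i with
      | zero =>
          obtain rfl : _ = c := by simpa using hi
          exact .single (by rw [hc, h])
      | succ i => simp at hi
  | cons h h' ih =>
      cases i with
      | zero =>
          obtain rfl : _ = c := by simpa using hi
          exact .cons (by rw [hc, h]) h'
      | succ i => exact .cons h (ih (by simpa using hi))

theorem Tiles.range_eq (h : Tiles rg L R ks cs) {i : ℕ} {c : Addr} (hi : cs[i]? = some c) :
    rg c = childRange (innerOf ks cs : Contents K V) ⟨L, R⟩ i := by
  induction h generalizing i with
  | single h =>
      cases i with
      | zero =>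
          obtain rfl : _ = c := by simpa using hi
          simpa [childRange, innerOf] using h
      | succ i => simp at hi
  | @cons L R k c' ks cs h h' ih =>
      cases i with
      | zero =>
          obtain rfl : _ = c := by simpa using hi
          simpa [childRange, innerOf] using h
      | succ i =>
          have hi' : cs[i]? = some c := by simpa using hi
          rw [ih hi']
          cases i with
          | zero => simp [childRange, innerOf]
          | succ j =>
              have hj : j < ks.length := by
                have := (List.getElem?_eq_some_iff.1 hi').1
                have := h'.length_eq
                omega
              simp [childRange, innerOf, hj]

variable [LinearOrder K]

theorem Tiles.nonempty (h : Tiles rg L R ks cs) (hne : ∀ c ∈ cs, (rg c).Nonempty) :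
    (⟨L, R⟩ : Range K).Nonempty := by
  induction h with
  | single h => exact h ▸ hne _ (by simp)
  | @cons L R k c ks cs h _ ih =>
      obtain ⟨x, hx⟩ := ih fun c hc => hne c (List.mem_cons_of_mem _ hc)
      obtain ⟨y, hy⟩ := hne c (by simp)
      rw [h] at hy
      refine ⟨x, ?_, hx.2⟩
      have h1 : y < k := WithTop.coe_lt_coe.1 hy.2
      have h2 : k ≤ x := WithBot.coe_le_coe.1 hx.1
      exact hy.1.trans (by exact_mod_cast h1.le.trans h2)

theorem Tiles.bounds (h : Tiles rg L R ks cs) (hne : ∀ c ∈ cs, (rg c).Nonempty) :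
    (∀ k ∈ ks, L < (k : WithBot K) ∧ (k : WithTop K) < R) ∧ ks.Pairwise (· < ·) := by
  induction h with
  | single h => simp
  | @cons L R k c ks cs h h' ih =>
      have hne' : ∀ c ∈ cs, (rg c).Nonempty := fun c hc => hne c (List.mem_cons_of_mem _ hc)
      obtain ⟨ih1, ih2⟩ := ih hne'
      obtain ⟨x, hx⟩ := h'.nonempty hne'
      obtain ⟨y, hy⟩ := hne c (by simp)
      rw [h] at hy
      have h1 : L < (k : WithBot K) := hy.1.trans_lt (by
        have : y < k := WithTop.coe_lt_coe.1 hy.2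
        exact_mod_cast this)
      have h2 : k ≤ x := WithBot.coe_le_coe.1 hx.1
      have h3 : (k : WithTop K) < R := lt_of_le_of_lt (by exact_mod_cast h2) hx.2
      refine ⟨?_, List.pairwise_cons.2 ⟨fun k' hk' => ?_, ih2⟩⟩
      · intro k' hk'
        rcases List.mem_cons.1 hk' with rfl | hk'
        · exact ⟨h1, h3⟩
        · exact ⟨h1.trans (ih1 k' hk').1, (ih1 k' hk').2⟩
      · exact_mod_cast (ih1 k' hk').1

/-- The range of a child is contained in the range of its parent. -/
theorem Tiles.subset (h : Tiles rg L R ks cs) (hne : ∀ c ∈ cs, (rg c).Nonempty) {c : Addr}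
    (hc : c ∈ cs) : L ≤ (rg c).left ∧ (rg c).right ≤ R := by
  induction h with
  | single h => obtain rfl : c = _ := by simpa using hc
                rw [h]; exact ⟨le_rfl, le_rfl⟩
  | @cons L R k c' ks cs h h' ih =>
      have hb := ((Tiles.cons h h').bounds hne).1 k (by simp)
      rcases List.mem_cons.1 hc with rfl | hc
      · rw [h]; exact ⟨le_rfl, hb.2.le⟩
      · have := ih (fun c hc => hne c (List.mem_cons_of_mem _ hc)) hc
        exact ⟨hb.1.le.trans this.1, this.2⟩

end Tiles

/-! ### The invariant of the memory -/

section Memory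

variable {K V T : Type*}

/-- Auxiliary data about the execution so far: `range x` and `weight x` are the key range of `x` and
the number of untagged nodes on the paths from `x` (included) down to the leaves below it, `once` is
the set of the nodes that have been reachable, `dead` is the set of those that a pointer write has
unlinked, and `owner x = some t` means that thread `t` has created `x` and not yet linked it. The
weight of the sentinel node has no meaning. -/
structure Ghost (K T : Type*) where
  range : Addr → Range K
  weight : Addr → ℕ
  once : Set Addr
  dead : Set Addr
  owner : Addr → Option T

variable [LinearOrder K]

/-- The conditions on the contents `d` of a leaf with key range `I`. -/
structure LeafOK (b : ℕ) (I : Range K) (d : Contents K V) : Prop where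
  lt : ∀ i k, d.keys i = some k → i < b
  ptrs : ∀ i, d.ptrs i = none
  inj : ∀ i j k, d.keys i = some k → d.keys j = some k → i = j
  mem : ∀ i k, d.keys i = some k → I.Contains k

/-- The conditions on the contents `d` of the internal node `x` with key range `rg x` and weight
`wt x`. -/
def InnerOK (b : ℕ) (rg : Addr → Range K) (wt : Addr → ℕ) (bound : ℕ) (x : Addr) (kd : Kind)
    (d : Contents K V) : Prop :=
  ∃ ks cs, d = innerOf ks cs ∧ Tiles rg (rg x).left (rg x).right ks cs ∧ cs.length ≤ b ∧
    (kd = .tagged → cs.length = 2) ∧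
    ∀ c ∈ cs, c < bound ∧ c ≠ entry ∧ (rg c).Nonempty ∧
      (x ≠ entry → wt x = wt c + if kd = .tagged then 0 else 1)

/-- The local condition on a node `x` of type `kd` with contents `d`. -/
structure NodeOK (b : ℕ) (rg : Addr → Range K) (wt : Addr → ℕ) (bound : ℕ) (x : Addr) (kd : Kind)
    (d : Contents K V) : Prop where
  pos : 1 ≤ wt x
  nonempty : (rg x).Nonempty
  leaf : kd = .leaf → wt x = 1 ∧ LeafOK b (rg x) d
  inner : kd ≠ .leaf → InnerOK b rg wt bound x kd d

/-- The invariant of the memory. All allocated nodes satisfy the local conditions, whether they are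
reachable or not. A once reachable node leads to once reachable nodes only, and it is reachable
unless it has been unlinked. -/
structure MInv (b : ℕ) (g : Ghost K T) (m : Memory K V T) : Prop where
  entry_once : entry ∈ g.once
  entry_kind : (m.node entry).kind = .internal
  entry_size : (m.node entry).data.size = 1
  entry_range : g.range entry = ⟨⊥, ⊤⟩
  entry_live : entry ∉ g.dead
  once_lt : ∀ x ∈ g.once, x < m.next
  dead_once : ∀ x ∈ g.dead, x ∈ g.once
  owner_lt : ∀ x t, g.owner x = some t → x < m.next ∧ x ∉ g.once
  node : ∀ x < m.next, NodeOK b g.range g.weight m.next x (m.node x).kind (m.node x).data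
  closed : ∀ x ∈ g.once, ∀ i c, m.Child x i c → c ∈ g.once
  live : ∀ x ∈ g.once, x ∉ g.dead → m.Reachable x

variable {b : ℕ} {g : Ghost K T} {m : Memory K V T}

theorem MInv.closed' (h : MInv b g m) {x y : Addr} (hx : x ∈ g.once) (hy : m.ReachableFrom x y) :
    y ∈ g.once := by
  induction hy with
  | refl => exact hx
  | tail _ h2 ih => obtain ⟨i, hi⟩ := h2; exact h.closed _ ih _ _ hi

theorem MInv.once_of_reachable (h : MInv b g m) {x : Addr} (hx : m.Reachable x) : x ∈ g.once :=
  h.closed' h.entry_once hx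

/-- The local description of an allocated internal node. -/
theorem MInv.inner (h : MInv b g m) {x : Addr} (hx : x < m.next) (hk : (m.node x).kind ≠ .leaf) :
    ∃ ks cs, (m.node x).data = innerOf ks cs ∧
      Tiles g.range (g.range x).left (g.range x).right ks cs ∧ cs.length ≤ b ∧
      ((m.node x).kind = .tagged → cs.length = 2) ∧
      (∀ c ∈ cs, (g.range c).Nonempty) ∧
      ∀ c ∈ cs, c < m.next ∧ c ≠ entry ∧
        (x ≠ entry → g.weight x = g.weight c + if (m.node x).kind = .tagged then 0 else 1) := by
  obtain ⟨ks, cs, h1, h2, h3, h4, h5⟩ := (h.node x hx).inner hk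
  exact ⟨ks, cs, h1, h2, h3, h4, fun c hc => (h5 c hc).2.2.1,
    fun c hc => ⟨(h5 c hc).1, (h5 c hc).2.1, (h5 c hc).2.2.2⟩⟩

theorem MInv.child_range (h : MInv b g m) {x c : Addr} {i : ℕ} (hx : x < m.next)
    (hc : m.Child x i c) : g.range c = childRange (m.node x).data (g.range x) i := by
  obtain ⟨ks, cs, h1, h2, -⟩ := h.inner hx hc.1
  have := hc.2
  rw [h1] at this ⊢
  exact h2.range_eq this

theorem MInv.child_facts (h : MInv b g m) {x c : Addr} {i : ℕ} (hx : x < m.next)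
    (hc : m.Child x i c) : c < m.next ∧ c ≠ entry ∧
      (x ≠ entry → g.weight x = g.weight c + if (m.node x).kind = .tagged then 0 else 1) ∧
      (g.range x).left ≤ (g.range c).left ∧ (g.range c).right ≤ (g.range x).right := by
  obtain ⟨ks, cs, h1, h2, -, -, h5, h6⟩ := h.inner hx hc.1
  have h7 := hc.2
  rw [h1] at h7
  have h8 : c ∈ cs := List.mem_of_getElem? h7
  exact ⟨(h6 c h8).1, (h6 c h8).2.1, (h6 c h8).2.2, h2.subset h5 h8⟩

theorem MInv.contains_of_child (h : MInv b g m) {x c : Addr} {i : ℕ} (hx : x < m.next)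
    (hc : m.Child x i c) {k : K} (hk : (g.range c).Contains k) : (g.range x).Contains k := by
  obtain ⟨-, -, -, h1, h2⟩ := h.child_facts hx hc
  exact ⟨h1.trans hk.1, hk.2.trans_le h2⟩

/-- Distinct children of a node have disjoint ranges. -/
theorem MInv.child_index_unique (h : MInv b g m) {x c c' : Addr} {i j : ℕ} (hx : x < m.next)
    (hc : m.Child x i c) (hc' : m.Child x j c') {k : K} (hk : (g.range c).Contains k)
    (hk' : (g.range c').Contains k) : i = j := by
  -- by symmetry it suffices to exclude `i < j`
  suffices H : ∀ {c c' : Addr} {i j : ℕ}, m.Child x i c → m.Child x j c' →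
      (g.range c).Contains k → (g.range c').Contains k → ¬ i < j by
    rcases lt_trichotomy i j with hij | hij | hij
    · exact absurd hij (H hc hc' hk hk')
    · exact hij
    · exact absurd hij (H hc' hc hk' hk)
  clear hc hc' hk hk'
  intro c c' i j hc hc' hk hk' hij
  rw [h.child_range hx hc] at hk
  rw [h.child_range hx hc'] at hk'
  obtain ⟨ks, cs, h1, h2, -, -, h5, -⟩ := h.inner hx hc.1
  obtain ⟨hb, hs⟩ := h2.bounds h5
  have hlen := h2.length_eq
  have hj : j < cs.length := by
    have := hc'.2; rw [h1] at this
    exact (List.getElem?_eq_some_iff.1 this).1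
  obtain ⟨j, rfl⟩ : ∃ j', j = j' + 1 := ⟨j - 1, by omega⟩
  have hi : i < ks.length := by omega
  have hj' : j < ks.length := by omega
  have e1 : (m.node x).data.keys i = some ks[i] := by rw [h1]; simp [innerOf, hi]
  have e2 : (m.node x).data.keys j = some ks[j] := by rw [h1]; simp [innerOf, hj']
  have h6 : k < ks[i] := by
    have := hk.2; simp only [childRange, e1] at this; exact_mod_cast this
  have h7 : ks[j] ≤ k := by
    have := hk'.1; simp only [childRange, e2] at this; exact_mod_cast this
  have h8 : ks[i] ≤ ks[j] := by
    rcases Nat.lt_or_eq_of_le (Nat.lt_succ_iff.1 hij) with h | h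
    · exact (List.pairwise_iff_getElem.1 hs i j hi hj' h).le
    · subst h; exact le_rfl
  exact absurd (h6.trans_le (h8.trans h7)) (lt_irrefl _)

/-! ### The reachable nodes form a relaxed tree -/

/-- `y` comes after `x` on the search path of the key `k`. -/
def Memory.SearchStep (m : Memory K V T) (g : Ghost K T) (k : K) (x y : Addr) : Prop :=
  x ∈ g.once ∧ (g.range y).Contains k ∧ ∃ i, m.Child x i y

theorem MInv.searchStep_rightUnique (h : MInv b g m) (k : K) :
    Relator.RightUnique (m.SearchStep g k) := by
  rintro x y z ⟨hx, hy, i, hi⟩ ⟨-, hz, j, hj⟩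
  obtain rfl := h.child_index_unique (h.once_lt _ hx) hi hj hy hz
  exact Option.some_injective _ (hi.2.symm.trans hj.2)

/-- Every reachable node is on the search path of the keys in its range. -/
theorem MInv.searchPath (h : MInv b g m) {x : Addr} (hx : m.Reachable x) {k : K}
    (hk : (g.range x).Contains k) : Relation.ReflTransGen (m.SearchStep g k) entry x := by
  induction hx with
  | refl => exact .refl
  | tail h1 h2 ih =>
      obtain ⟨i, hi⟩ := h2
      have hy := h.once_of_reachable h1
      exact (ih (h.contains_of_child (h.once_lt _ hy) hi hk)).tail ⟨hy, hk, i, hi⟩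

/-- Along the search path of a key, the pair of the weight and the range decreases: an untagged node
adds to the weight, and a tagged one has two children and thus a larger range than either. This
excludes cycles. -/
theorem MInv.searchStep_decreasing (h : MInv b g m) {k : K} {x y : Addr} (hx : x ≠ entry)
    (hxy : m.SearchStep g k x y) :
    g.weight y < g.weight x ∨ (g.weight y = g.weight x ∧
      (∀ k', (g.range y).Contains k' → (g.range x).Contains k') ∧
      ∃ k', (g.range x).Contains k' ∧ ¬ (g.range y).Contains k') := by
  obtain ⟨ho, hk, i, hi⟩ := hxy
  have hlt := h.once_lt _ ho
  have hw := (h.child_facts hlt hi).2.2.1 hx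
  by_cases ht : (m.node x).kind = .tagged
  · rw [if_pos ht] at hw
    refine Or.inr ⟨by omega, fun k' => h.contains_of_child hlt hi, ?_⟩
    obtain ⟨ks, cs, h1, h2, -, h4, h5, h6⟩ := h.inner hlt hi.1
    have hi2 := hi.2
    rw [h1] at hi2
    have hi3 := (List.getElem?_eq_some_iff.1 hi2).1
    have hlen := h4 ht
    -- the other child
    have hj : 1 - i < cs.length := by omega
    have hcj : m.Child x (1 - i) cs[1 - i] := ⟨hi.1, by rw [h1]; simp [innerOf, hj]⟩
    obtain ⟨k', hk'⟩ := h5 cs[1 - i] (List.getElem_mem _)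
    refine ⟨k', h.contains_of_child hlt hcj hk', fun hk'' => ?_⟩
    have := h.child_index_unique hlt hi hcj hk'' hk'
    omega
  · rw [if_neg ht] at hw
    exact Or.inl (by omega)

theorem MInv.not_child_entry (h : MInv b g m) {x : Addr} {i : ℕ} (hx : x ∈ g.once) :
    ¬ m.Child x i entry := fun hc => (h.child_facts (h.once_lt _ hx) hc).2.1 rfl

theorem MInv.searchStep_acyclic (h : MInv b g m) {k : K} {x : Addr} :
    ¬ Relation.TransGen (m.SearchStep g k) x x := by
  intro hx
  have hne : ∀ {z y : Addr}, Relation.TransGen (m.SearchStep g k) z y → y ≠ entry := by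
    rintro z y hy rfl
    cases hy with
    | single h1 => obtain ⟨ho, -, i, hi⟩ := h1; exact h.not_child_entry ho hi
    | tail _ h1 => obtain ⟨ho, -, i, hi⟩ := h1; exact h.not_child_entry ho hi
  have key : ∀ y, Relation.TransGen (m.SearchStep g k) x y →
      g.weight y < g.weight x ∨ (g.weight y = g.weight x ∧
      (∀ k', (g.range y).Contains k' → (g.range x).Contains k') ∧
      ∃ k', (g.range x).Contains k' ∧ ¬ (g.range y).Contains k') := by
    intro y hy
    induction hy with
    | single h1 => exact h.searchStep_decreasing (hne hx) h1
    | tail h1 h2 ih =>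
        rcases ih with h3 | ⟨h3, h4, k', h5, h6⟩ <;>
          rcases h.searchStep_decreasing (hne h1) h2 with h7 | ⟨h7, h8, -⟩
        · left; omega
        · left; omega
        · left; omega
        · exact Or.inr ⟨by omega, fun k hk => h4 k (h8 k hk), k', h5, fun h9 => h6 (h8 _ h9)⟩
  rcases key x hx with h1 | ⟨-, -, k', h1, h2⟩
  · omega
  · exact h2 h1

/-- Two parents of a node are on the search path of any key in its range. The node comes after both
of them, and so after itself, if they are distinct. -/
theorem MInv.isTree (h : MInv b g m) : m.IsTree := by
  refine ⟨fun x i hx => h.not_child_entry (h.once_of_reachable hx), ?_⟩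
  intro x i y j c hx hy hxc hyc
  have hxo := h.once_of_reachable hx
  have hyo := h.once_of_reachable hy
  have hc : c < m.next := (h.child_facts (h.once_lt _ hxo) hxc).1
  obtain ⟨k, hk⟩ := (h.node c hc).nonempty
  have hkx := h.contains_of_child (h.once_lt _ hxo) hxc hk
  have hky := h.contains_of_child (h.once_lt _ hyo) hyc hk
  have huniq := h.searchStep_rightUnique k
  -- if one of the two parents precedes the other, then there is a cycle through `c`
  have H : ∀ {x y : Addr}, m.SearchStep g k x c → m.SearchStep g k y c →
      Relation.ReflTransGen (m.SearchStep g k) x y → x = y := by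
    intro x y h1 h2 h3
    rcases Relation.ReflTransGen.cases_head h3 with h4 | ⟨z, h4, h5⟩
    · exact h4
    · obtain rfl := huniq h4 h1
      exact absurd (Relation.TransGen.tail' h5 h2) h.searchStep_acyclic
  have sx : m.SearchStep g k x c := ⟨hxo, hk, i, hxc⟩
  have sy : m.SearchStep g k y c := ⟨hyo, hk, j, hyc⟩
  have hxy : x = y := by
    rcases Relation.ReflTransGen.total_of_right_unique huniq (h.searchPath hx hkx)
      (h.searchPath hy hky) with h1 | h1
    · exact H sx sy h1
    · exact (H sy sx h1).symm
  subst hxy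
  exact ⟨rfl, h.child_index_unique (h.once_lt _ hxo) hxc hyc hk hk⟩

theorem MInv.contains_of_reachableFrom (h : MInv b g m) {x y : Addr} (hx : x ∈ g.once)
    (hy : m.ReachableFrom x y) {k : K} (hk : (g.range y).Contains k) :
    (g.range x).Contains k := by
  induction hy with
  | refl => exact hk
  | tail h1 h2 ih =>
      obtain ⟨i, hi⟩ := h2
      exact ih (h.contains_of_child (h.once_lt _ (h.closed' hx h1)) hi hk)

theorem MInv.key_mem (h : MInv b g m) {x : Addr} (hx : x ∈ g.once) {i : ℕ} {k : K}
    (hk : (m.node x).data.keys i = some k) : (g.range x).Contains k := by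
  by_cases hl : (m.node x).kind = .leaf
  · exact ((h.node x (h.once_lt _ hx)).leaf hl).2.mem i k hk
  · obtain ⟨ks, cs, h1, h2, -, -, h5, -⟩ := h.inner (h.once_lt _ hx) hl
    rw [h1] at hk
    have := (h2.bounds h5).1 k (List.mem_of_getElem? hk)
    exact ⟨this.1.le, this.2⟩

theorem MInv.keys_strictMono (h : MInv b g m) {x : Addr} (hx : x < m.next)
    (hl : (m.node x).kind ≠ .leaf) {i j : ℕ} {k l : K} (hij : i < j)
    (hk : (m.node x).data.keys i = some k) (hl' : (m.node x).data.keys j = some l) : k < l := by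
  obtain ⟨ks, cs, h1, h2, -, -, h5, -⟩ := h.inner hx hl
  rw [h1] at hk hl'
  obtain ⟨hi, rfl⟩ := List.getElem?_eq_some_iff.1 hk
  obtain ⟨hj, rfl⟩ := List.getElem?_eq_some_iff.1 hl'
  exact List.pairwise_iff_getElem.1 (h2.bounds h5).2 i j hi hj hij

theorem MInv.isSearchTree (h : MInv b g m) : m.IsSearchTree := by
  intro x i k hx hkd hk j c hc y hy i' k' hk'
  have hxo := h.once_of_reachable hx
  have hxl := h.once_lt _ hxo
  have hco := h.closed _ hxo _ _ hc
  have hcon := h.contains_of_reachableFrom hco hy (h.key_mem (h.closed' hco hy) hk')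
  rw [h.child_range hxl hc] at hcon
  obtain ⟨ks, cs, h1, h2, -, -, h5, -⟩ := h.inner hxl hkd
  have hlen := h2.length_eq
  have hcj := hc.2
  have hik := hk
  rw [h1] at hcj hik
  obtain ⟨hj, -⟩ := List.getElem?_eq_some_iff.1 hcj
  obtain ⟨hi, -⟩ := List.getElem?_eq_some_iff.1 hik
  constructor
  · intro hji
    have hj' : j < ks.length := by omega
    have e : (m.node x).data.keys j = some ks[j] := by rw [h1]; simp [innerOf, hj']
    have h6 : k' < ks[j] := by
      have := hcon.2; simp only [childRange, e] at this; exact_mod_cast this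
    rcases Nat.lt_or_eq_of_le hji with h7 | h7
    · exact h6.trans (h.keys_strictMono hxl hkd h7 e hk)
    · subst h7; rw [hk] at e; cases e; exact h6
  · intro hij
    obtain ⟨j, rfl⟩ : ∃ j', j = j' + 1 := ⟨j - 1, by omega⟩
    have hj' : j < ks.length := by omega
    have e : (m.node x).data.keys j = some ks[j] := by rw [h1]; simp [innerOf, hj']
    have h6 : ks[j] ≤ k' := by
      have := hcon.1; simp only [childRange, e] at this; exact_mod_cast this
    rcases Nat.lt_or_eq_of_le (Nat.lt_succ_iff.1 hij) with h7 | h7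
    · exact (h.keys_strictMono hxl hkd h7 hk e).le.trans h6
    · subst h7; rw [hk] at e; cases e; exact h6

theorem MInv.wellShaped (h : MInv b g m) {x : Addr} (hx : x < m.next) : m.WellShaped b x := by
  unfold Memory.WellShaped
  by_cases hl : (m.node x).kind = .leaf
  · simp only [hl, if_true]
    obtain ⟨-, h2⟩ := (h.node x hx).leaf hl
    exact ⟨fun i hi => by obtain ⟨k, hk⟩ := Option.isSome_iff_exists.1 hi; exact h2.lt i k hk,
      h2.ptrs⟩
  · simp only [hl, if_false]
    obtain ⟨ks, cs, h1, h2, h3, h4, h5, -⟩ := h.inner hx hl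
    have hlen := h2.length_eq
    refine ⟨cs.length, by omega, h3, h4, ?_, ?_, fun i j k l hij hk hl' =>
      h.keys_strictMono hx hl hij hk hl'⟩
    · intro i; simp [h1, innerOf]
    · intro i; simp [h1, innerOf]; omega

theorem MInv.relaxedDepth_once (h : MInv b g m) {x d} (hd : m.RelaxedDepth x d) : x ∈ g.once := by
  induction hd with
  | entry => exact h.entry_once
  | child _ h2 ih => exact h.closed _ ih _ _ h2

theorem MInv.entry_data (h : MInv b g m) : ∃ c, (m.node entry).data = innerOf [] [c] := by
  obtain ⟨ks, cs, h1, h2, -⟩ :=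
    h.inner (h.once_lt _ h.entry_once) (by rw [h.entry_kind]; decide)
  have hlen := h2.length_eq
  have hs := h.entry_size
  rw [h1] at hs
  have hs' : cs.length = 1 := hs
  obtain ⟨c, rfl⟩ := List.length_eq_one_iff.1 hs'
  obtain rfl : ks = [] := List.length_eq_zero_iff.1 (by omega)
  exact ⟨c, h1⟩

/-- The weight of the root is the sum of the relaxed depth of the parent of a node and the weight of
the node. -/
theorem MInv.relaxedDepth_weight (h : MInv b g m) {r : Addr} (hr : m.Child entry 0 r)
    {x : Addr} {d : ℕ} (hd : m.RelaxedDepth x d) (hx : x ≠ entry) :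
    d + g.weight x = g.weight r + if (m.node x).kind = .tagged then 0 else 1 := by
  induction hd with
  | entry => exact absurd rfl hx
  | @child x d i c h1 h2 ih =>
      have hxo := h.relaxedDepth_once h1
      by_cases hxe : x = entry
      · subst hxe
        obtain ⟨c', hc'⟩ := h.entry_data
        have e1 := h2.2
        have e2 := hr.2
        rw [hc'] at e1 e2
        have hi : i = 0 := by
          have := (List.getElem?_eq_some_iff.1 e1).1
          simpa using this
        subst hi
        obtain rfl : c = r := Option.some_injective _ (e1.symm.trans e2)
        have hd0 : d = 0 := by
          cases h1 with
          | entry => rfl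
          | child h3 h4 => exact absurd h4 (h.not_child_entry (h.relaxedDepth_once h3))
        subst hd0
        omega
      · have h3 := ih hxe
        have h4 := (h.child_facts (h.once_lt _ hxo) h2).2.2.1 hxe
        omega

theorem MInv.isRelaxedABTree (h : MInv b g m) : m.IsRelaxedABTree b where
  isTree := h.isTree
  sentinel := by
    obtain ⟨c, hc⟩ := h.entry_data
    refine ⟨h.entry_kind, fun i => by rw [hc]; rfl, fun i => ?_⟩
    rw [hc]
    cases i <;> simp [innerOf]
  isSearchTree := h.isSearchTree
  wellShaped := fun x hx => h.wellShaped (h.once_lt _ (h.once_of_reachable hx))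
  relaxedDepth := by
    intro x y d d' hx hy hd hd'
    obtain ⟨r, hr⟩ := h.entry_data
    have hr' : m.Child entry 0 r := ⟨by rw [h.entry_kind]; decide, by rw [hr]; rfl⟩
    have hk := h.entry_kind
    have h1 := h.relaxedDepth_weight hr' hd (by rintro rfl; rw [hx] at hk; cases hk)
    have h2 := h.relaxedDepth_weight hr' hd' (by rintro rfl; rw [hy] at hk; cases hk)
    have h3 := ((h.node x (h.once_lt _ (h.relaxedDepth_once hd))).leaf hx).1
    have h4 := ((h.node y (h.once_lt _ (h.relaxedDepth_once hd'))).leaf hy).1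
    rw [hx] at h1
    rw [hy] at h2
    simp only [reduceCtorEq, if_false] at h1 h2
    omega

theorem MInv.keyRange_eq (h : MInv b g m) {x : Addr} {I : Range K} (hI : m.KeyRange x I) :
    x ∈ g.once ∧ I = g.range x := by
  induction hI with
  | entry => exact ⟨h.entry_once, h.entry_range.symm⟩
  | child _ h2 ih =>
      refine ⟨h.closed _ ih.1 _ _ h2, ?_⟩
      rw [ih.2, h.child_range (h.once_lt _ ih.1) h2]

theorem MInv.keyRange (h : MInv b g m) {x : Addr} (hx : m.Reachable x) :
    m.KeyRange x (g.range x) := by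
  induction hx with
  | refl => rw [h.entry_range]; exact .entry
  | tail h1 h2 ih =>
      obtain ⟨i, hi⟩ := h2
      rw [h.child_range (h.once_lt _ (h.once_of_reachable h1)) hi]
      exact .child ih hi

end Memory

/-! ### Contents of nodes as lists -/

section Lists

variable {K V : Type*}

theorem filterMap_range_getElem? {α : Type*} (l : List α) :
    (List.range l.length).filterMap (fun i => l[i]?) = l := by
  induction l with
  | nil => rfl
  | cons a l ih =>
      rw [List.length_cons, List.range_succ_eq_map, List.filterMap_cons]
      simp only [List.getElem?_cons_zero, List.filterMap_map]
      congr 1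

theorem children_innerOf (ks : List K) (cs : List Addr) :
    (innerOf ks cs : Contents K V).children = cs :=
  filterMap_range_getElem? cs

theorem routing_innerOf {ks : List K} {cs : List Addr} (h : cs.length = ks.length + 1) :
    (innerOf ks cs : Contents K V).routing = ks := by
  have : (innerOf ks cs : Contents K V).size - 1 = ks.length := by simp [innerOf, h]
  unfold Contents.routing
  rw [this]
  exact filterMap_range_getElem? ks

theorem mem_ptrs_innerOf {ks : List K} {cs : List Addr} {c : Addr} :
    (∃ i, (innerOf ks cs : Contents K V).ptrs i = some c) ↔ c ∈ cs :=
  List.mem_iff_getElem?.symm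

theorem length_filterMap_range {α β : Type*} (f : ℕ → Option α) (p : ℕ → α → β) (n : ℕ) :
    ((List.range n).filterMap fun i => (f i).map (p i)).length =
      ((Finset.range n).filter fun i => (f i).isSome).card := by
  induction n with
  | zero => rfl
  | succ n ih =>
      rw [List.range_succ, List.filterMap_append, List.length_append, ih, Finset.range_add_one,
        Finset.filter_insert]
      cases h : f n <;> simp [h]

theorem entries_length (b : ℕ) (d : Contents K V) : (d.entries b).length = d.numKeys b :=
  length_filterMap_range d.keys (fun i k => (k, d.vals i)) b

theorem mem_entries {b : ℕ} {d : Contents K V} {e : K × Option V} (h : e ∈ d.entries b) :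
    ∃ i < b, d.keys i = some e.1 := by
  obtain ⟨i, hi, h1⟩ := List.mem_filterMap.1 h
  obtain ⟨k, h2, rfl⟩ := Option.map_eq_some_iff.1 h1
  exact ⟨i, List.mem_range.1 hi, h2⟩

theorem entries_nodup {b : ℕ} {d : Contents K V}
    (h : ∀ i j k, d.keys i = some k → d.keys j = some k → i = j) :
    ((d.entries b).map Prod.fst).Nodup := by
  have : (d.entries b).map Prod.fst = (List.range b).filterMap d.keys := by
    unfold Contents.entries
    rw [List.map_filterMap]
    congr 1
    funext i
    cases d.keys i <;> rfl
  rw [this]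
  exact List.nodup_range.filterMap fun i j k hi hj => h i j k hi hj

theorem numKeys_leafOf {b : ℕ} {l : List (K × Option V)} (h : l.length ≤ b) :
    (leafOf l).numKeys b = (leafOf l).size := by
  have : (Finset.range b).filter (fun i => ((leafOf l).keys i).isSome) = Finset.range l.length := by
    ext i
    simp [leafOf]
    omega
  unfold Contents.numKeys
  rw [this, Finset.card_range]
  rfl

theorem numKeys_innerOf {b : ℕ} {ks : List K} {cs : List Addr} (h : ks.length ≤ b) :
    (innerOf ks cs : Contents K V).numKeys b = ks.length := by
  have : (Finset.range b).filter (fun i => ((innerOf ks cs : Contents K V).keys i).isSome)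
      = Finset.range ks.length := by
    ext i
    simp [innerOf]
    omega
  unfold Contents.numKeys
  rw [this, Finset.card_range]

theorem numPtrs_innerOf {b : ℕ} {ks : List K} {cs : List Addr} (h : cs.length ≤ b) :
    (innerOf ks cs : Contents K V).numPtrs b = cs.length := by
  have : (Finset.range b).filter (fun i => ((innerOf ks cs : Contents K V).ptrs i).isSome)
      = Finset.range cs.length := by
    ext i
    simp [innerOf]
    omega
  unfold Contents.numPtrs
  rw [this, Finset.card_range]

variable [LinearOrder K]

theorem sortEntries_perm (l : List (K × Option V)) : (sortEntries l).Perm l :=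
  List.perm_insertionSort _ l

theorem sortEntries_pairwise (l : List (K × Option V)) :
    (sortEntries l).Pairwise fun x y => x.1 ≤ y.1 := by
  have : Std.Total (fun x y : K × Option V => x.1 ≤ y.1) := ⟨fun x y => le_total x.1 y.1⟩
  have : IsTrans (K × Option V) (fun x y : K × Option V => x.1 ≤ y.1) :=
    ⟨fun x y z h1 h2 => le_trans h1 h2⟩
  exact List.pairwise_insertionSort _ l

theorem leafOK_leafOf {b : ℕ} {I : Range K} {l : List (K × Option V)} (hb : l.length ≤ b)
    (hn : (l.map Prod.fst).Nodup) (hI : ∀ e ∈ l, I.Contains e.1) : LeafOK b I (leafOf l) where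
  lt := by
    intro i k hk
    obtain ⟨e, he, -⟩ := Option.map_eq_some_iff.1 hk
    have := (List.getElem?_eq_some_iff.1 he).1
    omega
  ptrs := fun _ => rfl
  inj := by
    intro i j k hi hj
    have hi' : (l.map Prod.fst)[i]? = some k := by rw [List.getElem?_map]; exact hi
    have hj' : (l.map Prod.fst)[j]? = some k := by rw [List.getElem?_map]; exact hj
    exact (List.getElem?_inj (List.getElem?_eq_some_iff.1 hi').1 hn).1 (hi'.trans hj'.symm)
  mem := by
    intro i k hk
    obtain ⟨e, he, rfl⟩ := Option.map_eq_some_iff.1 hk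
    exact hI e (List.mem_of_getElem? he)

end Lists

/-! ### The nodes created by an update -/

section Fragment

variable {K V T : Type*} [LinearOrder K]

theorem ne_entry_of_le {n x : Addr} (h : 0 < n) (hx : n ≤ x) : x ≠ entry := by
  rintro rfl
  exact absurd (h.trans_le hx) (lt_irrefl 0)

/-- Extend a function on the addresses below `next` by values for the new addresses. -/
def extend {α : Type*} (next : ℕ) (f : Addr → α) (f' : ℕ → α) : Addr → α :=
  fun x => if x < next then f x else f' (x - next)

theorem extend_lt {α : Type*} {next : ℕ} {f : Addr → α} {f' : ℕ → α} {x : Addr} (h : x < next) :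
    extend next f f' x = f x := if_pos h

theorem extend_add {α : Type*} {next : ℕ} {f : Addr → α} {f' : ℕ → α} (j : ℕ) :
    extend next f f' (next + j) = f' j := by
  simp [extend]

/-- The new nodes `news`, at the addresses from `m.next` on, can take the place of the nodes
`removed`, of which `r` is the topmost one and `target` is its parent. The ranges and weights of the
new nodes are given by `rs` and `ws`. The other new nodes are children of the first one, and every
child of a removed node is removed itself or a child of a new node. The weight of the first one does
not matter if the sentinel node is its parent: there the height of the tree may change. -/
structure Fragment (b : ℕ) (g : Ghost K T) (m : Memory K V T)
    (news : List (Kind × Contents K V)) (target r : Addr) (removed : List Addr)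
    (rs : ℕ → Range K) (ws : ℕ → ℕ) : Prop where
  pos : 0 < news.length
  node : ∀ (j : ℕ) (kd : Kind) (d : Contents K V), news[j]? = some (kd, d) →
    NodeOK b (extend m.next g.range rs) (extend m.next g.weight ws) (m.next + news.length)
      (m.next + j) kd d
  size : ∀ (j : ℕ) (d : Contents K V), news[j]? = some (.leaf, d) → d.numKeys b = d.size
  range_root : rs 0 = g.range r
  weight_root : target ≠ entry → ws 0 = g.weight r
  reach : ∀ j, 0 < j → j < news.length → ∃ (kd : Kind) (d : Contents K V),
    news[0]? = some (kd, d) ∧ kd ≠ .leaf ∧ ∃ i, d.ptrs i = some (m.next + j)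
  child : ∀ (j : ℕ) (kd : Kind) (d : Contents K V), news[j]? = some (kd, d) → kd ≠ .leaf →
    ∀ i c, d.ptrs i = some c → c ∈ g.once ∨ (m.next ≤ c ∧ c < m.next + news.length)
  exits : ∀ z ∈ removed, ∀ i y, m.Child z i y → y ∈ removed ∨
    ∃ (j : ℕ) (kd : Kind) (d : Contents K V), news[j]? = some (kd, d) ∧ kd ≠ .leaf ∧
      ∃ i, d.ptrs i = some y

/-- A new node, with range `I` and weight `w`, all of whose children are old nodes. The local
conditions hold for all ranges and weights `rg` and `wt` that extend those of the old nodes. -/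
structure PartOK (b : ℕ) (g : Ghost K T) (m : Memory K V T) (I : Range K) (w : ℕ) (kd : Kind)
    (d : Contents K V) : Prop where
  node : ∀ (rg : Addr → Range K) (wt : Addr → ℕ) (bound : ℕ) (x : Addr),
    (∀ y < m.next, rg y = g.range y ∧ wt y = g.weight y) → m.next ≤ bound → x ≠ entry →
    rg x = I → wt x = w → NodeOK b rg wt bound x kd d
  size : kd = .leaf → d.numKeys b = d.size
  child : kd ≠ .leaf → ∀ i c, d.ptrs i = some c → c ∈ g.once

variable {b : ℕ} {g : Ghost K T} {m : Memory K V T}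

theorem PartOK.leafOf {I : Range K} {l : List (K × Option V)} (hb : l.length ≤ b)
    (hn : (l.map Prod.fst).Nodup) (hI : ∀ e ∈ l, I.Contains e.1) (hne : I.Nonempty) :
    PartOK b g m I 1 .leaf (leafOf l) where
  node := by
    intro rg wt bound x _ _ _ hx hw
    exact ⟨by omega, by rw [hx]; exact hne, fun _ => ⟨hw, by
      rw [hx]; exact leafOK_leafOf hb hn hI⟩, fun h => absurd rfl h⟩
  size := fun _ => numKeys_leafOf hb
  child := fun h => absurd rfl h

theorem PartOK.innerOf (hI : MInv b g m) {L : WithBot K} {R : WithTop K} {ks : List K}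
    {cs : List Addr} {w : ℕ} (hT : Tiles g.range L R ks cs) (hb : cs.length ≤ b) (hw : 1 ≤ w)
    (hcs : ∀ c ∈ cs, c ∈ g.once ∧ c ≠ entry ∧ w = g.weight c + 1) :
    PartOK b g m ⟨L, R⟩ w .internal (innerOf ks cs) where
  node := by
    intro rg wt bound x hold hbd _ hx hwx
    have hlt : ∀ c ∈ cs, c < m.next := fun c hc => hI.once_lt _ (hcs c hc).1
    have hne : ∀ c ∈ cs, (g.range c).Nonempty := fun c hc => (hI.node c (hlt c hc)).nonempty
    refine ⟨by omega, by rw [hx]; exact hT.nonempty hne, fun h => by simp at h, fun _ => ?_⟩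
    refine ⟨ks, cs, rfl, ?_, hb, fun h => by simp at h, fun c hc => ?_⟩
    · rw [hx]; exact hT.congr fun c hc => (hold c (hlt c hc)).1
    · obtain ⟨h1, h2, h3⟩ := hcs c hc
      obtain ⟨h4, h5⟩ := hold c (hlt c hc)
      refine ⟨(hlt c hc).trans_le hbd, h2, by rw [h4]; exact hne c hc, fun _ => ?_⟩
      rw [hwx, h5]; exact h3
  size := fun h => by simp at h
  child := fun _ i c hc => (hcs c (List.mem_of_getElem? hc)).1

theorem PartOK.fragment {I : Range K} {w : ℕ} {kd : Kind} {d : Contents K V}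
    (h : PartOK b g m I w kd d) {target r : Addr} {removed : List Addr} (hI : g.range r = I)
    (h0 : 0 < m.next)
    (hw : target ≠ entry → w = g.weight r)
    (hex : ∀ z ∈ removed, ∀ i y, m.Child z i y → y ∈ removed ∨ (kd ≠ .leaf ∧
      ∃ i, d.ptrs i = some y)) :
    Fragment b g m [(kd, d)] target r removed (fun _ => I) (fun _ => w) where
  pos := by simp
  node := by
    intro j kd' d' hj
    obtain ⟨rfl, h1⟩ : j = 0 ∧ (kd, d) = (kd', d') := by
      cases j with
      | zero => exact ⟨rfl, by simpa using hj⟩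
      | succ j => simp at hj
    cases h1
    refine h.node _ _ _ _ (fun y hy => ⟨extend_lt hy, extend_lt hy⟩) (Nat.le_add_right _ _) ?_ ?_ ?_
    · exact ne_entry_of_le h0 (Nat.le_add_right _ _)
    · rw [extend_add]
    · rw [extend_add]
  size := by
    intro j d' hj
    cases j with
    | zero => cases (show (kd, d) = (.leaf, d') by simpa using hj); exact h.size rfl
    | succ j => simp at hj
  range_root := hI.symm
  weight_root := hw
  reach := by intro j hj hj'; simp at hj'; omega
  child := by
    intro j kd' d' hj hk i c hc
    cases j with
    | zero => cases (show (kd, d) = (kd', d') by simpa using hj); exact .inl (h.child hk i c hc)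
    | succ j => simp at hj
  exits := by
    intro z hz i y hy
    rcases hex z hz i y hy with h1 | ⟨h1, h2⟩
    · exact .inl h1
    · exact .inr ⟨0, kd, d, rfl, h1, h2⟩

/-- An internal node `innerOf ks cs` on top of new nodes `parts`, its new children. -/
theorem Fragment.ofParts (hI : MInv b g m) {kd₀ kd₁ : Kind} {ks : List K} {cs : List Addr}
    {parts : List (Range K × Contents K V)} {target r : Addr} {removed : List Addr} {w₀ w₁ : ℕ}
    {rs : ℕ → Range K} {ws : ℕ → ℕ} (hrs0 : rs 0 = g.range r)
    (hrs : ∀ (j : ℕ) (q : Range K × Contents K V), parts[j]? = some q → rs (j + 1) = q.1)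
    (hws0 : ws 0 = w₀) (hws : ∀ j, ws (j + 1) = w₁)
    (hk₀ : kd₀ ≠ .leaf) (hk₂ : kd₀ = .tagged → cs.length = 2) (hb : cs.length ≤ b)
    (hT : Tiles (extend m.next g.range rs) (g.range r).left (g.range r).right ks cs)
    (hcs : ∀ c ∈ cs, (c ∈ g.once ∧ c ≠ entry ∧ g.weight c = w₁) ∨
      ∃ j < parts.length, c = m.next + (j + 1))
    (hnew : ∀ j < parts.length, m.next + (j + 1) ∈ cs)
    (hw₀ : w₀ = w₁ + if kd₀ = .tagged then 0 else 1) (hw₁ : 1 ≤ w₁)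
    (hw : target ≠ entry → w₀ = g.weight r)
    (hparts : ∀ q ∈ parts, PartOK b g m q.1 w₁ kd₁ q.2)
    (hex : ∀ z ∈ removed, ∀ i y, m.Child z i y → y ∈ removed ∨ y ∈ cs ∨
      (kd₁ ≠ .leaf ∧ ∃ q ∈ parts, ∃ i, q.2.ptrs i = some y)) :
    Fragment b g m ((kd₀, innerOf ks cs) :: parts.map fun q => (kd₁, q.2)) target r removed
      rs ws where
  pos := by simp
  node := by
    have h0 : 0 < m.next := (Nat.zero_le _).trans_lt (hI.once_lt _ hI.entry_once)
    have hpart : ∀ (j : ℕ) (q : Range K × Contents K V), parts[j]? = some q →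
        NodeOK b (extend m.next g.range rs) (extend m.next g.weight ws)
        (m.next + ((kd₀, (innerOf ks cs : Contents K V)) :: parts.map fun q => (kd₁, q.2)).length)
        (m.next + (j + 1)) kd₁ q.2 := by
      intro j q hq
      refine (hparts q (List.mem_of_getElem? hq)).node _ _ _ _
        (fun y hy => ⟨extend_lt hy, extend_lt hy⟩) (Nat.le_add_right _ _) ?_ ?_ ?_
      · exact ne_entry_of_le h0 (Nat.le_add_right _ _)
      · rw [extend_add, hrs j q hq]
      · rw [extend_add, hws]
    intro j kd d hj
    cases j with
    | succ j =>
        obtain ⟨q, hq, he⟩ : ∃ q, parts[j]? = some q ∧ (kd₁, q.2) = (kd, d) := by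
          simpa using hj
        cases he
        exact hpart j q hq
    | zero =>
        cases (show (kd₀, innerOf ks cs) = (kd, d) by simpa using hj)
        have e0 : extend m.next g.range rs (m.next + 0) = g.range r := by rw [extend_add, hrs0]
        have e1 : extend m.next g.weight ws (m.next + 0) = w₀ := by rw [extend_add, hws0]
        have hc : ∀ c ∈ cs, c < m.next + ((kd₀, (innerOf ks cs : Contents K V)) ::
            parts.map fun q => (kd₁, q.2)).length ∧ c ≠ entry ∧
            (extend m.next g.range rs c).Nonempty ∧ extend m.next g.weight ws c = w₁ := by
          intro c hc
          rcases hcs c hc with ⟨h1, h2, h3⟩ | ⟨j, hj, rfl⟩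
          · have h4 := hI.once_lt _ h1
            rw [extend_lt h4, extend_lt h4]
            exact ⟨h4.trans_le (Nat.le_add_right _ _), h2, (hI.node c h4).nonempty, h3⟩
          · refine ⟨Nat.add_lt_add_left (by simpa using hj) _, ?_, ?_, ?_⟩
            · exact ne_entry_of_le h0 (Nat.le_add_right _ _)
            · exact (hpart j parts[j] (by simp [hj])).nonempty
            · rw [extend_add, hws]
        refine ⟨by rw [e1, hw₀]; omega, ?_, fun h => absurd h hk₀, fun _ => ?_⟩
        · rw [e0]; exact hT.nonempty fun c hc' => (hc c hc').2.2.1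
        · refine ⟨ks, cs, rfl, by rw [e0]; exact hT, hb, hk₂, fun c hc' => ?_⟩
          obtain ⟨h1, h2, h3, h4⟩ := hc c hc'
          exact ⟨h1, h2, h3, fun _ => by rw [e1, h4, hw₀]⟩
  size := by
    intro j d hj
    cases j with
    | succ j =>
        obtain ⟨q, hq, he⟩ : ∃ q, parts[j]? = some q ∧ (kd₁, q.2) = (.leaf, d) := by
          simpa using hj
        cases he
        exact (hparts q (List.mem_of_getElem? hq)).size rfl
    | zero =>
        cases (show (kd₀, innerOf ks cs) = (.leaf, d) by simpa using hj)
        exact absurd rfl hk₀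
  range_root := hrs0
  weight_root := by rw [hws0]; exact hw
  reach := by
    intro j hj hj'
    obtain ⟨j, rfl⟩ : ∃ j', j = j' + 1 := ⟨j - 1, by omega⟩
    exact ⟨kd₀, innerOf ks cs, rfl, hk₀, mem_ptrs_innerOf.2 (hnew j (by simpa using hj'))⟩
  child := by
    intro j kd d hj hk i c hc
    cases j with
    | succ j =>
        obtain ⟨q, hq, he⟩ : ∃ q, parts[j]? = some q ∧ (kd₁, q.2) = (kd, d) := by
          simpa using hj
        cases he
        exact .inl ((hparts q (List.mem_of_getElem? hq)).child hk i c hc)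
    | zero =>
        cases (show (kd₀, innerOf ks cs) = (kd, d) by simpa using hj)
        rcases hcs c (mem_ptrs_innerOf.1 ⟨i, hc⟩) with ⟨h1, -⟩ | ⟨j, hj, rfl⟩
        · exact .inl h1
        · exact .inr ⟨Nat.le_add_right _ _, Nat.add_lt_add_left (by simpa using hj) _⟩
  exits := by
    intro z hz i y hy
    rcases hex z hz i y hy with h1 | h1 | ⟨h1, q, hq, h2⟩
    · exact .inl h1
    · exact .inr ⟨0, kd₀, innerOf ks cs, rfl, hk₀, mem_ptrs_innerOf.2 h1⟩
    · obtain ⟨j, hj⟩ := List.mem_iff_getElem?.1 hq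
      exact .inr ⟨j + 1, kd₁, q.2, by simp [hj], h1, h2⟩

/-! ### Sharing the contents of a node evenly -/

theorem half_bounds {half : ℕ → ℕ} (hh : ∀ n, half n = n / 2 ∨ half n = (n + 1) / 2) {n b : ℕ}
    (h2 : 2 ≤ n) (hb : n ≤ 2 * b) : 0 < half n ∧ half n < n ∧ half n ≤ b ∧ n - half n ≤ b := by
  rcases hh n with h | h <;> rw [h] <;> omega

/-- Cutting a list of key-value pairs in key order gives two leaves. -/
theorem leaf_halves {es : List (K × Option V)} {I : Range K} {h : ℕ}
    (hn : (es.map Prod.fst).Nodup) (hI : ∀ e ∈ es, I.Contains e.1) (h0 : 0 < h)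
    (h1 : h < es.length) (hb1 : h ≤ b) (hb2 : es.length - h ≤ b) :
    ∃ k : K, (((sortEntries es).drop h).map Prod.fst).take 1 = [k] ∧
      PartOK b g m ⟨I.left, (k : WithTop K)⟩ 1 .leaf (leafOf ((sortEntries es).take h)) ∧
      PartOK b g m ⟨(k : WithBot K), I.right⟩ 1 .leaf (leafOf ((sortEntries es).drop h)) := by
  have hp := sortEntries_perm es
  have hlen := hp.length_eq
  have hs := sortEntries_pairwise es
  generalize sortEntries es = l at hlen hp hs
  have hnl : (l.map Prod.fst).Nodup := ((hp.map Prod.fst).nodup_iff).2 hn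
  have hIl : ∀ e ∈ l, I.Contains e.1 := fun e he => hI e (hp.mem_iff.1 he)
  have hstrict : l.Pairwise fun x y => x.1 < y.1 :=
    (hs.and (List.pairwise_map.1 hnl)).imp fun h => lt_of_le_of_ne h.1 h.2
  have hlt : h < l.length := by omega
  have hdrop : l.drop h = l[h] :: l.drop (h + 1) := List.drop_eq_getElem_cons hlt
  have hl : ∀ e ∈ l.take h, e.1 < (l[h]).1 := by
    intro e he
    obtain ⟨i, hi, rfl⟩ := List.mem_take_iff_getElem.1 he
    exact List.pairwise_iff_getElem.1 hstrict i h (by omega) hlt (by omega)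
  have hr : ∀ e ∈ l.drop h, (l[h]).1 ≤ e.1 := by
    intro e he
    obtain ⟨i, hi, rfl⟩ := List.mem_drop_iff_getElem.1 he
    rcases Nat.eq_zero_or_pos i with rfl | h2
    · simp
    · exact (List.pairwise_iff_getElem.1 hstrict h (h + i) hlt (by omega) (by omega)).le
  have hcl : ∀ e ∈ l.take h, (⟨I.left, ((l[h]).1 : WithTop K)⟩ : Range K).Contains e.1 :=
    fun e he => ⟨(hIl e (List.mem_of_mem_take he)).1, WithTop.coe_lt_coe.2 (hl e he)⟩
  have hcr : ∀ e ∈ l.drop h, (⟨((l[h]).1 : WithBot K), I.right⟩ : Range K).Contains e.1 :=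
    fun e he => ⟨WithBot.coe_le_coe.2 (hr e he), (hIl e (List.mem_of_mem_drop he)).2⟩
  refine ⟨(l[h]).1, by rw [hdrop]; rfl, ?_, ?_⟩
  · refine .leafOf (by simp; omega) ?_ hcl ⟨l[0].1, hcl _ ?_⟩
    · exact hnl.sublist ((List.take_sublist h l).map _)
    · exact List.mem_take_iff_getElem.2 ⟨0, by omega, rfl⟩
  · refine .leafOf (by simp; omega) ?_ hcr ⟨l[h].1, hcr _ (hdrop ▸ List.mem_cons_self)⟩
    exact hnl.sublist ((List.drop_sublist h l).map _)

/-- Cutting a list of children gives two internal nodes. -/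
theorem inner_halves (hI : MInv b g m) {L : WithBot K} {R : WithTop K} {ks : List K}
    {cs : List Addr} {h w : ℕ} (hT : Tiles g.range L R ks cs) (hw : 1 ≤ w)
    (hcs : ∀ c ∈ cs, c ∈ g.once ∧ c ≠ entry ∧ w = g.weight c + 1) (h0 : 0 < h)
    (h1 : h < cs.length) (hb1 : h ≤ b) (hb2 : cs.length - h ≤ b) :
    ∃ k : K, (ks.drop (h - 1)).take 1 = [k] ∧
      PartOK b g m ⟨L, (k : WithTop K)⟩ w .internal (innerOf (ks.take (h - 1)) (cs.take h)) ∧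
      PartOK b g m ⟨(k : WithBot K), R⟩ w .internal (innerOf (ks.drop h) (cs.drop h)) := by
  have hlen := hT.length_eq
  have hlt : h - 1 < ks.length := by omega
  have hdrop : ks.drop (h - 1) = ks[h - 1] :: ks.drop h := by
    rw [List.drop_eq_getElem_cons hlt, Nat.sub_add_cancel h0]
  have hks : ks = ks.take (h - 1) ++ ks[h - 1] :: ks.drop h := by
    rw [← hdrop, List.take_append_drop]
  have hT' := hT
  rw [hks, ← List.take_append_drop h cs] at hT'
  obtain ⟨h2, h3⟩ := hT'.of_append (by simp; omega)
  refine ⟨ks[h - 1], by rw [hdrop]; rfl, .innerOf hI h2 (by simp; omega) hw ?_,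
    .innerOf hI h3 (by simp; omega) hw ?_⟩
  · exact fun c hc => hcs c (List.mem_of_mem_take hc)
  · exact fun c hc => hcs c (List.mem_of_mem_drop hc)

end Fragment

/-! ### The plans of the updates -/

section Plans

variable {K V T : Type*} [LinearOrder K] {a b : ℕ} {g : Ghost K T} {m : Memory K V T}
  {half : ℕ → ℕ}

/-- The ranges, or the weights, of a new node and of two new children of it. -/
def three {α : Type*} (x y z : α) : ℕ → α
  | 0 => x
  | 1 => y
  | _ => z

theorem MInv.next_pos (hI : MInv b g m) : 0 < m.next :=
  (Nat.zero_le _).trans_lt (hI.once_lt _ hI.entry_once)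

/-- A new internal node with two adjacent new nodes among its children. -/
theorem Fragment.ofPair (hI : MInv b g m) {kd₀ kd₁ : Kind} {ks₁ ks₂ : List K} {k : K}
    {cs₁ cs₂ : List Addr} {I₁ I₂ : Range K} {d₁ d₂ : Contents K V}
    {target r : Addr} {removed : List Addr} {w₀ w₁ : ℕ}
    (hk₀ : kd₀ ≠ .leaf) (hk₂ : kd₀ = .tagged → cs₁ = [] ∧ cs₂ = [])
    (hb : cs₁.length + 2 + cs₂.length ≤ b)
    (hT : ∀ rg : Addr → Range K, (∀ y < m.next, rg y = g.range y) → rg (m.next + 1) = I₁ →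
      rg (m.next + 2) = I₂ → Tiles rg (g.range r).left (g.range r).right
        (ks₁ ++ [k] ++ ks₂) (cs₁ ++ [m.next + 1, m.next + 2] ++ cs₂))
    (hcs : ∀ c ∈ cs₁ ++ cs₂, c ∈ g.once ∧ c ≠ entry ∧ g.weight c = w₁)
    (hw₀ : w₀ = w₁ + if kd₀ = .tagged then 0 else 1) (hw₁ : 1 ≤ w₁)
    (hw : target ≠ entry → w₀ = g.weight r)
    (h₁ : PartOK b g m I₁ w₁ kd₁ d₁) (h₂ : PartOK b g m I₂ w₁ kd₁ d₂)
    (hex : ∀ z ∈ removed, ∀ i y, m.Child z i y → y ∈ removed ∨ y ∈ cs₁ ++ cs₂ ∨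
      (kd₁ ≠ .leaf ∧ ((∃ i, d₁.ptrs i = some y) ∨ ∃ i, d₂.ptrs i = some y))) :
    Fragment b g m
      [(kd₀, innerOf (ks₁ ++ [k] ++ ks₂) (cs₁ ++ [m.next + 1, m.next + 2] ++ cs₂)),
        (kd₁, d₁), (kd₁, d₂)]
      target r removed (three (g.range r) I₁ I₂) (three w₀ w₁ w₁) := by
  refine Fragment.ofParts hI (parts := [(I₁, d₁), (I₂, d₂)]) (w₀ := w₀) (w₁ := w₁) rfl ?_ rfl ?_
    hk₀ ?_ ?_ ?_ ?_ ?_ hw₀ hw₁ hw ?_ ?_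
  · intro j q hq
    match j, hq with
    | 0, hq => cases (show (I₁, d₁) = q by simpa using hq); rfl
    | 1, hq => cases (show (I₂, d₂) = q by simpa using hq); rfl
    | j + 2, hq => simp at hq
  · intro j
    cases j <;> rfl
  · intro h
    obtain ⟨rfl, rfl⟩ := hk₂ h
    rfl
  · simp; omega
  · exact hT _ (fun y hy => extend_lt hy) (extend_add 1) (extend_add 2)
  · intro c hc
    simp only [List.mem_append, List.mem_cons, List.not_mem_nil, or_false] at hc hcs
    rcases hc with (hc | rfl | rfl) | hc
    · exact .inl (hcs c (.inl hc))
    · exact .inr ⟨0, by simp, rfl⟩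
    · exact .inr ⟨1, by simp, rfl⟩
    · exact .inl (hcs c (.inr hc))
  · intro j hj
    match j, hj with
    | 0, _ => simp
    | 1, _ => simp
    | j + 2, hj => simp at hj
  · intro q hq
    simp only [List.mem_cons, List.not_mem_nil, or_false] at hq
    rcases hq with rfl | rfl
    · exact h₁
    · exact h₂
  · intro z hz i y hy
    rcases hex z hz i y hy with h | h | ⟨h, h'⟩
    · exact .inl h
    · right; left
      simp only [List.mem_append] at h ⊢
      tauto
    · refine .inr (.inr ⟨h, ?_⟩)
      rcases h' with h' | h'
      · exact ⟨(I₁, d₁), by simp, h'⟩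
      · exact ⟨(I₂, d₂), by simp, h'⟩

/-- The new nodes of a splitting insert can replace the leaf. -/
theorem fragment_split (hI : MInv b g m) (hh : ∀ n, half n = n / 2 ∨ half n = (n + 1) / 2)
    (hb : 4 ≤ b) {k : K} {v : V} {leaf p : Addr} {nIdx : ℕ} (hl : leaf ∈ g.once)
    (hkd : (m.node leaf).kind = .leaf) (hk : (g.range leaf).Contains k)
    (hnk : ∀ i, (m.node leaf).data.keys i ≠ some k)
    (hfull : (m.node leaf).data.numKeys b = b) :
    ∃ rs ws, Fragment b g m (plan a b half (fun x => (m.node x).kind)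
      (fun x => (m.node x).data) m.next (.split k v leaf p nIdx)).news p leaf [leaf] rs ws := by
  obtain ⟨hw, hlf⟩ := (hI.node leaf (hI.once_lt _ hl)).leaf hkd
  simp only [plan]
  have hnd : (((k, some v) :: (m.node leaf).data.entries b).map Prod.fst).Nodup := by
    rw [List.map_cons, List.nodup_cons]
    refine ⟨fun h => ?_, entries_nodup hlf.inj⟩
    obtain ⟨e, he, rfl⟩ := List.mem_map.1 h
    obtain ⟨i, -, hi⟩ := mem_entries he
    exact hnk i hi
  have hmem : ∀ e ∈ (k, some v) :: (m.node leaf).data.entries b,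
      (g.range leaf).Contains e.1 := by
    intro e he
    rcases List.mem_cons.1 he with rfl | he
    · exact hk
    · obtain ⟨i, -, hi⟩ := mem_entries he
      exact hlf.mem i _ hi
  have hlen : ((k, some v) :: (m.node leaf).data.entries b).length = b + 1 := by
    rw [List.length_cons, entries_length, hfull]
  generalize (k, some v) :: (m.node leaf).data.entries b = es at hnd hmem hlen
  have hslen := (sortEntries_perm es).length_eq
  obtain ⟨h1, h2, h3, h4⟩ := half_bounds (b := b) hh (n := (sortEntries es).length)
    (by omega) (by omega)
  obtain ⟨k', hk', hp1, hp2⟩ := leaf_halves (b := b) (g := g) (m := m) hnd hmem h1 (by omega) h3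
    (by omega)
  rw [hk']
  refine ⟨_, _, Fragment.ofPair hI (ks₁ := []) (ks₂ := []) (cs₁ := []) (cs₂ := [])
    (w₀ := if p = entry then 2 else 1) ?_ ?_ ?_ ?_ ?_ ?_ ?_ ?_ hp1 hp2 ?_⟩
  · split_ifs <;> simp
  · simp
  · simp; omega
  · intro rg _ e1 e2
    exact .cons e1 (.single e2)
  · simp
  · by_cases hp : p = entry <;> simp [hp]
  · exact le_rfl
  · intro hp
    rw [if_neg hp, hw]
  · intro z hz i y hy
    rw [List.mem_singleton.1 hz] at hy
    exact absurd hkd hy.1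

/-- The list of the children of an internal node that is not the sentinel node. -/
theorem MInv.inner_lists (hI : MInv b g m) {x : Addr} (hx : x ∈ g.once) (hxe : x ≠ entry)
    (hk : (m.node x).kind ≠ .leaf) :
    ∃ ks cs, (m.node x).data = innerOf ks cs ∧ cs.length = ks.length + 1 ∧
      Tiles g.range (g.range x).left (g.range x).right ks cs ∧ cs.length ≤ b ∧
      ((m.node x).kind = .tagged → cs.length = 2) ∧
      ∀ c ∈ cs, c ∈ g.once ∧ c ≠ entry ∧
        g.weight x = g.weight c + if (m.node x).kind = .tagged then 0 else 1 := by
  have hxl := hI.once_lt _ hx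
  obtain ⟨ks, cs, h1, h2, h3, h4, -, h6⟩ := hI.inner hxl hk
  refine ⟨ks, cs, h1, h2.length_eq, h2, h3, h4, fun c hc => ?_⟩
  obtain ⟨i, hi⟩ := mem_ptrs_innerOf (K := K) (V := V) (ks := ks).2 hc
  exact ⟨hI.closed x hx i c ⟨hk, by rw [h1]; exact hi⟩, (h6 c hc).2.1, (h6 c hc).2.2 hxe⟩

theorem take_append_cons_drop {α : Type*} {l : List α} {i : ℕ} {x : α} (h : l[i]? = some x) :
    l = l.take i ++ [x] ++ l.drop (i + 1) := by
  obtain ⟨hi, rfl⟩ := List.getElem?_eq_some_iff.1 h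
  simp

/-- The new nodes of `fixTagged` can replace the tagged node and its parent. -/
theorem fragment_tagged (hI : MInv b g m) (hh : ∀ n, half n = n / 2 ∨ half n = (n + 1) / 2)
    (hb : 4 ≤ b) {x p gp : Addr} {nIdx pIdx : ℕ} (hp : p ∈ g.once) (hpe : p ≠ entry)
    (hpk : (m.node p).kind = .internal) (hx : m.Child p nIdx x) (hxk : (m.node x).kind = .tagged) :
    ∃ rs ws, Fragment b g m (plan a b half (fun x => (m.node x).kind)
      (fun x => (m.node x).data) m.next (.tagged x p gp nIdx pIdx)).news gp p [x, p] rs ws := by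
  obtain ⟨pk, pc, hpd, hpl, hpT, hpb, -, hpc⟩ := hI.inner_lists hp hpe hx.1
  obtain ⟨hxo, hxe, hxw⟩ := hpc x (mem_ptrs_innerOf.1 ⟨nIdx, by rw [← hpd]; exact hx.2⟩)
  obtain ⟨xk, xc, hxd, hxl, hxT, -, hx2, hxc⟩ := hI.inner_lists hxo hxe (by rw [hxk]; decide)
  have hx2 := hx2 hxk
  simp only [hpk, hxk, reduceCtorEq, if_false, if_true] at hpc hxc hxw
  have hxi : pc[nIdx]? = some x := by have := hx.2; rw [hpd] at this; exact this
  have hi : nIdx < pc.length := (List.getElem?_eq_some_iff.1 hxi).1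
  -- the pointer to `x` is replaced by the contents of `x`
  have hT : Tiles g.range (g.range p).left (g.range p).right
      (pk.take nIdx ++ xk ++ pk.drop nIdx) (pc.take nIdx ++ xc ++ pc.drop (nIdx + 1)) := by
    have e1 : pk = pk.take nIdx ++ [] ++ pk.drop nIdx := by simp
    have e2 := take_append_cons_drop hxi
    have hpT' := hpT
    rw [e1, e2] at hpT'
    obtain ⟨L', R', h1, h2⟩ := hpT'.replace (by simp; omega) (by simp)
    cases h1 with
    | single h1 => rw [h1] at hxT; exact h2 _ _ hxT
  have hcs : ∀ c ∈ pc.take nIdx ++ xc ++ pc.drop (nIdx + 1),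
      c ∈ g.once ∧ c ≠ entry ∧ g.weight p = g.weight c + 1 := by
    intro c hc
    simp only [List.mem_append] at hc
    rcases hc with (hc | hc) | hc
    · exact hpc c (List.mem_of_mem_take hc)
    · obtain ⟨h1, h2, h3⟩ := hxc c hc
      exact ⟨h1, h2, by omega⟩
    · exact hpc c (List.mem_of_mem_drop hc)
  have hex : ∀ z ∈ [x, p], ∀ i y, m.Child z i y → y ∈ [x, p] ∨
      y ∈ pc.take nIdx ++ xc ++ pc.drop (nIdx + 1) := by
    intro z hz i y hy
    simp only [List.mem_cons, List.not_mem_nil, or_false] at hz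
    have hy2 := hy.2
    rcases hz with rfl | rfl
    · rw [hxd] at hy2
      have := mem_ptrs_innerOf.1 ⟨i, hy2⟩
      simp [this]
    · rw [hpd] at hy2
      have := mem_ptrs_innerOf.1 ⟨i, hy2⟩
      rw [take_append_cons_drop hxi] at this
      simp only [List.mem_append, List.mem_singleton] at this ⊢
      rcases this with (h | rfl) | h
      · tauto
      · simp
      · tauto
  have hlen : (pc.take nIdx ++ xc ++ pc.drop (nIdx + 1)).length = pc.length + 1 := by
    simp; omega
  have hsize : (m.node p).data.size = pc.length := by rw [hpd]; rfl
  have hwp : 1 ≤ g.weight p := (hI.node p (hI.once_lt _ hp)).pos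
  simp only [plan]
  rw [hsize]
  simp only [hpd, hxd, routing_innerOf hpl, routing_innerOf hxl, children_innerOf]
  generalize pk.take nIdx ++ xk ++ pk.drop nIdx = ks at hT
  generalize pc.take nIdx ++ xc ++ pc.drop (nIdx + 1) = cs at hT hcs hex hlen
  by_cases hsz : pc.length + 1 ≤ b
  · rw [if_pos hsz]
    refine ⟨_, _, (PartOK.innerOf hI hT (by omega) hwp hcs).fragment rfl hI.next_pos
      (fun _ => rfl) fun z hz i y hy => ?_⟩
    rcases hex z hz i y hy with h | h
    · exact .inl h
    · exact .inr ⟨by decide, mem_ptrs_innerOf.2 h⟩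
  · rw [if_neg hsz]
    obtain ⟨h1, h2, h3, h4⟩ := half_bounds (b := b) hh (n := cs.length) (by omega) (by omega)
    obtain ⟨k', hk', hp1, hp2⟩ := inner_halves (b := b) (g := g) (m := m) hI hT hwp hcs h1 h2 h3 h4
    simp only [hk']
    refine ⟨_, _, Fragment.ofPair hI (ks₁ := []) (ks₂ := []) (cs₁ := []) (cs₂ := [])
      (w₀ := g.weight p + if gp = entry then 1 else 0) ?_ ?_ ?_ ?_ ?_ ?_ hwp ?_ hp1 hp2 ?_⟩
    · split_ifs <;> simp
    · simp
    · simp; omega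
    · intro rg _ e1 e2
      exact .cons e1 (.single e2)
    · simp
    · by_cases hgp : gp = entry <;> simp [hgp]
    · intro hgp
      rw [if_neg hgp, Nat.add_zero]
    · intro z hz i y hy
      rcases hex z hz i y hy with h | h
      · exact .inl h
      · refine .inr (.inr ⟨by decide, ?_⟩)
        rw [← List.take_append_drop (half cs.length) cs, List.mem_append] at h
        exact h.imp mem_ptrs_innerOf.2 mem_ptrs_innerOf.2

theorem Range.Contains.mono {I J : Range K} {k : K} (h : I.Contains k) (h1 : J.left ≤ I.left)
    (h2 : I.right ≤ J.right) : J.Contains k :=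
  ⟨h1.trans h.1, h.2.trans_le h2⟩

/-- The adjacent siblings `l` and `r`, at the indices `i` and `i + 1` of the untagged internal node
`p`, are of the same type. `p` has the contents `innerOf pk pc`, the key between `l` and `r` is `k`,
and `[L, R)` is the union of their ranges. -/
structure Siblings (b : ℕ) (g : Ghost K T) (m : Memory K V T) (p : Addr) (i : ℕ) (l r : Addr)
    (pk : List K) (pc : List Addr) (L : WithBot K) (k : K) (R : WithTop K) : Prop where
  data : (m.node p).data = innerOf pk pc
  length : pc.length = pk.length + 1
  le : pc.length ≤ b
  lt : i + 1 < pc.length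
  key : (pk.drop i).take 1 = [k]
  left : g.range l = ⟨L, (k : WithTop K)⟩
  right : g.range r = ⟨(k : WithBot K), R⟩
  left_lt : L < (k : WithBot K)
  lt_right : (k : WithTop K) < R
  nonempty : (⟨L, R⟩ : Range K).Nonempty
  tiles : ∀ A B (rg : Addr → Range K), (∀ y < m.next, rg y = g.range y) → Tiles rg L R A B →
    Tiles rg (g.range p).left (g.range p).right (pk.take i ++ A ++ pk.drop (i + 1))
      (pc.take i ++ B ++ pc.drop (i + 2))
  once : l ∈ g.once ∧ r ∈ g.once
  ne : l ≠ entry ∧ r ≠ entry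
  weight : g.weight p = g.weight l + 1 ∧ g.weight p = g.weight r + 1 ∧ 1 ≤ g.weight l
  others : ∀ c ∈ pc.take i ++ pc.drop (i + 2), c ∈ g.once ∧ c ≠ entry ∧ g.weight c = g.weight l
  exits : ∀ j y, m.Child p j y → y = l ∨ y = r ∨ y ∈ pc.take i ++ pc.drop (i + 2)
  kinds : ((m.node l).kind = .leaf ∧ (m.node r).kind = .leaf) ∨
    ((m.node l).kind = .internal ∧ (m.node r).kind = .internal)

/-- Adjacent untagged siblings are of the same type because they have the same weight. -/
theorem MInv.siblings (hI : MInv b g m) {l r p : Addr} {i : ℕ} (hp : p ∈ g.once)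
    (hpe : p ≠ entry) (hpk : (m.node p).kind = .internal) (hcl : m.Child p i l)
    (hcr : m.Child p (i + 1) r) (htl : (m.node l).kind ≠ .tagged)
    (htr : (m.node r).kind ≠ .tagged) :
    ∃ pk pc L k R, Siblings b g m p i l r pk pc L k R := by
  obtain ⟨pk, pc, hpd, hpl, hpT, hpb, -, hpc⟩ := hI.inner_lists hp hpe hcl.1
  have hli : pc[i]? = some l := by have := hcl.2; rw [hpd] at this; exact this
  have hri : pc[i + 1]? = some r := by have := hcr.2; rw [hpd] at this; exact this
  have hi : i + 1 < pc.length := (List.getElem?_eq_some_iff.1 hri).1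
  have hpc' : pc = pc.take i ++ [l, r] ++ pc.drop (i + 2) := by
    obtain ⟨h1, h2⟩ := List.getElem?_eq_some_iff.1 hli
    obtain ⟨h3, h4⟩ := List.getElem?_eq_some_iff.1 hri
    conv_lhs => rw [← List.take_append_drop i pc, List.drop_eq_getElem_cons h1,
      List.drop_eq_getElem_cons h3, h2, h4]
    simp
  have hki : i < pk.length := by omega
  have hpk' : pk = pk.take i ++ [pk[i]] ++ pk.drop (i + 1) := by simp
  have hki' : (pk.drop i).take 1 = [pk[i]] := by rw [List.drop_eq_getElem_cons hki]; rfl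
  obtain ⟨L', R', hT1, hT2⟩ : ∃ L' R', Tiles g.range L' R' [pk[i]] [l, r] ∧ ∀ A' B',
      (∀ rg : Addr → Range K, (∀ y < m.next, rg y = g.range y) → Tiles rg L' R' A' B' →
      Tiles rg (g.range p).left (g.range p).right (pk.take i ++ A' ++ pk.drop (i + 1))
        (pc.take i ++ B' ++ pc.drop (i + 2))) := by
    have hpT' := hpT
    rw [hpk', hpc'] at hpT'
    obtain ⟨L', R', h1, -⟩ := hpT'.replace (by simp; omega) (by simp)
    refine ⟨L', R', h1, fun A' B' rg hrg h2 => ?_⟩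
    have h3 : ∀ c ∈ pc.take i ++ [l, r] ++ pc.drop (i + 2), rg c = g.range c := by
      rw [← hpc']
      exact fun c hc => hrg c (hI.once_lt _ (hpc c hc).1)
    obtain ⟨L'', R'', h4, h5⟩ := (hpT'.congr h3).replace (by simp; omega) (by simp)
    -- the range of a run of children is determined by the children
    have h6 : L'' = L' ∧ R'' = R' := by
      have hl := h3 l (by simp)
      have hr := h3 r (by simp)
      cases h1 with
      | cons a1 a2 =>
        cases a2 with
        | single a2 =>
          cases h4 with
          | cons b1 b2 =>
            cases b2 with
            | single b2 =>
              rw [a1, b1] at hl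
              rw [a2, b2] at hr
              cases hl; cases hr; exact ⟨rfl, rfl⟩
    rw [h6.1, h6.2] at h5
    exact h5 _ _ h2
  simp only [hpk, reduceCtorEq, if_false] at hpc
  obtain ⟨hlo, hle, hlw⟩ := hpc l (List.mem_of_getElem? hli)
  obtain ⟨hro, hre, hrw⟩ := hpc r (List.mem_of_getElem? hri)
  have hne : ∀ c ∈ [l, r], (g.range c).Nonempty := by
    intro c hc
    simp only [List.mem_cons, List.not_mem_nil, or_false] at hc
    rcases hc with rfl | rfl
    · exact (hI.node _ (hI.once_lt _ hlo)).nonempty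
    · exact (hI.node _ (hI.once_lt _ hro)).nonempty
  have hbd := (hT1.bounds hne).1 pk[i] (by simp)
  refine ⟨pk, pc, L', pk[i], R', hpd, hpl, hpb, hi, hki', ?_, ?_, hbd.1, hbd.2, hT1.nonempty hne,
    hT2, ⟨hlo, hro⟩, ⟨hle, hre⟩, ⟨hlw, hrw, (hI.node l (hI.once_lt _ hlo)).pos⟩, ?_, ?_, ?_⟩
  · cases hT1 with
    | cons a1 a2 => exact a1
  · cases hT1 with
    | cons a1 a2 =>
      cases a2 with
      | single a2 => exact a2
  · intro c hc
    have : c ∈ pc := by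
      rcases List.mem_append.1 hc with hc | hc
      · exact List.mem_of_mem_take hc
      · exact List.mem_of_mem_drop hc
    obtain ⟨h1, h2, h3⟩ := hpc c this
    exact ⟨h1, h2, by omega⟩
  · intro j y hy
    have hy2 := hy.2
    rw [hpd] at hy2
    have h := mem_ptrs_innerOf.1 ⟨j, hy2⟩
    rw [hpc'] at h
    simp only [List.mem_append, List.mem_cons, List.not_mem_nil, or_false] at h ⊢
    tauto
  · -- the weight is `1` for a leaf, and larger for an untagged internal node
    have key : ∀ y, y ∈ g.once → y ≠ entry → (m.node y).kind = .internal → 2 ≤ g.weight y := by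
      intro y hy hye hyk
      obtain ⟨ks, cs, -, h1, -, -, -, h2⟩ := hI.inner_lists hy hye (by rw [hyk]; decide)
      have h3 : 0 < cs.length := by omega
      obtain ⟨h4, -, h5⟩ := h2 cs[0] (List.getElem_mem h3)
      have h6 := (hI.node _ (hI.once_lt _ h4)).pos
      simp only [hyk, reduceCtorEq, if_false] at h5
      omega
    have keyl : ∀ y, y ∈ g.once → (m.node y).kind = .leaf → g.weight y = 1 := fun y hy hyk =>
      ((hI.node y (hI.once_lt _ hy)).leaf hyk).1
    rcases hkl : (m.node l).kind with _ | _ | _ <;> rcases hkr : (m.node r).kind with _ | _ | _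
    · simp
    · have := key r hro hre hkr; have := keyl l hlo hkl; omega
    · exact absurd hkr htr
    · have := key l hlo hle hkl; have := keyl r hro hkr; omega
    · simp
    · exact absurd hkr htr
    all_goals exact absurd hkl htl

section

variable {p l r gp : Addr} {i : ℕ} {pk : List K} {pc : List Addr} {L : WithBot K} {k : K}
  {R : WithTop K} {removed : List Addr} {kd : Kind}

/-- Two new nodes that share the contents of `l` and `r`, below a copy of `p`. -/
theorem Siblings.fragment_share (hS : Siblings b g m p i l r pk pc L k R) (hI : MInv b g m)
    (hrm : ∀ z, z ∈ removed ↔ z = l ∨ z = r ∨ z = p) {k' : K} {d₁ d₂ : Contents K V}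
    (h₁ : PartOK b g m ⟨L, (k' : WithTop K)⟩ (g.weight l) kd d₁)
    (h₂ : PartOK b g m ⟨(k' : WithBot K), R⟩ (g.weight l) kd d₂)
    (hex : ∀ z, z = l ∨ z = r → ∀ j y, m.Child z j y →
      kd ≠ .leaf ∧ ((∃ j, d₁.ptrs j = some y) ∨ ∃ j, d₂.ptrs j = some y)) :
    ∃ rs ws, Fragment b g m [(.internal, innerOf (pk.take i ++ [k'] ++ pk.drop (i + 1))
      (pc.take i ++ [m.next + 1, m.next + 2] ++ pc.drop (i + 2))), (kd, d₁), (kd, d₂)]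
      gp p removed rs ws := by
  have hlen := hS.length
  have hle := hS.le
  have hlt := hS.lt
  refine ⟨_, _, Fragment.ofPair hI (w₀ := g.weight p) (by decide) (by simp) (by simp; omega) ?_
    hS.others (by simpa using hS.weight.1) hS.weight.2.2 (fun _ => rfl) h₁ h₂ ?_⟩
  · intro rg hrg e1 e2
    exact hS.tiles _ _ rg hrg (.cons e1 (.single e2))
  · intro z hz j y hy
    rcases (hrm z).1 hz with h | h | rfl
    · exact .inr (.inr (hex z (.inl h) j y hy))
    · exact .inr (.inr (hex z (.inr h) j y hy))
    · rcases hS.exits j y hy with h | h | h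
      · exact .inl ((hrm y).2 (.inl h))
      · exact .inl ((hrm y).2 (.inr (.inl h)))
      · exact .inr (.inl h)

/-- A new node with the contents of `l` and `r`, below a copy of `p`. -/
theorem Siblings.fragment_merge (hS : Siblings b g m p i l r pk pc L k R) (hI : MInv b g m)
    (hrm : ∀ z, z ∈ removed ↔ z = l ∨ z = r ∨ z = p) {d : Contents K V}
    (h₁ : PartOK b g m ⟨L, R⟩ (g.weight l) kd d)
    (hex : ∀ z, z = l ∨ z = r → ∀ j y, m.Child z j y → kd ≠ .leaf ∧ ∃ j, d.ptrs j = some y) :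
    ∃ rs ws, Fragment b g m [(.internal, innerOf (pk.take i ++ pk.drop (i + 1))
      (pc.take i ++ [m.next + 1] ++ pc.drop (i + 2))), (kd, d)] gp p removed rs ws := by
  have hlen := hS.length
  have hle := hS.le
  have hlt := hS.lt
  refine ⟨three (g.range p) ⟨L, R⟩ ⟨L, R⟩, three (g.weight p) (g.weight l) (g.weight l),
    Fragment.ofParts hI (parts := [(⟨L, R⟩, d)]) (w₀ := g.weight p) (w₁ := g.weight l) rfl ?_ rfl
    ?_ (by decide) (by simp) (by simp; omega) ?_ ?_ ?_ (by simpa using hS.weight.1) hS.weight.2.2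
    (fun _ => rfl) ?_ ?_⟩
  · intro j q hq
    match j, hq with
    | 0, hq => cases (show ((⟨L, R⟩ : Range K), d) = q by simpa using hq); rfl
    | j + 1, hq => simp at hq
  · intro j
    cases j <;> rfl
  · have := hS.tiles [] [m.next + 1] _ (fun y hy => extend_lt hy) (.single (extend_add
      (f' := three (g.range p) ⟨L, R⟩ ⟨L, R⟩) 1))
    simpa using this
  · intro c hc
    have hcs := hS.others
    simp only [List.mem_append, List.mem_cons, List.not_mem_nil, or_false] at hc hcs
    rcases hc with (hc | rfl) | hc
    · exact .inl (hcs c (.inl hc))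
    · exact .inr ⟨0, by simp, rfl⟩
    · exact .inl (hcs c (.inr hc))
  · intro j hj
    obtain rfl : j = 0 := by simpa using hj
    simp
  · intro q hq
    rw [List.mem_singleton.1 hq]
    exact h₁
  · intro z hz j y hy
    rcases (hrm z).1 hz with h | h | rfl
    · obtain ⟨h1, h2⟩ := hex z (.inl h) j y hy
      exact .inr (.inr ⟨h1, _, List.mem_singleton_self _, h2⟩)
    · obtain ⟨h1, h2⟩ := hex z (.inr h) j y hy
      exact .inr (.inr ⟨h1, _, List.mem_singleton_self _, h2⟩)
    · rcases hS.exits j y hy with h | h | h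
      · exact .inl ((hrm y).2 (.inl h))
      · exact .inl ((hrm y).2 (.inr (.inl h)))
      · right; left
        simp only [List.mem_append] at h ⊢
        tauto

/-- A new node with the contents of `l` and `r`, as the new root. -/
theorem Siblings.fragment_root (hS : Siblings b g m p i l r pk pc L k R) (hI : MInv b g m)
    (hrm : ∀ z, z ∈ removed ↔ z = l ∨ z = r ∨ z = p) {d : Contents K V}
    (h₁ : PartOK b g m ⟨L, R⟩ (g.weight l) kd d) (hp2 : pc.length = 2)
    (hex : ∀ z, z = l ∨ z = r → ∀ j y, m.Child z j y → kd ≠ .leaf ∧ ∃ j, d.ptrs j = some y) :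
    ∃ rs ws, Fragment b g m [(kd, d)] entry p removed rs ws := by
  have hlt := hS.lt
  have hi : i = 0 := by omega
  have hlen := hS.length
  have hr : g.range p = ⟨L, R⟩ := by
    -- the run that consists of `l` and `r` is the whole list of children of `p`
    have := hS.tiles [k] [l, r] _ (fun _ _ => rfl) (.cons hS.left (.single hS.right))
    subst hi
    rw [List.drop_of_length_le (by omega), List.drop_of_length_le (by omega)] at this
    simp only [List.take_zero, List.nil_append, List.append_nil] at this
    rcases hgp : g.range p with ⟨L', R'⟩
    rw [hgp] at this
    cases this with
    | cons a1 a2 =>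
      cases a2 with
      | single a2 =>
        have e1 := hS.left.symm.trans a1
        have e2 := hS.right.symm.trans a2
        cases e1; cases e2; rfl
  refine ⟨_, _, h₁.fragment hr hI.next_pos (fun h => absurd rfl h) fun z hz j y hy => ?_⟩
  rcases (hrm z).1 hz with h | h | rfl
  · exact .inr (hex z (.inl h) j y hy)
  · exact .inr (hex z (.inr h) j y hy)
  · rcases hS.exits j y hy with h | h | h
    · exact .inl ((hrm y).2 (.inl h))
    · exact .inl ((hrm y).2 (.inr (.inl h)))
    · rw [List.drop_of_length_le (by omega), hi] at h
      simp at h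

/-- The contents of two leaves, as the contents of one new leaf, or of two. -/
theorem Siblings.leaf_parts (hS : Siblings b g m p i l r pk pc L k R) (hI : MInv b g m)
    (hkl : (m.node l).kind = .leaf) (hkr : (m.node r).kind = .leaf)
    (hsl : (m.node l).data.size = (m.node l).data.numKeys b)
    (hsr : (m.node r).data.size = (m.node r).data.numKeys b) :
    let es := (m.node l).data.entries b ++ (m.node r).data.entries b
    es.length = (m.node l).data.size + (m.node r).data.size ∧ es.length ≤ 2 * b ∧
    (es.length ≤ b → PartOK b g m ⟨L, R⟩ (g.weight l) .leaf (leafOf es)) ∧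
    ∀ h, 0 < h → h < es.length → h ≤ b → es.length - h ≤ b → ∃ k' : K,
      (((sortEntries es).drop h).map Prod.fst).take 1 = [k'] ∧
      PartOK b g m ⟨L, (k' : WithTop K)⟩ (g.weight l) .leaf (leafOf ((sortEntries es).take h)) ∧
      PartOK b g m ⟨(k' : WithBot K), R⟩ (g.weight l) .leaf
        (leafOf ((sortEntries es).drop h)) := by
  intro es
  obtain ⟨hw1, hlf⟩ := (hI.node l (hI.once_lt _ hS.once.1)).leaf hkl
  obtain ⟨-, hrf⟩ := (hI.node r (hI.once_lt _ hS.once.2)).leaf hkr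
  have hmem : ∀ e ∈ es, (⟨L, R⟩ : Range K).Contains e.1 := by
    intro e he
    rcases List.mem_append.1 he with he | he
    · obtain ⟨j, -, hj⟩ := mem_entries he
      have := hlf.mem j _ hj
      rw [hS.left] at this
      exact this.mono le_rfl hS.lt_right.le
    · obtain ⟨j, -, hj⟩ := mem_entries he
      have := hrf.mem j _ hj
      rw [hS.right] at this
      exact this.mono hS.left_lt.le le_rfl
  have hnd : (es.map Prod.fst).Nodup := by
    rw [List.map_append, List.nodup_append]
    refine ⟨entries_nodup hlf.inj, entries_nodup hrf.inj, ?_⟩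
    rintro k1 h1 k2 h2 rfl
    obtain ⟨e, he, rfl⟩ := List.mem_map.1 h1
    obtain ⟨e', he', hee⟩ := List.mem_map.1 h2
    obtain ⟨j, -, hj⟩ := mem_entries he
    obtain ⟨j', -, hj'⟩ := mem_entries he'
    rw [hee] at hj'
    have q1 := (hlf.mem j _ hj).2
    have q2 := (hrf.mem j' _ hj').1
    rw [hS.left] at q1
    rw [hS.right] at q2
    exact absurd (WithTop.coe_lt_coe.1 q1) (not_lt.2 (WithBot.coe_le_coe.1 q2))
  have hlen2 : es.length = (m.node l).data.size + (m.node r).data.size := by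
    rw [List.length_append, entries_length, entries_length, hsl, hsr]
  have hnb : ∀ y, (m.node y).data.numKeys b ≤ b := by
    intro y
    refine (Finset.card_filter_le _ _).trans ?_
    rw [Finset.card_range]
  have hn1 := hnb l
  have hn2 := hnb r
  refine ⟨hlen2, by omega, fun hb => ?_, fun h h1 h2 h3 h4 => ?_⟩
  · rw [hw1]; exact .leafOf hb hnd hmem hS.nonempty
  · rw [hw1]
    exact leaf_halves hnd hmem h1 h2 h3 h4

/-- The contents of two internal nodes, as the contents of one new internal node, or of two. -/
theorem Siblings.inner_parts (hS : Siblings b g m p i l r pk pc L k R) (hI : MInv b g m)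
    (hkl : (m.node l).kind = .internal) (hkr : (m.node r).kind = .internal) :
    let ks := (m.node l).data.routing ++ [k] ++ (m.node r).data.routing
    let cs := (m.node l).data.children ++ (m.node r).data.children
    cs.length = (m.node l).data.size + (m.node r).data.size ∧ cs.length ≤ 2 * b ∧
    (∀ z, z = l ∨ z = r → ∀ j y, m.Child z j y → y ∈ cs) ∧
    (cs.length ≤ b → PartOK b g m ⟨L, R⟩ (g.weight l) .internal (innerOf ks cs)) ∧
    ∀ h, 0 < h → h < cs.length → h ≤ b → cs.length - h ≤ b → ∃ k' : K,
      (ks.drop (h - 1)).take 1 = [k'] ∧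
      PartOK b g m ⟨L, (k' : WithTop K)⟩ (g.weight l) .internal
        (innerOf (ks.take (h - 1)) (cs.take h)) ∧
      PartOK b g m ⟨(k' : WithBot K), R⟩ (g.weight l) .internal
        (innerOf (ks.drop h) (cs.drop h)) := by
  intro ks cs
  obtain ⟨lk, lc, hld, hll, hlT, hlb, -, hlc⟩ :=
    hI.inner_lists hS.once.1 hS.ne.1 (by rw [hkl]; decide)
  obtain ⟨rk, rc, hrd, hrl, hrT, hrb, -, hrc⟩ :=
    hI.inner_lists hS.once.2 hS.ne.2 (by rw [hkr]; decide)
  obtain ⟨hw1, hw2, hw3⟩ := hS.weight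
  have eks : ks = lk ++ [k] ++ rk := by
    show (m.node l).data.routing ++ [k] ++ (m.node r).data.routing = _
    rw [hld, hrd, routing_innerOf hll, routing_innerOf hrl]
  have ecs : cs = lc ++ rc := by
    show (m.node l).data.children ++ (m.node r).data.children = _
    rw [hld, hrd, children_innerOf, children_innerOf]
  have hsl : (m.node l).data.size = lc.length := by rw [hld]; rfl
  have hsr : (m.node r).data.size = rc.length := by rw [hrd]; rfl
  simp only [hkl, hkr, reduceCtorEq, if_false] at hlc hrc
  have hT : Tiles g.range L R ks cs := by
    rw [eks, ecs, List.append_assoc]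
    rw [hS.left] at hlT
    rw [hS.right] at hrT
    exact hlT.append hrT
  have hcs : ∀ c ∈ cs, c ∈ g.once ∧ c ≠ entry ∧ g.weight l = g.weight c + 1 := by
    intro c hc
    rw [ecs] at hc
    rcases List.mem_append.1 hc with hc | hc
    · exact hlc c hc
    · obtain ⟨h1, h2, h3⟩ := hrc c hc
      exact ⟨h1, h2, by omega⟩
  have hlen : cs.length = lc.length + rc.length := by rw [ecs, List.length_append]
  refine ⟨by omega, by omega, ?_, fun hb => .innerOf hI hT hb hw3 hcs,
    fun h h1 h2 h3 h4 => inner_halves hI hT hw3 hcs h1 h2 h3 h4⟩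
  rintro z (rfl | rfl) j y hy
  · have hy2 := hy.2
    rw [hld] at hy2
    rw [ecs]
    exact List.mem_append_left _ (mem_ptrs_innerOf.1 ⟨j, hy2⟩)
  · have hy2 := hy.2
    rw [hrd] at hy2
    rw [ecs]
    exact List.mem_append_right _ (mem_ptrs_innerOf.1 ⟨j, hy2⟩)

end

/-- The new nodes of `fixUnderfull` can replace the node, its sibling, and their parent. -/
theorem fragment_underfull (hI : MInv b g m) (hh : ∀ n, half n = n / 2 ∨ half n = (n + 1) / 2)
    (ha : 2 ≤ a) (hab : 2 * a ≤ b) {x s p gp : Addr} {nIdx sIdx pIdx : ℕ} (hp : p ∈ g.once)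
    (hpe : p ≠ entry) (hpk : (m.node p).kind = .internal) (hx : m.Child p nIdx x)
    (hs : m.Child p sIdx s) (hsi : sIdx = if nIdx = 0 then 1 else nIdx - 1)
    (hxk : (m.node x).kind ≠ .tagged) (hsk : (m.node s).kind ≠ .tagged)
    (hxs : (m.node x).kind = .leaf → (m.node x).data.size = (m.node x).data.numKeys b)
    (hss : (m.node s).kind = .leaf → (m.node s).data.size = (m.node s).data.numKeys b) :
    ∃ rs ws, Fragment b g m (plan a b half (fun x => (m.node x).kind)
      (fun x => (m.node x).data) m.next (.underfull x s p gp nIdx sIdx pIdx)).news gp p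
      [x, s, p] rs ws := by
  -- `l` and `r` are the left and the right one of `x` and `s`
  obtain ⟨l, hl⟩ : ∃ l, l = if nIdx < sIdx then x else s := ⟨_, rfl⟩
  obtain ⟨r, hr⟩ : ∃ r, r = if nIdx < sIdx then s else x := ⟨_, rfl⟩
  obtain ⟨i, hi⟩ : ∃ i, i = min nIdx sIdx := ⟨_, rfl⟩
  have hlr : (l = x ∧ r = s) ∨ (l = s ∧ r = x) := by rw [hl, hr]; split_ifs <;> simp
  have hpl : m.Child p i l ∧ m.Child p (i + 1) r := by
    rcases Nat.eq_zero_or_pos nIdx with h0 | h0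
    · rw [if_pos h0] at hsi
      rw [if_pos (by omega)] at hl hr
      rw [hl, hr, hi, show min nIdx sIdx = nIdx by omega, show nIdx + 1 = sIdx by omega]
      exact ⟨hx, hs⟩
    · rw [if_neg (by omega)] at hsi
      rw [if_neg (by omega)] at hl hr
      rw [hl, hr, hi, show min nIdx sIdx = sIdx by omega, show sIdx + 1 = nIdx by omega]
      exact ⟨hs, hx⟩
  have hsum : (m.node x).data.size + (m.node s).data.size =
      (m.node l).data.size + (m.node r).data.size := by
    rcases hlr with ⟨rfl, rfl⟩ | ⟨rfl, rfl⟩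
    · rfl
    · exact Nat.add_comm _ _
  have hrm : ∀ z, z ∈ [x, s, p] ↔ z = l ∨ z = r ∨ z = p := by
    intro z
    simp only [List.mem_cons, List.not_mem_nil, or_false]
    rcases hlr with ⟨rfl, rfl⟩ | ⟨rfl, rfl⟩ <;> tauto
  have htag : (m.node l).kind ≠ .tagged ∧ (m.node r).kind ≠ .tagged := by
    rcases hlr with ⟨rfl, rfl⟩ | ⟨rfl, rfl⟩
    · exact ⟨hxk, hsk⟩
    · exact ⟨hsk, hxk⟩
  have hsz : ((m.node l).kind = .leaf → (m.node l).data.size = (m.node l).data.numKeys b) ∧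
      ((m.node r).kind = .leaf → (m.node r).data.size = (m.node r).data.numKeys b) := by
    rcases hlr with ⟨rfl, rfl⟩ | ⟨rfl, rfl⟩
    · exact ⟨hxs, hss⟩
    · exact ⟨hss, hxs⟩
  have hmemx : x = l ∨ x = r := by rcases hlr with ⟨rfl, rfl⟩ | ⟨rfl, rfl⟩ <;> simp
  simp only [plan]
  rw [← hl, ← hr, ← hi, hsum]
  clear hl hr hi hsum hlr hx hs hsi hxk hsk hxs hss
  obtain ⟨pk, pc, L, k, R, hS⟩ := hI.siblings hp hpe hpk hpl.1 hpl.2 htag.1 htag.2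
  have hkx : (m.node x).kind = (m.node l).kind := by
    rcases hmemx with rfl | rfl <;> rcases hS.kinds with h | h <;> simp [h.1, h.2]
  have hsize : (m.node p).data.size = pc.length := by rw [hS.data]; rfl
  have hrt : (m.node p).data.routing = pk := by rw [hS.data, routing_innerOf hS.length]
  have hch : (m.node p).data.children = pc := by rw [hS.data, children_innerOf]
  rw [hkx, hsize, hrt, hch, hS.key]
  rcases hS.kinds with ⟨hkl, hkr⟩ | ⟨hkl, hkr⟩
  · obtain ⟨h1, h2, h3, h4⟩ := hS.leaf_parts hI hkl hkr (hsz.1 hkl) (hsz.2 hkr)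
    have hex : ∀ z, z = l ∨ z = r → ∀ j y, ¬ m.Child z j y := by
      rintro z (rfl | rfl) j y hy
      · exact hy.1 hkl
      · exact hy.1 hkr
    simp only [hkl, if_true]
    generalize (m.node l).data.entries b ++ (m.node r).data.entries b = es at h1 h2 h3 h4
    by_cases hshare : 2 * a ≤ (m.node l).data.size + (m.node r).data.size
    · rw [if_pos hshare]
      obtain ⟨q1, q2, q3, q4⟩ := half_bounds (b := b) hh (n := es.length) (by omega) h2
      obtain ⟨k', hk', hp1, hp2⟩ := h4 _ q1 q2 q3 q4
      rw [hk']
      exact hS.fragment_share hI hrm hp1 hp2 fun z hz j y hy => absurd hy (hex z hz j y)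
    · rw [if_neg hshare]
      have hp1 := h3 (by omega)
      by_cases hroot : gp = entry ∧ pc.length = 2
      · rw [if_pos hroot, hroot.1]
        exact hS.fragment_root hI hrm hp1 hroot.2 fun z hz j y hy => absurd hy (hex z hz j y)
      · rw [if_neg hroot]
        exact hS.fragment_merge hI hrm hp1 fun z hz j y hy => absurd hy (hex z hz j y)
  · obtain ⟨h1, h2, hex, h3, h4⟩ := hS.inner_parts hI hkl hkr
    simp only [hkl, reduceCtorEq, if_false]
    generalize (m.node l).data.routing ++ [k] ++ (m.node r).data.routing = ks at h3 h4
    generalize (m.node l).data.children ++ (m.node r).data.children = cs at h1 h2 hex h3 h4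
    by_cases hshare : 2 * a ≤ (m.node l).data.size + (m.node r).data.size
    · rw [if_pos hshare]
      obtain ⟨q1, q2, q3, q4⟩ := half_bounds (b := b) hh (n := cs.length) (by omega) h2
      obtain ⟨k', hk', hp1, hp2⟩ := h4 _ q1 q2 q3 q4
      rw [hk']
      refine hS.fragment_share hI hrm hp1 hp2 fun z hz j y hy => ⟨by decide, ?_⟩
      have h := hex z hz j y hy
      rw [← List.take_append_drop (half cs.length) cs, List.mem_append] at h
      exact h.imp mem_ptrs_innerOf.2 mem_ptrs_innerOf.2
    · rw [if_neg hshare]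
      have hp1 := h3 (by omega)
      by_cases hroot : gp = entry ∧ pc.length = 2
      · rw [if_pos hroot, hroot.1]
        exact hS.fragment_root hI hrm hp1 hroot.2 fun z hz j y hy =>
          ⟨by decide, mem_ptrs_innerOf.2 (hex z hz j y hy)⟩
      · rw [if_neg hroot]
        exact hS.fragment_merge hI hrm hp1 fun z hz j y hy =>
          ⟨by decide, mem_ptrs_innerOf.2 (hex z hz j y hy)⟩

end Plans

/-! ### The invariant of a thread -/

section ThreadInvariant

variable {K V T : Type*}

/-- The node whose pointer an update overwrites. -/
def Update.target : Update K V → Addr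
  | .split _ _ _ p _ => p
  | .tagged _ _ gp _ _ => gp
  | .underfull _ _ _ gp _ _ _ => gp

/-- The locks that are already held when an update begins to acquire locks. -/
def Update.initialLocks : Update K V → List Addr
  | .split _ _ leaf _ _ => [leaf]
  | _ => []

/-- The nodes whose locks a thread holds at a program point. -/
def PC.held : PC K V → List Addr
  | .insMarked _ _ path => [path.n]
  | .insScan _ _ path _ => [path.n]
  | .insFound path _ => [path.n]
  | .insSize _ _ path => [path.n]
  | .insEmpty _ _ path _ => [path.n]
  | .insBegin _ _ leaf _ => [leaf]
  | .insKey _ _ leaf _ => [leaf]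
  | .insVal _ leaf _ => [leaf]
  | .insInc leaf => [leaf]
  | .insEnd leaf => [leaf]
  | .delMarked _ leaf => [leaf]
  | .delScan _ leaf _ => [leaf]
  | .delVal leaf _ => [leaf]
  | .delBegin leaf _ => [leaf]
  | .delKey leaf _ => [leaf]
  | .delDec leaf => [leaf]
  | .delEnd leaf => [leaf]
  | .delSize leaf => [leaf]
  | .acquire u todo => u.locks.take (u.locks.length - todo.length)
  | .test u _ => u.locks
  | .premark u _ => u.locks
  | .copy u _ _ => u.locks
  | .link u _ _ _ => u.locks
  | .postmark u _ => u.locks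
  | .release todo _ => todo
  | _ => []

/-- The nodes that a thread has unlinked and is about to mark. -/
def PC.unlinked : PC K V → List Addr
  | .postmark _ todo => todo
  | _ => []

/-- The leaf whose keys array a thread has changed, without having adjusted its size yet. -/
def PC.resizing : PC K V → List Addr
  | .insVal _ leaf _ => [leaf]
  | .insInc leaf => [leaf]
  | .delDec leaf => [leaf]
  | _ => []

/-- The locked nodes that a thread may have changed since it locked them. -/
def PC.dirty : PC K V → List Addr
  | .insVal _ leaf _ => [leaf]
  | .insInc leaf => [leaf]
  | .insEnd leaf => [leaf]
  | .delDec leaf => [leaf]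
  | .delEnd leaf => [leaf]
  | .delSize leaf => [leaf]
  | .postmark u _ => [u.target]
  | .release todo _ => todo
  | _ => []

/-- `n` is the child of `p` at index `i`, or it was and has been unlinked. In contrast to being a
child, this is never lost. -/
def Edge (g : Ghost K T) (m : Memory K V T) (p : Addr) (i : ℕ) (n : Addr) : Prop :=
  (m.node p).data.ptrs i = some n ∨ n ∈ g.dead

/-- `p` is an internal node, once reachable, with a current or former child `n` at index `i`. -/
def Parent (g : Ghost K T) (m : Memory K V T) (p : Addr) (i : ℕ) (n : Addr) : Prop :=
  p ∈ g.once ∧ (m.node p).kind ≠ .leaf ∧ Edge g m p i n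

/-- The nodes on the path are current or former children of one another. -/
def PathOK (g : Ghost K T) (m : Memory K V T) (path : Path) : Prop :=
  path.n ∈ g.once ∧ (∀ p, path.p = some p → Parent g m p path.nIdx path.n) ∧
    ∀ gp, path.gp = some gp → ∃ p, path.p = some p ∧ Parent g m gp path.pIdx p

/-- The condition on the path within an iteration of the outer loop of `search`, when `p` is already
equal to `n`. -/
def DescentOK (g : Ghost K T) (m : Memory K V T) (path : Path) : Prop :=
  path.n ∈ g.once ∧ (m.node path.n).kind ≠ .leaf ∧ path.p = some path.n ∧
    ∀ gp, path.gp = some gp → Parent g m gp path.pIdx path.n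

/-- A rebalancing routine is applied to an allocated node. -/
def RoutineOK (m : Memory K V T) : Routine K V → Prop
  | .fixTagged x => x < m.next
  | .fixUnderfull x => x < m.next
  | _ => True

/-- The arguments with which a routine calls `search`. -/
def SearchArgs (m : Memory K V T) (key : K) (target : Option Addr) : Routine K V → Prop
  | .find k => k = key ∧ target = none
  | .insert k _ => k = key ∧ target = none
  | .delete k => k = key ∧ target = none
  | .fixTagged x => x < m.next ∧ (m.node x).kind = .tagged
  | .fixUnderfull x => x < m.next

variable [LinearOrder K]

/-- The search for `key` has ended in the leaf `path.n`. -/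
def LeafPath (g : Ghost K T) (m : Memory K V T) (key : K) (path : Path) : Prop :=
  PathOK g m path ∧ (m.node path.n).kind = .leaf ∧ (g.range path.n).Contains key

/-- An unmarked leaf. -/
def LiveLeaf (g : Ghost K T) (m : Memory K V T) (x : Addr) : Prop :=
  x ∈ g.once ∧ (m.node x).kind = .leaf ∧ (m.node x).marked = false

/-- What an update knows about its nodes before it tests them. -/
def Update.OK (b : ℕ) (g : Ghost K T) (m : Memory K V T) : Update K V → Prop
  | .split k _ leaf p nIdx => LiveLeaf g m leaf ∧ (g.range leaf).Contains k ∧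
      (∀ i, (m.node leaf).data.keys i ≠ some k) ∧ b ≤ (m.node leaf).data.size ∧
      Parent g m p nIdx leaf
  | .tagged x p gp nIdx pIdx => (m.node x).kind = .tagged ∧ x ∈ g.once ∧
      Parent g m p nIdx x ∧ Parent g m gp pIdx p
  | .underfull x s p gp nIdx sIdx pIdx => (x ∈ g.once ∧ s ∈ g.once) ∧ Parent g m p nIdx x ∧
      Parent g m p sIdx s ∧ Parent g m gp pIdx p ∧ sIdx = if nIdx = 0 then 1 else nIdx - 1

/-- What an update knows about its nodes, whose locks it holds, after it has tested them. -/
def Update.Tested (m : Memory K V T) : Update K V → Prop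
  | .split _ _ leaf p nIdx =>
      (m.node p).data.ptrs nIdx = some leaf ∧ (m.node p).marked = false
  | .tagged x p gp nIdx pIdx => (m.node p).data.ptrs nIdx = some x ∧
      (m.node gp).data.ptrs pIdx = some p ∧ (m.node gp).marked = false ∧
      (m.node p).kind ≠ .tagged
  | .underfull x s p gp nIdx sIdx pIdx => (m.node p).data.ptrs nIdx = some x ∧
      (m.node p).data.ptrs sIdx = some s ∧ (m.node gp).data.ptrs pIdx = some p ∧
      (m.node gp).marked = false ∧ (m.node x).kind ≠ .tagged ∧ (m.node s).kind ≠ .tagged ∧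
      (m.node p).kind ≠ .tagged

/-- The cell `c` has the same contents in `d` and `d'`. -/
def Cell.Same (d d' : Contents K V) : Cell → Prop
  | .size => d.size = d'.size
  | .key i => d.keys i = d'.keys i
  | .val i => d.vals i = d'.vals i
  | .ptr i => d.ptrs i = d'.ptrs i

/-- Thread `t` has created the new nodes of the update `u`, the first one of which is `new`, and is
going to write `new` into the pointer of `x` at index `i`, in place of `r`. -/
structure LinkReady (g : Ghost K T) (m : Memory K V T) (t : T) (u : Update K V) (x : Addr)
    (i : ℕ) (new r : Addr) : Prop where
  target : x = u.target
  kind : (m.node x).kind ≠ .leaf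
  unmarked : (m.node x).marked = false
  not_source : x ∉ u.sources
  source : r ∈ u.sources
  ptr : (m.node x).data.ptrs i = some r
  range : g.range new = g.range r
  weight : x ≠ entry → g.weight new = g.weight r
  sources : ∀ z ∈ u.sources, z ≠ r → ∃ j, m.Child r j z
  owner : g.owner new = some t
  reach : ∀ y, g.owner y = some t → y ≠ new → ∃ j, m.Child new j y
  closed : ∀ y, g.owner y = some t → ∀ j c, m.Child y j c → c ∈ g.once ∨ g.owner c = some t
  exits : ∀ z ∈ u.sources, ∀ j y, m.Child z j y → y ∈ u.sources ∨
    ∃ y' j', g.owner y' = some t ∧ m.Child y' j' y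
  marks : ∀ z ∈ u.sources, (m.node z).marked = true ∨ z ∈ u.postmarks

/-- What thread `t` knows at a program point. -/
def PCInv (a b : ℕ) (g : Ghost K T) (m : Memory K V T) (t : T) : PC K V → Prop
  | .idle => True
  | .ret => True
  | .start r => RoutineOK m r
  | .retry r => RoutineOK m r
  | .search r key target path pt =>
      SearchArgs m key target r ∧ (g.range path.n).Contains key ∧
      match pt with
      | .head => PathOK g m path
      | .size => DescentOK g m path ∧ path.nIdx < (m.node path.n).data.size ∧
          (childRange (m.node path.n).data (g.range path.n) path.nIdx).left ≤ (key : WithBot K)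
      | .key => DescentOK g m path ∧ path.nIdx + 1 < (m.node path.n).data.size ∧
          (childRange (m.node path.n).data (g.range path.n) path.nIdx).left ≤ (key : WithBot K)
      | .ptr => DescentOK g m path ∧
          (childRange (m.node path.n).data (g.range path.n) path.nIdx).Contains key
  | .leafVer r key path => (∀ k v, r = .insert k v → k = key) ∧ LeafPath g m key path
  | .leafKey r key path _ _ => (∀ k v, r = .insert k v → k = key) ∧ LeafPath g m key path
  | .leafVal r key path _ _ => (∀ k v, r = .insert k v → k = key) ∧ LeafPath g m key path
  | .leafVer2 r key path _ _ => (∀ k v, r = .insert k v → k = key) ∧ LeafPath g m key path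
  | .insLock k _ path => LeafPath g m k path
  | .insMarked k _ path => LeafPath g m k path
  | .insScan k _ path i => LeafPath g m k path ∧ (m.node path.n).marked = false ∧
      ∀ j < i, (m.node path.n).data.keys j ≠ some k
  | .insFound path _ => path.n ∈ g.once
  | .insSize k _ path => LeafPath g m k path ∧ (m.node path.n).marked = false ∧
      ∀ j, (m.node path.n).data.keys j ≠ some k
  | .insEmpty k _ path _ => LeafPath g m k path ∧ (m.node path.n).marked = false ∧
      ∀ j, (m.node path.n).data.keys j ≠ some k
  | .insBegin k _ leaf i => LiveLeaf g m leaf ∧ (g.range leaf).Contains k ∧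
      (∀ j, (m.node leaf).data.keys j ≠ some k) ∧ i < b ∧ (m.node leaf).data.keys i = none
  | .insKey k _ leaf i => LiveLeaf g m leaf ∧ (g.range leaf).Contains k ∧
      (∀ j, (m.node leaf).data.keys j ≠ some k) ∧ i < b ∧ (m.node leaf).data.keys i = none
  | .insVal _ leaf _ => LiveLeaf g m leaf ∧
      (m.node leaf).data.numKeys b = (m.node leaf).data.size + 1
  | .insInc leaf => LiveLeaf g m leaf ∧
      (m.node leaf).data.numKeys b = (m.node leaf).data.size + 1
  | .insEnd leaf => LiveLeaf g m leaf
  | .delLock _ leaf => leaf ∈ g.once ∧ (m.node leaf).kind = .leaf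
  | .delMarked _ leaf => leaf ∈ g.once ∧ (m.node leaf).kind = .leaf
  | .delScan _ leaf _ => LiveLeaf g m leaf
  | .delVal leaf i => LiveLeaf g m leaf ∧ i < b ∧ ((m.node leaf).data.keys i).isSome
  | .delBegin leaf i => LiveLeaf g m leaf ∧ i < b ∧ ((m.node leaf).data.keys i).isSome
  | .delKey leaf i => LiveLeaf g m leaf ∧ i < b ∧ ((m.node leaf).data.keys i).isSome
  | .delDec leaf => LiveLeaf g m leaf ∧
      (m.node leaf).data.size = (m.node leaf).data.numKeys b + 1
  | .delEnd leaf => LiveLeaf g m leaf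
  | .delSize leaf => LiveLeaf g m leaf
  | .sibling x p gp nIdx sIdx pIdx => x ∈ g.once ∧ Parent g m p nIdx x ∧
      Parent g m gp pIdx p ∧ sIdx = if nIdx = 0 then 1 else nIdx - 1
  | .acquire u todo => u.OK b g m ∧ ∃ done, u.locks = u.initialLocks ++ done ++ todo
  | .test u todo => u.OK b g m ∧ ∀ c ∈ u.tests, c ∈ todo ∨ c.holds a m = true
  | .premark u todo => u.OK b g m ∧ u.Tested m ∧ (∀ x ∈ todo, x ∈ u.premarks) ∧
      ∀ x ∈ u.premarks, x ∈ todo ∨ (m.node x).marked = true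
  | .copy u todo buf => u.OK b g m ∧ u.Tested m ∧
      (∀ x ∈ u.premarks, (m.node x).marked = true) ∧
      ∀ x ∈ u.sources, ∀ c ∈ cells b, (x, c) ∈ todo ∨ c.Same (buf x) (m.node x).data
  | .link u x i new => ∃ r, LinkReady g m t u x i new r
  | .postmark u todo => ∀ x ∈ todo, x ∈ u.postmarks
  | .release _ after => after = .ret ∨ ∃ r, after = .retry r ∧ RoutineOK m r

/-! ### Stability under the steps of other threads -/

/-- What is never lost in a step. -/
structure Extends (g : Ghost K T) (m : Memory K V T) (g' : Ghost K T) (m' : Memory K V T) :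
    Prop where
  next_le : m.next ≤ m'.next
  kind : ∀ x < m.next, (m'.node x).kind = (m.node x).kind
  range : ∀ x < m.next, g'.range x = g.range x
  weight : ∀ x < m.next, g'.weight x = g.weight x
  once : ∀ x ∈ g.once, x ∈ g'.once
  dead : ∀ x ∈ g.dead, x ∈ g'.dead
  inner : ∀ x < m.next, (m.node x).kind ≠ .leaf →
    (m'.node x).data.keys = (m.node x).data.keys ∧ (m'.node x).data.size = (m.node x).data.size
  ptrs : ∀ x < m.next, ∀ i n, (m.node x).data.ptrs i = some n →
    (m'.node x).data.ptrs i = some n ∨ n ∈ g'.dead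

variable {a b : ℕ} {g g' : Ghost K T} {m m' : Memory K V T} {t : T}

theorem Extends.parent (hE : Extends g m g' m') (hI : MInv b g m) {p n : Addr} {i : ℕ}
    (h : Parent g m p i n) : Parent g' m' p i n := by
  obtain ⟨h1, h2, h3⟩ := h
  have hp := hI.once_lt _ h1
  refine ⟨hE.once _ h1, by rwa [hE.kind _ hp], ?_⟩
  rcases h3 with h3 | h3
  · exact hE.ptrs _ hp _ _ h3
  · exact .inr (hE.dead _ h3)

theorem Extends.pathOK (hE : Extends g m g' m') (hI : MInv b g m) {path : Path}
    (h : PathOK g m path) : PathOK g' m' path := by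
  obtain ⟨h1, h2, h3⟩ := h
  refine ⟨hE.once _ h1, fun p hp => hE.parent hI (h2 p hp), fun gp hgp => ?_⟩
  obtain ⟨p, hp, h4⟩ := h3 gp hgp
  exact ⟨p, hp, hE.parent hI h4⟩

theorem Extends.descentOK (hE : Extends g m g' m') (hI : MInv b g m) {path : Path}
    (h : DescentOK g m path) : DescentOK g' m' path := by
  obtain ⟨h1, h2, h3, h4⟩ := h
  exact ⟨hE.once _ h1, by rwa [hE.kind _ (hI.once_lt _ h1)], h3,
    fun gp hgp => hE.parent hI (h4 gp hgp)⟩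

theorem Extends.leafPath (hE : Extends g m g' m') (hI : MInv b g m) {path : Path} {key : K}
    (h : LeafPath g m key path) : LeafPath g' m' key path := by
  obtain ⟨h1, h2, h3⟩ := h
  have hn := hI.once_lt _ h1.1
  exact ⟨hE.pathOK hI h1, by rwa [hE.kind _ hn], by rwa [hE.range _ hn]⟩

theorem Extends.routineOK (hE : Extends g m g' m') {r : Routine K V} (h : RoutineOK m r) :
    RoutineOK m' r := by
  cases r <;> first | trivial | exact lt_of_lt_of_le h hE.next_le

theorem Extends.searchArgs (hE : Extends g m g' m') {r : Routine K V} {key : K}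
    {target : Option Addr} (h : SearchArgs m key target r) : SearchArgs m' key target r := by
  cases r with
  | fixTagged x => exact ⟨h.1.trans_le hE.next_le, (hE.kind _ h.1).trans h.2⟩
  | fixUnderfull x => exact lt_of_lt_of_le h hE.next_le
  | _ => exact h

theorem Extends.childRange (hE : Extends g m g' m') {x : Addr} (hx : x < m.next)
    (hk : (m.node x).kind ≠ .leaf) (i : ℕ) :
    childRange (m'.node x).data (g'.range x) i = childRange (m.node x).data (g.range x) i := by
  unfold OCCABTree.childRange
  rw [hE.range x hx, (hE.inner x hx hk).1]

theorem Extends.liveLeaf (hE : Extends g m g' m') (hI : MInv b g m) {x : Addr}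
    (h : LiveLeaf g m x) (hm : (m'.node x).marked = (m.node x).marked) : LiveLeaf g' m' x := by
  obtain ⟨h1, h2, h3⟩ := h
  exact ⟨hE.once _ h1, by rwa [hE.kind _ (hI.once_lt _ h1)], by rwa [hm]⟩

theorem Update.sources_subset (u : Update K V) : ∀ x ∈ u.sources, x ∈ u.locks := by
  intro x hx
  cases u <;> simp only [Update.sources, Update.locks] at hx ⊢
  · simp only [List.mem_cons, List.not_mem_nil, or_false] at hx ⊢; tauto
  · simp only [List.mem_cons, List.not_mem_nil, or_false] at hx ⊢; tauto
  · split_ifs <;> (simp only [List.mem_cons, List.not_mem_nil, or_false] at hx ⊢; tauto)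

theorem Update.target_mem (u : Update K V) : u.target ∈ u.locks := by
  cases u <;> simp only [Update.target, Update.locks]
  · simp
  · simp
  · split_ifs <;> simp

theorem Update.premarks_subset (u : Update K V) : ∀ x ∈ u.premarks, x ∈ u.sources := by
  cases u <;> simp [Update.sources, Update.premarks]

theorem Update.postmarks_subset (u : Update K V) : ∀ x ∈ u.postmarks, x ∈ u.sources := by
  intro x hx
  cases u <;> simp [Update.sources, Update.postmarks] at hx ⊢ <;> tauto

theorem Update.OK.frame {u : Update K V} (hE : Extends g m g' m') (hI : MInv b g m)
    (hK : ∀ x ∈ u.initialLocks, (m'.node x).data = (m.node x).data ∧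
      (m'.node x).marked = (m.node x).marked) (h : u.OK b g m) : u.OK b g' m' := by
  cases u with
  | split k v leaf p nIdx =>
      obtain ⟨h1, h2, h3, h4, h5⟩ := h
      obtain ⟨e1, e2⟩ := hK leaf (List.mem_singleton_self _)
      refine ⟨hE.liveLeaf hI h1 e2, ?_, ?_, ?_, hE.parent hI h5⟩
      · rwa [hE.range _ (hI.once_lt _ h1.1)]
      · rwa [e1]
      · rwa [e1]
  | tagged x p gp nIdx pIdx =>
      obtain ⟨h1, h2, h3, h4⟩ := h
      exact ⟨(hE.kind _ (hI.once_lt _ h2)).trans h1, hE.once _ h2, hE.parent hI h3,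
        hE.parent hI h4⟩
  | underfull x s p gp nIdx sIdx pIdx =>
      obtain ⟨h1, h2, h3, h4, h5⟩ := h
      exact ⟨⟨hE.once _ h1.1, hE.once _ h1.2⟩, hE.parent hI h2, hE.parent hI h3,
        hE.parent hI h4, h5⟩

/-- The facts that an update has tested are not lost when other nodes change, or when nodes other
than its target are marked. -/
theorem Update.Tested.frame {u : Update K V}
    (hK : ∀ x ∈ u.locks, (m'.node x).data = (m.node x).data ∧
      (m'.node x).kind = (m.node x).kind)
    (hm : (m'.node u.target).marked = (m.node u.target).marked)
    (h : u.Tested m) : u.Tested m' := by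
  cases u with
  | split k v leaf p nIdx =>
      have e := (hK p (by simp [Update.locks])).1
      simp only [Update.Tested] at h ⊢
      rw [e, show (m'.node p).marked = _ from hm]
      exact h
  | tagged x p gp nIdx pIdx =>
      have e1 := hK p (by simp [Update.locks])
      have e2 := hK gp (by simp [Update.locks])
      simp only [Update.Tested] at h ⊢
      rw [e1.1, e1.2, e2.1, show (m'.node gp).marked = _ from hm]
      exact h
  | underfull x s p gp nIdx sIdx pIdx =>
      have hl : ∀ y, y = x ∨ y = s ∨ y = p ∨ y = gp →
          y ∈ (Update.underfull x s p gp nIdx sIdx pIdx : Update K V).locks := by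
        intro y hy
        simp only [Update.locks]
        split_ifs <;> (simp only [List.mem_cons, List.not_mem_nil, or_false]; tauto)
      have e1 := hK p (hl p (by simp))
      have e2 := hK gp (hl gp (by simp))
      have e3 := hK x (hl x (by simp))
      have e4 := hK s (hl s (by simp))
      simp only [Update.Tested] at h ⊢
      rw [e1.1, e1.2, e2.1, e3.2, e4.2, show (m'.node gp).marked = _ from hm]
      exact h

theorem Test.holds_congr {u : Update K V} {c : Test} (hc : c ∈ u.tests)
    (hK : ∀ x ∈ u.locks, (m'.node x).data = (m.node x).data ∧
      (m'.node x).kind = (m.node x).kind ∧ (m'.node x).marked = (m.node x).marked) :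
    c.holds a m' = c.holds a m := by
  have key : ∀ x ∈ u.locks, c = .sizeBelow x ∨ c = .sizeNotBelow x ∨ c = .unmarked x ∨
      c = .untagged x → c.holds a m' = c.holds a m := by
    intro x hx h
    obtain ⟨e1, e2, e3⟩ := hK x hx
    rcases h with rfl | rfl | rfl | rfl <;> simp only [Test.holds, e1, e2, e3]
  cases u with
  | split k v leaf p nIdx =>
      simp only [Update.tests, List.mem_singleton] at hc
      exact key p (by simp [Update.locks]) (by simp [hc])
  | tagged x p gp nIdx pIdx =>
      simp only [Update.tests, List.mem_cons, List.not_mem_nil, or_false] at hc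
      rcases hc with h | h | h | h
      · exact key x (by simp [Update.locks]) (by simp [h])
      · exact key p (by simp [Update.locks]) (by simp [h])
      · exact key gp (by simp [Update.locks]) (by simp [h])
      · exact key p (by simp [Update.locks]) (by simp [h])
  | underfull x s p gp nIdx sIdx pIdx =>
      have hl : ∀ y, y = x ∨ y = s ∨ y = p ∨ y = gp →
          y ∈ (Update.underfull x s p gp nIdx sIdx pIdx : Update K V).locks := by
        intro y hy
        simp only [Update.locks]
        split_ifs <;> (simp only [List.mem_cons, List.not_mem_nil, or_false]; tauto)
      simp only [Update.tests, List.mem_cons, List.not_mem_nil, or_false] at hc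
      rcases hc with h | h | h | h | h | h | h | h | h
      · exact key x (hl _ (by simp)) (by simp [h])
      · exact key p (hl _ (by simp)) (by simp [h])
      · exact key x (hl _ (by simp)) (by simp [h])
      · exact key s (hl _ (by simp)) (by simp [h])
      · exact key p (hl _ (by simp)) (by simp [h])
      · exact key gp (hl _ (by simp)) (by simp [h])
      · exact key x (hl _ (by simp)) (by simp [h])
      · exact key s (hl _ (by simp)) (by simp [h])
      · exact key p (hl _ (by simp)) (by simp [h])

theorem LinkReady.frame {u : Update K V} {x new r : Addr} {i : ℕ} (hE : Extends g m g' m')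
    (hK : ∀ x ∈ u.locks, x < m.next ∧ (m'.node x).data = (m.node x).data ∧
      (m'.node x).marked = (m.node x).marked)
    (hO : ∀ x, g'.owner x = some t ↔ g.owner x = some t)
    (hD : ∀ x, g.owner x = some t → x < m.next ∧ (m'.node x).data = (m.node x).data)
    (h : LinkReady g m t u x i new r) : LinkReady g' m' t u x i new r := by
  have hx : x ∈ u.locks := h.target ▸ u.target_mem
  have hr := u.sources_subset r h.source
  have hchild : ∀ y, y < m.next ∧ (m'.node y).data = (m.node y).data → ∀ j c,
      (m'.Child y j c ↔ m.Child y j c) := by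
    intro y hy j c
    unfold Memory.Child
    rw [hy.2, hE.kind y hy.1]
  have hlk : ∀ y ∈ u.sources, ∀ j c, (m'.Child y j c ↔ m.Child y j c) := fun y hy =>
    hchild y ⟨(hK y (u.sources_subset y hy)).1, (hK y (u.sources_subset y hy)).2.1⟩
  have hnew := (hD new h.owner).1
  exact
    { target := h.target
      kind := by rw [hE.kind x (hK x hx).1]; exact h.kind
      unmarked := by rw [(hK x hx).2.2]; exact h.unmarked
      not_source := h.not_source
      source := h.source
      ptr := by rw [(hK x hx).2.1]; exact h.ptr
      range := by rw [hE.range _ hnew, hE.range _ (hK r hr).1]; exact h.range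
      weight := by rw [hE.weight _ hnew, hE.weight _ (hK r hr).1]; exact h.weight
      sources := fun z hz hzr => by
        obtain ⟨j, hj⟩ := h.sources z hz hzr
        exact ⟨j, (hlk r h.source j z).2 hj⟩
      owner := (hO new).2 h.owner
      reach := fun y hy hyn => by
        obtain ⟨j, hj⟩ := h.reach y ((hO y).1 hy) hyn
        exact ⟨j, (hchild new (hD new h.owner) j y).2 hj⟩
      closed := fun y hy j c hc => by
        have hy' := (hO y).1 hy
        exact (h.closed y hy' j c ((hchild y (hD y hy') j c).1 hc)).imp (hE.once c) (hO c).2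
      exits := fun z hz j y hy => by
        rcases h.exits z hz j y ((hlk z hz j y).1 hy) with h1 | ⟨y', j', h1, h2⟩
        · exact .inl h1
        · exact .inr ⟨y', j', (hO y').2 h1, (hchild y' (hD y' h1) j' y).2 h2⟩
      marks := fun z hz => by
        rw [(hK z (u.sources_subset z hz)).2.2]; exact h.marks z hz }

/-- The invariant of a thread is not lost when nodes change that the thread has neither locked nor
created. -/
theorem PCInv.frame (hE : Extends g m g' m') (hI : MInv b g m) {pc : PC K V}
    (hH : ∀ x ∈ pc.held, x ∈ g.once)
    (hK : ∀ x ∈ pc.held, (m'.node x).data = (m.node x).data ∧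
      (m'.node x).marked = (m.node x).marked)
    (hO : ∀ x, g'.owner x = some t ↔ g.owner x = some t)
    (hD : ∀ x, g.owner x = some t → (m'.node x).data = (m.node x).data)
    (h : PCInv a b g m t pc) : PCInv a b g' m' t pc := by
  have hlt : ∀ x ∈ pc.held, x < m.next := fun x hx => hI.once_lt _ (hH x hx)
  cases pc with
  | idle => trivial
  | ret => trivial
  | start r => exact hE.routineOK h
  | retry r => exact hE.routineOK h
  | search r key target path pt =>
      obtain ⟨h1, h2, h3⟩ := h
      cases pt with
      | head =>
          refine ⟨hE.searchArgs h1, ?_, hE.pathOK hI h3⟩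
          rwa [hE.range _ (hI.once_lt _ h3.1)]
      | ptr =>
          obtain ⟨h4, h5⟩ := h3
          have hn := hI.once_lt _ h4.1
          refine ⟨hE.searchArgs h1, ?_, hE.descentOK hI h4, ?_⟩
          · rwa [hE.range _ hn]
          · rwa [hE.childRange hn h4.2.1]
      | _ =>
          obtain ⟨h4, h5, h6⟩ := h3
          have hn := hI.once_lt _ h4.1
          refine ⟨hE.searchArgs h1, ?_, hE.descentOK hI h4, ?_, ?_⟩
          · rwa [hE.range _ hn]
          · rwa [(hE.inner _ hn h4.2.1).2]
          · rwa [hE.childRange hn h4.2.1]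
  | leafVer r key path => exact ⟨h.1, hE.leafPath hI h.2⟩
  | leafKey r key path _ _ => exact ⟨h.1, hE.leafPath hI h.2⟩
  | leafVal r key path _ _ => exact ⟨h.1, hE.leafPath hI h.2⟩
  | leafVer2 r key path _ _ => exact ⟨h.1, hE.leafPath hI h.2⟩
  | insLock k v path => exact hE.leafPath hI h
  | insMarked k v path => exact hE.leafPath hI h
  | insScan k v path i =>
      obtain ⟨e1, e2⟩ := hK path.n (List.mem_singleton_self _)
      obtain ⟨h1, h2, h3⟩ := h
      exact ⟨hE.leafPath hI h1, by rwa [e2], by rwa [e1]⟩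
  | insFound path i => exact hE.once _ h
  | insSize k v path =>
      obtain ⟨e1, e2⟩ := hK path.n (List.mem_singleton_self _)
      obtain ⟨h1, h2, h3⟩ := h
      exact ⟨hE.leafPath hI h1, by rwa [e2], by rwa [e1]⟩
  | insEmpty k v path i =>
      obtain ⟨e1, e2⟩ := hK path.n (List.mem_singleton_self _)
      obtain ⟨h1, h2, h3⟩ := h
      exact ⟨hE.leafPath hI h1, by rwa [e2], by rwa [e1]⟩
  | insBegin k v leaf i =>
      obtain ⟨e1, e2⟩ := hK leaf (List.mem_singleton_self _)
      obtain ⟨h1, h2, h3⟩ := h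
      exact ⟨hE.liveLeaf hI h1 e2, by rwa [hE.range _ (hI.once_lt _ h1.1)], by rwa [e1]⟩
  | insKey k v leaf i =>
      obtain ⟨e1, e2⟩ := hK leaf (List.mem_singleton_self _)
      obtain ⟨h1, h2, h3⟩ := h
      exact ⟨hE.liveLeaf hI h1 e2, by rwa [hE.range _ (hI.once_lt _ h1.1)], by rwa [e1]⟩
  | insVal v leaf i =>
      obtain ⟨e1, e2⟩ := hK leaf (List.mem_singleton_self _)
      exact ⟨hE.liveLeaf hI h.1 e2, by rw [e1]; exact h.2⟩
  | insInc leaf =>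
      obtain ⟨e1, e2⟩ := hK leaf (List.mem_singleton_self _)
      exact ⟨hE.liveLeaf hI h.1 e2, by rw [e1]; exact h.2⟩
  | insEnd leaf => exact hE.liveLeaf hI h (hK leaf (List.mem_singleton_self _)).2
  | delLock k leaf =>
      exact ⟨hE.once _ h.1, by rw [hE.kind _ (hI.once_lt _ h.1)]; exact h.2⟩
  | delMarked k leaf =>
      exact ⟨hE.once _ h.1, by rw [hE.kind _ (hI.once_lt _ h.1)]; exact h.2⟩
  | delScan k leaf i => exact hE.liveLeaf hI h (hK leaf (List.mem_singleton_self _)).2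
  | delVal leaf i =>
      obtain ⟨e1, e2⟩ := hK leaf (List.mem_singleton_self _)
      exact ⟨hE.liveLeaf hI h.1 e2, by rw [e1]; exact h.2⟩
  | delBegin leaf i =>
      obtain ⟨e1, e2⟩ := hK leaf (List.mem_singleton_self _)
      exact ⟨hE.liveLeaf hI h.1 e2, by rw [e1]; exact h.2⟩
  | delKey leaf i =>
      obtain ⟨e1, e2⟩ := hK leaf (List.mem_singleton_self _)
      exact ⟨hE.liveLeaf hI h.1 e2, by rw [e1]; exact h.2⟩
  | delDec leaf =>
      obtain ⟨e1, e2⟩ := hK leaf (List.mem_singleton_self _)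
      exact ⟨hE.liveLeaf hI h.1 e2, by rw [e1]; exact h.2⟩
  | delEnd leaf => exact hE.liveLeaf hI h (hK leaf (List.mem_singleton_self _)).2
  | delSize leaf => exact hE.liveLeaf hI h (hK leaf (List.mem_singleton_self _)).2
  | sibling x p gp nIdx sIdx pIdx =>
      obtain ⟨h1, h2, h3, h4⟩ := h
      exact ⟨hE.once _ h1, hE.parent hI h2, hE.parent hI h3, h4⟩
  | acquire u todo =>
      obtain ⟨h1, done, h2⟩ := h
      refine ⟨h1.frame hE hI fun x hx => hK x ?_, done, h2⟩
      simp only [PC.held, h2]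
      rw [List.take_left' (by simp; omega)]
      exact List.mem_append_left _ hx
  | test u todo =>
      obtain ⟨h1, h2⟩ := h
      refine ⟨h1.frame hE hI fun x hx => hK x ?_, fun c hc => ?_⟩
      · cases u <;> simp [Update.initialLocks, Update.locks, PC.held] at hx ⊢
        simp [hx]
      · refine (h2 c hc).imp_right fun h3 => ?_
        rw [Test.holds_congr hc fun x hx => ⟨(hK x hx).1, hE.kind x (hlt x hx), (hK x hx).2⟩]
        exact h3
  | premark u todo =>
      obtain ⟨h1, h2, h3, h4⟩ := h
      refine ⟨h1.frame hE hI fun x hx => hK x ?_,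
        h2.frame (fun x hx => ⟨(hK x hx).1, hE.kind x (hlt x hx)⟩) (hK _ u.target_mem).2, h3,
        fun x hx => ?_⟩
      · cases u <;> simp [Update.initialLocks, Update.locks, PC.held] at hx ⊢
        simp [hx]
      · rw [(hK x (u.sources_subset x (u.premarks_subset x hx))).2]
        exact h4 x hx
  | copy u todo buf =>
      obtain ⟨h1, h2, h3, h4⟩ := h
      refine ⟨h1.frame hE hI fun x hx => hK x ?_,
        h2.frame (fun x hx => ⟨(hK x hx).1, hE.kind x (hlt x hx)⟩) (hK _ u.target_mem).2,
        fun x hx => ?_, fun x hx => ?_⟩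
      · cases u <;> simp [Update.initialLocks, Update.locks, PC.held] at hx ⊢
        simp [hx]
      · rw [(hK x (u.sources_subset x (u.premarks_subset x hx))).2]
        exact h3 x hx
      · rw [(hK x (u.sources_subset x hx)).1]
        exact h4 x hx
  | link u x i new =>
      obtain ⟨r, h⟩ := h
      exact ⟨r, h.frame hE (fun x hx => ⟨hlt x hx, hK x hx⟩) hO
        fun x hx => ⟨(hI.owner_lt x t hx).1, hD x hx⟩⟩
  | postmark u todo => exact h
  | release todo after =>
      rcases h with h | ⟨r, h1, h2⟩
      · exact .inl h
      · exact .inr ⟨r, h1, hE.routineOK h2⟩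

end ThreadInvariant

/-! ### The effect of a pointer write and of an allocation on the memory -/

section MemoryEffects

variable {K V T : Type*} [LinearOrder K] {a b : ℕ} {g : Ghost K T} {m m' : Memory K V T} {t : T}

theorem Memory.Reachable.congr (hm : ∀ x i c, m.Child x i c → m'.Child x i c) {x : Addr}
    (h : m.Reachable x) : m'.Reachable x := by
  induction h with
  | refl => exact .refl
  | tail _ h2 ih => obtain ⟨i, hi⟩ := h2; exact ih.tail ⟨i, hm _ i _ hi⟩

/-- The invariant of the memory does not depend on locks, marks and versions. -/
theorem MInv.congr (h : MInv b g m) (hn : m'.next = m.next)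
    (hm : ∀ x, (m'.node x).kind = (m.node x).kind ∧ (m'.node x).data = (m.node x).data) :
    MInv b g m' := by
  have hc : ∀ x i c, m'.Child x i c ↔ m.Child x i c := by
    intro x i c
    unfold Memory.Child
    rw [(hm x).1, (hm x).2]
  exact
    { h with
      entry_kind := by rw [(hm _).1]; exact h.entry_kind
      entry_size := by rw [(hm _).2]; exact h.entry_size
      once_lt := fun x hx => by rw [hn]; exact h.once_lt x hx
      owner_lt := fun x t hx => by rw [hn]; exact h.owner_lt x t hx
      node := fun x hx => by
        rw [hn] at hx ⊢
        rw [(hm _).1, (hm _).2]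
        exact h.node x hx
      closed := fun x hx i c hxc => h.closed x hx i c ((hc x i c).1 hxc)
      live := fun x hx hd => (h.live x hx hd).congr fun x i c => (hc x i c).2 }

theorem MInv.modifyLeaf (h : MInv b g m) {x : Addr} {f : Contents K V → Contents K V}
    (hx : (m.node x).kind = .leaf) (hf : LeafOK b (g.range x) (f (m.node x).data)) :
    MInv b g (m.modifyData x f) := by
  have hk : ∀ y, ((m.modifyData x f).node y).kind = (m.node y).kind := by
    intro y
    by_cases hy : y = x
    · subst hy; simp [Memory.modifyData, Memory.modify]
    · simp [Memory.modifyData, Memory.modify, hy]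
  have hd : ∀ y, y ≠ x → ((m.modifyData x f).node y).data = (m.node y).data := by
    intro y hy
    simp [Memory.modifyData, Memory.modify, hy]
  have hdx : ((m.modifyData x f).node x).data = f (m.node x).data := by
    simp [Memory.modifyData, Memory.modify]
  have hc : ∀ y i c, (m.modifyData x f).Child y i c ↔ m.Child y i c := by
    intro y i c
    unfold Memory.Child
    rw [hk]
    by_cases hy : y = x
    · subst hy; simp [hx]
    · rw [hd y hy]
  have hex : entry ≠ x := by
    rintro rfl
    have := h.entry_kind
    rw [hx] at this
    cases this
  exact
    { h with
      entry_kind := by rw [hk]; exact h.entry_kind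
      entry_size := by rw [hd _ hex]; exact h.entry_size
      node := fun y hy => by
        have hN := h.node y hy
        rw [hk]
        by_cases hyx : y = x
        · subst hyx
          rw [hdx]
          exact ⟨hN.pos, hN.nonempty, fun _ => ⟨(hN.leaf hx).1, hf⟩, fun h => absurd hx h⟩
        · rw [hd y hyx]; exact hN
      closed := fun y hy i c hyc => h.closed y hy i c ((hc y i c).1 hyc)
      live := fun y hy hd => (h.live y hy hd).congr fun y i c => (hc y i c).2 }

/-- The auxiliary data after thread `t` has linked its new nodes, in place of `removed`. -/
def Ghost.link [DecidableEq T] (g : Ghost K T) (t : T) (removed : List Addr) : Ghost K T :=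
  { g with
    once := {x | x ∈ g.once ∨ g.owner x = some t}
    dead := {x | x ∈ g.dead ∨ x ∈ removed}
    owner := fun x => if g.owner x = some t then none else g.owner x }

/-- The write of `new` into the pointer of `x` at index `i`. -/
def Memory.link (m : Memory K V T) (x : Addr) (i : ℕ) (new : Addr) : Memory K V T :=
  m.modifyData x fun d => { d with ptrs := Function.update d.ptrs i (some new) }

theorem Memory.link_of_ne {x y : Addr} {i : ℕ} {new : Addr} (h : y ≠ x) :
    (m.link x i new).node y = m.node y := by
  simp [Memory.link, Memory.modifyData, Memory.modify, h]

theorem Memory.link_self {x : Addr} {i : ℕ} {new : Addr} :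
    (m.link x i new).node x = { m.node x with
      data := { (m.node x).data with ptrs := Function.update (m.node x).data.ptrs i (some new) } } := by
  simp [Memory.link, Memory.modifyData, Memory.modify]

theorem Memory.link_kind {x y : Addr} {i : ℕ} {new : Addr} :
    ((m.link x i new).node y).kind = (m.node y).kind := by
  by_cases h : y = x
  · subst h; rw [Memory.link_self]
  · rw [Memory.link_of_ne h]

theorem Memory.link_child {x y c : Addr} {i j : ℕ} {new : Addr} (h : m.Child y j c)
    (hne : ¬ (y = x ∧ j = i)) : (m.link x i new).Child y j c := by
  refine ⟨by rw [Memory.link_kind]; exact h.1, ?_⟩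
  by_cases hy : y = x
  · subst hy
    rw [Memory.link_self]
    have hj : j ≠ i := fun hj => hne ⟨rfl, hj⟩
    simpa [hj] using h.2
  · rw [Memory.link_of_ne hy]; exact h.2

theorem Memory.child_of_link {x y c : Addr} {i j : ℕ} {new : Addr}
    (h : (m.link x i new).Child y j c) : m.Child y j c ∨ (y = x ∧ c = new) := by
  have h1 := h.1
  have h2 := h.2
  rw [Memory.link_kind] at h1
  by_cases hy : y = x
  · subst hy
    rw [Memory.link_self] at h2
    by_cases hj : j = i
    · subst hj
      right
      exact ⟨rfl, by simpa using h2.symm⟩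
    · left
      exact ⟨h1, by simpa [hj] using h2⟩
  · rw [Memory.link_of_ne hy] at h2
    exact .inl ⟨h1, h2⟩

theorem innerOf_update_ptrs {ks : List K} {cs : List Addr} {i : ℕ} {c : Addr}
    (hi : i < cs.length) :
    ({ (innerOf ks cs : Contents K V) with
      ptrs := Function.update (innerOf ks cs : Contents K V).ptrs i (some c) } : Contents K V) =
      innerOf ks (cs.set i c) := by
  unfold innerOf
  simp only [List.length_set, Contents.mk.injEq, true_and, and_true]
  funext j
  by_cases hj : j = i
  · subst hj; simp [hi]
  · simp [hj, List.getElem?_set_ne (Ne.symm hj)]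

/-- The pointer write of an update keeps the reachable nodes that it does not remove reachable, and
makes its new nodes reachable. As parents are unique, a path from the sentinel node can enter the
set of the removed nodes only from the target `x`, and it can leave this set only to a child of a
new node. -/
theorem MInv.reachable_link (h : MInv b g m) {u : Update K V} {x new r : Addr} {i : ℕ}
    (hL : LinkReady g m t u x i new r) (hx : m.Reachable x) :
    (∀ y, m.Reachable y → y ∉ u.sources → (m.link x i new).Reachable y) ∧
      ∀ y, g.owner y = some t → (m.link x i new).Reachable y := by
  have hxo := h.once_of_reachable hx
  have hxr : m.Child x i r := ⟨hL.kind, hL.ptr⟩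
  have hr : m.Reachable r := hx.tail ⟨i, hxr⟩
  have hown : ∀ y, g.owner y = some t → y ≠ x := by
    rintro y hy rfl
    exact (h.owner_lt y t hy).2 hxo
  have hnewx : (m.link x i new).Child x i new :=
    ⟨by rw [Memory.link_kind]; exact hL.kind, by rw [Memory.link_self]; simp⟩
  -- once `x` is reachable, the new nodes are
  have hnew : (m.link x i new).Reachable x → ∀ y, g.owner y = some t →
      (m.link x i new).Reachable y := by
    intro hx' y hy
    have h1 : (m.link x i new).Reachable new := hx'.tail ⟨i, hnewx⟩
    by_cases hyn : y = new
    · rw [hyn]; exact h1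
    · obtain ⟨j, hj⟩ := hL.reach y hy hyn
      exact h1.tail ⟨j, Memory.link_child hj fun hh => hown new hL.owner hh.1⟩
  have key : ∀ y, m.Reachable y → (y ∉ u.sources → (m.link x i new).Reachable y) ∧
      (y ∈ u.sources → (m.link x i new).Reachable x) := by
    intro y hy
    induction hy with
    | refl =>
        refine ⟨fun _ => .refl, fun he => ?_⟩
        by_cases her : entry = r
        · rw [← her] at hxr
          exact absurd hxr (h.not_child_entry hxo)
        · obtain ⟨j, hj⟩ := hL.sources _ he her
          exact absurd hj (h.not_child_entry (h.once_of_reachable hr))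
    | @tail z y hz hzy ih =>
        obtain ⟨j, hj⟩ := hzy
        have htree := h.isTree.2
        constructor
        · intro hys
          by_cases hzs : z ∈ u.sources
          · have hx' := ih.2 hzs
            rcases hL.exits z hzs j y hj with h1 | ⟨y', j', h1, h2⟩
            · exact absurd h1 hys
            · exact (hnew hx' y' h1).tail ⟨j', Memory.link_child h2 fun hh => hown y' h1 hh.1⟩
          · refine (ih.1 hzs).tail ⟨j, Memory.link_child hj ?_⟩
            rintro ⟨rfl, rfl⟩
            have : y = r := Option.some_injective _ (hj.2.symm.trans hxr.2)
            exact hys (this ▸ hL.source)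
        · intro hys
          by_cases hyr : y = r
          · subst hyr
            obtain ⟨rfl, rfl⟩ := htree z j x i y hz hx hj hxr
            exact ih.1 hL.not_source
          · obtain ⟨j', hj'⟩ := hL.sources y hys hyr
            obtain ⟨rfl, -⟩ := htree z j r j' y hz hr hj hj'
            exact ih.2 hL.source
  exact ⟨fun y hy => (key y hy).1, hnew ((key x hx).1 hL.not_source)⟩

theorem MInv.link [DecidableEq T] (h : MInv b g m) {u : Update K V} {x new r : Addr} {i : ℕ}
    (hL : LinkReady g m t u x i new r) (hxo : x ∈ g.once) (hxd : x ∉ g.dead)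
    (hs : ∀ y ∈ u.sources, y ∈ g.once) :
    MInv b (g.link t u.sources) (m.link x i new) := by
  have hx := h.live x hxo hxd
  obtain ⟨hreach, hnew⟩ := h.reachable_link hL hx
  have hxl := h.once_lt x hxo
  have hxr : m.Child x i r := ⟨hL.kind, hL.ptr⟩
  have hnl := h.owner_lt new t hL.owner
  exact
    { entry_once := .inl h.entry_once
      entry_kind := by rw [Memory.link_kind]; exact h.entry_kind
      entry_size := by
        by_cases he : entry = x
        · rw [he, Memory.link_self, ← he]; exact h.entry_size
        · rw [Memory.link_of_ne he]; exact h.entry_size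
      entry_range := h.entry_range
      entry_live := by
        rintro (he | he)
        · exact h.entry_live he
        · by_cases her : entry = r
          · rw [← her] at hxr
            exact h.not_child_entry hxo hxr
          · obtain ⟨j, hj⟩ := hL.sources _ he her
            exact h.not_child_entry (h.closed x hxo i r hxr) hj
      once_lt := by
        rintro y (hy | hy)
        · exact h.once_lt y hy
        · exact (h.owner_lt y t hy).1
      dead_once := by
        rintro y (hy | hy)
        · exact .inl (h.dead_once y hy)
        · exact .inl (hs y hy)
      owner_lt := by
        intro y t' hy
        simp only [Ghost.link] at hy
        split_ifs at hy with hyt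
        obtain ⟨h1, h2⟩ := h.owner_lt y t' hy
        exact ⟨h1, fun h3 => h3.elim h2 hyt⟩
      node := by
        intro y hy
        have hN := h.node y hy
        rw [Memory.link_kind]
        by_cases hyx : y = x
        · subst hyx
          refine ⟨hN.pos, hN.nonempty, fun hh => absurd hh hL.kind, fun hk => ?_⟩
          obtain ⟨ks, cs, h1, h2, h3, h4, h5⟩ := hN.inner hk
          have hi := hL.ptr
          rw [h1] at hi
          have hi' := (List.getElem?_eq_some_iff.1 hi).1
          refine ⟨ks, cs.set i new, ?_, h2.set hi hL.range, by simpa using h3,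
            by simpa using h4, fun c hc => ?_⟩
          · rw [Memory.link_self]
            simp only
            rw [h1]
            exact innerOf_update_ptrs hi'
          · rcases List.mem_or_eq_of_mem_set hc with hc | rfl
            · exact h5 c hc
            · refine ⟨hnl.1, fun he => hnl.2 (he ▸ h.entry_once), (h.node c hnl.1).nonempty, ?_⟩
              intro hy
              rw [show (g.link t u.sources).weight = g.weight from rfl, hL.weight hy]
              exact (h5 r (List.mem_of_getElem? hi)).2.2.2 hy
        · rw [Memory.link_of_ne hyx]; exact hN
      closed := by
        rintro y (hy | hy) j c hc
        · rcases Memory.child_of_link hc with h1 | ⟨-, rfl⟩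
          · exact .inl (h.closed y hy j c h1)
          · exact .inr hL.owner
        · rcases Memory.child_of_link hc with h1 | ⟨-, rfl⟩
          · exact hL.closed y hy j c h1
          · exact .inr hL.owner
      live := by
        rintro y (hy | hy) hyd
        · exact hreach y (h.live y hy fun hh => hyd (.inl hh)) fun hh => hyd (.inr hh)
        · exact hnew y hy }

theorem Extends.link [DecidableEq T] {u : Update K V} {x new r : Addr} {i : ℕ}
    (hL : LinkReady g m t u x i new r) :
    Extends g m (g.link t u.sources) (m.link x i new) where
  next_le := le_rfl
  kind := fun y _ => Memory.link_kind
  range := fun _ _ => rfl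
  weight := fun _ _ => rfl
  once := fun _ hy => .inl hy
  dead := fun _ hy => .inl hy
  inner := by
    intro y _ _
    by_cases hy : y = x
    · subst hy; rw [Memory.link_self]; exact ⟨rfl, rfl⟩
    · rw [Memory.link_of_ne hy]; exact ⟨rfl, rfl⟩
  ptrs := by
    intro y _ j n hn
    by_cases hy : y = x
    · subst hy
      by_cases hj : j = i
      · subst hj
        rw [hL.ptr] at hn
        cases hn
        exact .inr (.inr hL.source)
      · left; rw [Memory.link_self]; simpa [hj] using hn
    · left; rw [Memory.link_of_ne hy]; exact hn

/-- The auxiliary data after thread `t` has created `n` new nodes from address `next` on. They are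
made the only nodes with owner `t`. -/
def Ghost.alloc [DecidableEq T] (g : Ghost K T) (next n : ℕ) (rs : ℕ → Range K) (ws : ℕ → ℕ)
    (t : T) : Ghost K T :=
  { g with
    range := extend next g.range rs
    weight := extend next g.weight ws
    owner := fun x => if next ≤ x ∧ x < next + n then some t
      else if g.owner x = some t then none else g.owner x }

theorem Memory.alloc_lt {sk : ℕ → K} {news : List (Kind × Contents K V)} {x : Addr}
    (h : x < m.next) : (m.alloc sk news).node x = m.node x := by
  simp [Memory.alloc, h]

theorem Memory.alloc_add {sk : ℕ → K} {news : List (Kind × Contents K V)} {j : ℕ} {kd : Kind}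
    {d : Contents K V} (h : news[j]? = some (kd, d)) :
    (m.alloc sk news).node (m.next + j) = ⟨kd, sk j, d, 0, false, none⟩ := by
  simp [Memory.alloc, h]

theorem exists_offset {next n x : ℕ} (h1 : next ≤ x) (h2 : x < next + n) :
    ∃ j < n, x = next + j := ⟨x - next, by omega, by omega⟩

theorem Memory.alloc_child {sk : ℕ → K} {news : List (Kind × Contents K V)} {x c : Addr} {i : ℕ}
    (h : x < m.next) : (m.alloc sk news).Child x i c ↔ m.Child x i c := by
  unfold Memory.Child
  rw [Memory.alloc_lt h]

theorem MInv.alloc [DecidableEq T] (h : MInv b g m) {news : List (Kind × Contents K V)}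
    {target r : Addr} {removed : List Addr} {rs : ℕ → Range K} {ws : ℕ → ℕ}
    (hF : Fragment b g m news target r removed rs ws) (sk : ℕ → K) :
    MInv b (g.alloc m.next news.length rs ws t) (m.alloc sk news) := by
  have hel := h.once_lt _ h.entry_once
  exact
    { entry_once := h.entry_once
      entry_kind := by rw [Memory.alloc_lt hel]; exact h.entry_kind
      entry_size := by rw [Memory.alloc_lt hel]; exact h.entry_size
      entry_range := (extend_lt hel).trans h.entry_range
      entry_live := h.entry_live
      once_lt := fun x hx => (h.once_lt x hx).trans_le (Nat.le_add_right _ _)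
      dead_once := h.dead_once
      owner_lt := by
        intro y t' hy
        simp only [Ghost.alloc] at hy ⊢
        split_ifs at hy with h1 h2
        · exact ⟨h1.2, fun h3 => absurd (h.once_lt y h3) (not_lt.2 h1.1)⟩
        · obtain ⟨h3, h4⟩ := h.owner_lt y t' hy
          exact ⟨h3.trans_le (Nat.le_add_right _ _), h4⟩
      node := by
        intro y hy
        rcases Nat.lt_or_ge y m.next with hlt | hge
        · rw [Memory.alloc_lt hlt]
          obtain ⟨h1, h2, h3, h4⟩ := h.node y hlt
          have e1 : (g.alloc m.next news.length rs ws t).range y = g.range y := extend_lt hlt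
          have e2 : (g.alloc m.next news.length rs ws t).weight y = g.weight y := extend_lt hlt
          refine ⟨by rw [e2]; exact h1, by rw [e1]; exact h2, by rw [e1, e2]; exact h3,
            fun hk => ?_⟩
          obtain ⟨ks, cs, q1, q2, q3, q4, q5⟩ := h4 hk
          refine ⟨ks, cs, q1, ?_, q3, q4, fun c hc => ?_⟩
          · rw [e1]
            exact q2.congr fun c hc => extend_lt (q5 c hc).1
          · obtain ⟨p1, p2, p3, p4⟩ := q5 c hc
            refine ⟨p1.trans_le (Nat.le_add_right _ _), p2, ?_, ?_⟩
            · rw [show (g.alloc m.next news.length rs ws t).range c = g.range c from extend_lt p1]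
              exact p3
            · rw [e2, show (g.alloc m.next news.length rs ws t).weight c = g.weight c from
                extend_lt p1]
              exact p4
        · obtain ⟨j, hj, rfl⟩ := exists_offset hge hy
          have e : news[j]? = some (news[j].1, news[j].2) := by simp [hj]
          rw [Memory.alloc_add e]
          exact hF.node j _ _ e
      closed := fun x hx i c hc => h.closed x hx i c ((Memory.alloc_child (h.once_lt x hx)).1 hc)
      live := by
        intro x hx hd
        have := h.live x hx hd
        clear hd hx
        induction this with
        | refl => exact .refl
        | tail h1 h2 ih =>
            obtain ⟨i, hi⟩ := h2
            exact ih.tail ⟨i, (Memory.alloc_child (h.once_lt _ (h.once_of_reachable h1))).2 hi⟩ }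

theorem Extends.alloc [DecidableEq T] {news : List (Kind × Contents K V)} {rs : ℕ → Range K}
    {ws : ℕ → ℕ} {sk : ℕ → K} :
    Extends g m (g.alloc m.next news.length rs ws t) (m.alloc sk news) where
  next_le := Nat.le_add_right _ _
  kind := fun x hx => by rw [Memory.alloc_lt hx]
  range := fun x hx => extend_lt hx
  weight := fun x hx => extend_lt hx
  once := fun _ hx => hx
  dead := fun _ hx => hx
  inner := fun x hx _ => by rw [Memory.alloc_lt hx]; exact ⟨rfl, rfl⟩
  ptrs := fun x hx i n hn => by rw [Memory.alloc_lt hx]; exact .inl hn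

/-- The new nodes of an update are ready to be linked once they have been created. -/
theorem LinkReady.ofFragment [DecidableEq T] (h : MInv b g m) {u : Update K V}
    {news : List (Kind × Contents K V)} {r : Addr} {rs : ℕ → Range K} {ws : ℕ → ℕ}
    (hF : Fragment b g m news u.target r u.sources rs ws) {sk : ℕ → K} {i : ℕ}
    (hs : ∀ x ∈ u.sources, x ∈ g.once) (ht : u.target ∉ u.sources)
    (hu : (m.node u.target).marked = false) (hr : r ∈ u.sources) (hto : u.target ∈ g.once)
    (hi : m.Child u.target i r) (hsr : ∀ z ∈ u.sources, z ≠ r → ∃ j, m.Child r j z)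
    (hmk : ∀ z ∈ u.sources, (m.node z).marked = true ∨ z ∈ u.postmarks) :
    LinkReady (g.alloc m.next news.length rs ws t) (m.alloc sk news) t u u.target i m.next r := by
  have htl := h.once_lt _ hto
  have hrl := h.once_lt r (hs r hr)
  have e0 : extend m.next g.range rs m.next = rs 0 := extend_add (next := m.next) 0
  have e1 : extend m.next g.weight ws m.next = ws 0 := extend_add (next := m.next) 0
  have hown : ∀ y, (g.alloc m.next news.length rs ws t).owner y = some t →
      ∃ j < news.length, y = m.next + j := by
    intro y hy
    simp only [Ghost.alloc] at hy
    split_ifs at hy with h1 h2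
    · exact exists_offset h1.1 h1.2
    · exact absurd hy h2
  have hown' : ∀ j < news.length, (g.alloc m.next news.length rs ws t).owner (m.next + j) =
      some t := by
    intro j hj
    simp only [Ghost.alloc]
    rw [if_pos ⟨Nat.le_add_right _ _, Nat.add_lt_add_left hj _⟩]
  exact
    { target := rfl
      kind := by rw [Memory.alloc_lt htl]; exact hi.1
      unmarked := by rw [Memory.alloc_lt htl]; exact hu
      not_source := ht
      source := hr
      ptr := by rw [Memory.alloc_lt htl]; exact hi.2
      range := by
        show extend m.next g.range rs m.next = extend m.next g.range rs r
        rw [e0, extend_lt hrl, hF.range_root]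
      weight := fun hte => by
        show extend m.next g.weight ws m.next = extend m.next g.weight ws r
        rw [e1, extend_lt hrl, hF.weight_root hte]
      sources := fun z hz hzr => by
        obtain ⟨j, hj⟩ := hsr z hz hzr
        exact ⟨j, (Memory.alloc_child hrl).2 hj⟩
      owner := hown' 0 hF.pos
      reach := by
        intro y hy hyn
        obtain ⟨j, hj, rfl⟩ := hown y hy
        have hj0 : 0 < j := by
          rcases Nat.eq_zero_or_pos j with rfl | h1
          · exact absurd rfl hyn
          · exact h1
        obtain ⟨kd, d, q1, q2, i', q3⟩ := hF.reach j hj0 hj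
        have e := Memory.alloc_add (m := m) (sk := sk) q1
        rw [Nat.add_zero] at e
        exact ⟨i', by rw [e]; exact q2, by rw [e]; exact q3⟩
      closed := by
        intro y hy i' c hc
        obtain ⟨j, hj, rfl⟩ := hown y hy
        have e : news[j]? = some (news[j].1, news[j].2) := by simp [hj]
        have e2 := Memory.alloc_add (m := m) (sk := sk) e
        have hc1 := hc.1
        have hc2 := hc.2
        rw [e2] at hc1 hc2
        rcases hF.child j _ _ e hc1 i' c hc2 with h1 | ⟨h1, h2⟩
        · exact .inl h1
        · obtain ⟨j', hj', rfl⟩ := exists_offset h1 h2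
          exact .inr (hown' j' hj')
      exits := by
        intro z hz i' y hy
        rcases hF.exits z hz i' y ((Memory.alloc_child (h.once_lt z (hs z hz))).1 hy) with h1 | h1
        · exact .inl h1
        · obtain ⟨j, kd, d, q1, q2, j', q3⟩ := h1
          have e := Memory.alloc_add (m := m) (sk := sk) q1
          exact .inr ⟨m.next + j, j', hown' j (List.getElem?_eq_some_iff.1 q1).1,
            by rw [e]; exact q2, by rw [e]; exact q3⟩
      marks := fun z hz => by rw [Memory.alloc_lt (h.once_lt z (hs z hz))]; exact hmk z hz }

end MemoryEffects

/-! ### The invariant of a configuration -/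

section ConfigInvariant

variable {K V T : Type*} [LinearOrder K] [DecidableEq T]

/-- The invariant of a configuration. `D x` is the contents of the node `x` in the last
configuration in which `x` was reachable and unlocked. It can differ from the current contents only
while a thread that has locked `x` is changing it; such a node is neither marked nor unlinked. An
unlinked node is marked, or about to be marked. The size of a leaf is correct unless a thread is
about to adjust it. -/
structure CInv (a b : ℕ) (g : Ghost K T) (D : Addr → Contents K V) (c : Config K V T) :
    Prop where
  mem : MInv b g c.mem
  pc : ∀ t, PCInv a b g c.mem t (c.thread t).pc
  stack : ∀ t, ∀ r ∈ (c.thread t).stack, RoutineOK c.mem r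
  lock : ∀ x < c.mem.next, ∀ t, (c.mem.node x).lock = some t ↔ x ∈ (c.thread t).pc.held
  held : ∀ t, ∀ x ∈ (c.thread t).pc.held, x ∈ g.once
  nodup : ∀ t, (c.thread t).pc.held.Nodup
  dead : ∀ x ∈ g.dead, (c.mem.node x).marked = true ∨ ∃ t, x ∈ (c.thread t).pc.unlinked
  size : ∀ x < c.mem.next, (c.mem.node x).kind = .leaf →
    (c.mem.node x).data.numKeys b = (c.mem.node x).data.size ∨
      ∃ t, x ∈ (c.thread t).pc.resizing
  saved : ∀ x ∈ g.once, D x = (c.mem.node x).data ∨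
    ((∃ t, x ∈ (c.thread t).pc.dirty) ∧ (c.mem.node x).marked = false ∧ x ∉ g.dead)

/-- The invariant holds in `c'`, with auxiliary data that extend those of `c`. The nodes that are
once reachable in `c'` but not in `c` are reachable and unlocked. -/
def Preserved (a b : ℕ) (g : Ghost K T) (D : Addr → Contents K V) (c c' : Config K V T) : Prop :=
  ∃ g' D', CInv a b g' D' c' ∧ Extends g c.mem g' c'.mem ∧ ∀ x ∈ g'.once,
    (c'.mem.ReachableUnlocked x ∧ D' x = (c'.mem.node x).data) ∨
      (¬ c'.mem.ReachableUnlocked x ∧ x ∈ g.once ∧ D' x = D x)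

variable {a b : ℕ} {g g' : Ghost K T} {D : Addr → Contents K V} {c : Config K V T} {t : T}
  {m' : Memory K V T} {s' : Thread K V}

theorem PC.resizing_subset {pc : PC K V} {x : Addr} (h : x ∈ pc.resizing) : x ∈ pc.held := by
  cases pc <;> simp_all [PC.resizing, PC.held]

theorem PC.dirty_subset {pc : PC K V} {x : Addr} (h : x ∈ pc.dirty) : x ∈ pc.held := by
  cases pc <;> simp_all [PC.dirty, PC.held, Update.target_mem]

theorem PCInv.unlinked_subset {m : Memory K V T} {pc : PC K V} (hpc : PCInv a b g m t pc)
    {x : Addr} (h : x ∈ pc.unlinked) : x ∈ pc.held := by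
  cases pc with
  | postmark u todo => exact u.sources_subset x (u.postmarks_subset x (hpc x h))
  | _ => simp [PC.unlinked] at h

theorem CInv.lock_of_held (h : CInv a b g D c) {x : Addr} (hx : x ∈ (c.thread t).pc.held) :
    (c.mem.node x).lock = some t :=
  (h.lock x (h.mem.once_lt x (h.held t x hx)) t).2 hx

theorem CInv.eq_of_held (h : CInv a b g D c) {x : Addr} {t' : T}
    (hx : x ∈ (c.thread t).pc.held) (hx' : x ∈ (c.thread t').pc.held) : t = t' := by
  have := h.lock_of_held hx
  rw [h.lock_of_held hx'] at this
  exact (Option.some_injective _ this).symm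

/-- An unmarked node is not unlinked while it is locked by a thread that is not about to mark it. -/
theorem CInv.not_dead (h : CInv a b g D c) {x : Addr} (hx : x ∈ (c.thread t).pc.held)
    (hm : (c.mem.node x).marked = false) (hu : (c.thread t).pc.unlinked = []) : x ∉ g.dead := by
  intro hd
  rcases h.dead x hd with h1 | ⟨t', h1⟩
  · rw [hm] at h1; cases h1
  · obtain rfl := h.eq_of_held hx ((h.pc t').unlinked_subset h1)
    rw [hu] at h1
    simp at h1

theorem CInv.size_of_held (h : CInv a b g D c) {x : Addr} (hx : x ∈ (c.thread t).pc.held)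
    (hk : (c.mem.node x).kind = .leaf) (hr : (c.thread t).pc.resizing = []) :
    (c.mem.node x).data.size = (c.mem.node x).data.numKeys b := by
  rcases h.size x (h.mem.once_lt x (h.held t x hx)) hk with h1 | ⟨t', h1⟩
  · exact h1.symm
  · obtain rfl := h.eq_of_held hx (PC.resizing_subset h1)
    rw [hr] at h1
    simp at h1

theorem CInv.owner_unlocked (h : CInv a b g D c) {x : Addr} {t' : T} (hx : g.owner x = some t') :
    x < c.mem.next ∧ (c.mem.node x).lock ≠ some t := by
  obtain ⟨h1, h2⟩ := h.mem.owner_lt x t' hx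
  exact ⟨h1, fun h3 => h2 (h.held t x ((h.lock x h1 t).1 h3))⟩

/-- The invariant is preserved in a step of thread `t` that changes only nodes locked by `t`, or
new ones. -/
theorem CInv.advance (h : CInv a b g D c) (hm : MInv b g' m') (hE : Extends g c.mem g' m')
    (hother : ∀ x < c.mem.next, (c.mem.node x).lock ≠ some t →
      (m'.node x).data = (c.mem.node x).data ∧ (m'.node x).marked = (c.mem.node x).marked)
    (hmark : ∀ x < c.mem.next, (c.mem.node x).marked = true → (m'.node x).marked = true)
    (hown : ∀ t' ≠ t, ∀ x, g'.owner x = some t' ↔ g.owner x = some t')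
    (hlock' : ∀ x < m'.next, ∀ t' ≠ t, (m'.node x).lock = some t' ↔
      x < c.mem.next ∧ (c.mem.node x).lock = some t')
    (hlockt : ∀ x < m'.next, (m'.node x).lock = some t ↔ x ∈ s'.pc.held)
    (hpc : PCInv a b g' m' t s'.pc) (hstack : ∀ r ∈ s'.stack, RoutineOK m' r)
    (hheld : ∀ x ∈ s'.pc.held, x ∈ g'.once) (hnodup : s'.pc.held.Nodup)
    (hdead : ∀ x ∈ g'.dead, x ∉ g.dead → (c.mem.node x).lock = some t ∧
      ((m'.node x).marked = true ∨ x ∈ s'.pc.unlinked))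
    (hunl : ∀ x ∈ (c.thread t).pc.unlinked, (m'.node x).marked = true ∨ x ∈ s'.pc.unlinked)
    (hsize : ∀ x < m'.next, (m'.node x).kind = .leaf →
      (x < c.mem.next → (m'.node x).data = (c.mem.node x).data →
        x ∈ (c.thread t).pc.resizing) →
      (m'.node x).data.numKeys b = (m'.node x).data.size ∨ x ∈ s'.pc.resizing)
    (hdirty : ∀ x ∈ g.once, (m'.node x).data ≠ (c.mem.node x).data →
      x ∈ s'.pc.dirty ∧ (m'.node x).marked = false ∧ x ∉ g'.dead)
    (hdirty' : ∀ x ∈ (c.thread t).pc.dirty, x ∈ g.once → (c.mem.node x).marked = false →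
      x ∉ g.dead → (x ∈ s'.pc.dirty ∧ (m'.node x).marked = false ∧ x ∉ g'.dead) ∨
        m'.ReachableUnlocked x)
    (hnew : ∀ x ∈ g'.once, x ∉ g.once → m'.ReachableUnlocked x) :
    Preserved a b g D c ⟨m',
      Function.update c.thread t s'⟩ := by
  classical
  have hth : ∀ t' ≠ t, Function.update c.thread t s' t' = c.thread t' := fun t' ht' =>
    Function.update_of_ne ht' _ _
  have hself : Function.update c.thread t s' t = s' := Function.update_self _ _ _
  have hkeep : ∀ t' ≠ t, ∀ x ∈ (c.thread t').pc.held,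
      (m'.node x).data = (c.mem.node x).data ∧ (m'.node x).marked = (c.mem.node x).marked := by
    intro t' ht' x hx
    refine hother x (h.mem.once_lt x (h.held t' x hx)) ?_
    rw [h.lock_of_held hx]
    exact fun hh => ht' (Option.some_injective _ hh)
  refine ⟨g', fun x => if m'.ReachableUnlocked x then (m'.node x).data else D x, ?_, hE, ?_⟩
  · refine ⟨hm, fun t' => ?_, fun t' => ?_, fun x hx t' => ?_, fun t' => ?_, fun t' => ?_,
      fun x hx => ?_, fun x hx hk => ?_, fun x hx => ?_⟩
    · by_cases ht' : t' = t
      · subst ht'; simp only [hself]; exact hpc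
      · simp only [hth t' ht']
        refine (h.pc t').frame hE h.mem (h.held t') (hkeep t' ht') (hown t' ht') fun x hx => ?_
        obtain ⟨h1, h2⟩ := h.owner_unlocked (t := t) hx
        exact (hother x h1 h2).1
    · by_cases ht' : t' = t
      · subst ht'; simp only [hself]; exact hstack
      · simp only [hth t' ht']
        exact fun r hr => hE.routineOK (h.stack t' r hr)
    · by_cases ht' : t' = t
      · subst ht'; simp only [hself]; exact hlockt x hx
      · simp only [hth t' ht']
        rw [hlock' x hx t' ht']
        constructor
        · rintro ⟨h1, h2⟩; exact (h.lock x h1 t').1 h2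
        · intro h1
          exact ⟨h.mem.once_lt x (h.held t' x h1), h.lock_of_held h1⟩
    · by_cases ht' : t' = t
      · subst ht'; simp only [hself]; exact hheld
      · simp only [hth t' ht']
        exact fun x hx => hE.once x (h.held t' x hx)
    · by_cases ht' : t' = t
      · subst ht'; simp only [hself]; exact hnodup
      · simp only [hth t' ht']; exact h.nodup t'
    · by_cases hxd : x ∈ g.dead
      · rcases h.dead x hxd with h1 | ⟨t', h1⟩
        · exact .inl (hmark x (h.mem.once_lt x (h.mem.dead_once x hxd)) h1)
        · by_cases ht' : t' = t
          · subst ht'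
            refine (hunl x h1).imp_right fun h2 => ⟨t', ?_⟩
            simp only [hself]; exact h2
          · refine .inr ⟨t', ?_⟩
            simp only [hth t' ht']; exact h1
      · refine (hdead x hx hxd).2.imp_right fun h2 => ⟨t, ?_⟩
        simp only [hself]; exact h2
    · by_cases hcond : x < c.mem.next → (m'.node x).data = (c.mem.node x).data →
          x ∈ (c.thread t).pc.resizing
      · refine (hsize x hx hk hcond).imp_right fun h2 => ⟨t, ?_⟩
        simp only [hself]; exact h2
      · simp only [not_forall] at hcond
        obtain ⟨h1, h2, h3⟩ := hcond
        have hk' := hk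
        simp only [hE.kind x h1] at hk'
        simp only [h2]
        rcases h.size x h1 hk' with h4 | ⟨t', h4⟩
        · exact .inl h4
        · have ht' : t' ≠ t := by rintro rfl; exact h3 h4
          refine .inr ⟨t', ?_⟩
          simp only [hth t' ht']; exact h4
    · by_cases hru : m'.ReachableUnlocked x
      · left; simp only [hru, if_true]
      · simp only [hru, if_false]
        have hxo : x ∈ g.once := by
          by_contra hxo
          exact hru (hnew x hx hxo)
        by_cases hdx : (m'.node x).data = (c.mem.node x).data
        · rcases h.saved x hxo with h1 | ⟨⟨t', h1⟩, h2, h3⟩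
          · left; rw [h1, hdx]
          · right
            by_cases ht' : t' = t
            · subst ht'
              rcases hdirty' x h1 hxo h2 h3 with ⟨q1, q2⟩ | q
              · exact ⟨⟨t', by simp only [hself]; exact q1⟩, q2⟩
              · exact absurd q hru
            · have hlk := PC.dirty_subset h1
              refine ⟨⟨t', by simp only [hth t' ht']; exact h1⟩, ?_, fun hd => ?_⟩
              · rw [(hkeep t' ht' x hlk).2]; exact h2
              · have h4 := (hdead x hd h3).1
                rw [h.lock_of_held hlk] at h4
                exact ht' (Option.some_injective _ h4)
        · obtain ⟨h1, h2⟩ := hdirty x hxo hdx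
          exact .inr ⟨⟨t, by simp only [hself]; exact h1⟩, h2⟩
  · intro x hx
    by_cases hru : m'.ReachableUnlocked x
    · left; exact ⟨hru, by simp only [hru, if_true]⟩
    · right
      refine ⟨hru, ?_, by simp only [hru, if_false]⟩
      by_contra hxo
      exact hru (hnew x hx hxo)

/-- A step that changes no more than locks and versions. -/
theorem CInv.advance_soft (h : CInv a b g D c) (hn : m'.next = c.mem.next)
    (hsame : ∀ x, (m'.node x).kind = (c.mem.node x).kind ∧
      (m'.node x).data = (c.mem.node x).data ∧ (m'.node x).marked = (c.mem.node x).marked)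
    (hlock' : ∀ x < c.mem.next, ∀ t' ≠ t, (m'.node x).lock = some t' ↔
      (c.mem.node x).lock = some t')
    (hlockt : ∀ x < c.mem.next, (m'.node x).lock = some t ↔ x ∈ s'.pc.held)
    (hpc : PCInv a b g c.mem t s'.pc) (hstack : ∀ r ∈ s'.stack, RoutineOK c.mem r)
    (hheld : ∀ x ∈ s'.pc.held, x ∈ g.once) (hnodup : s'.pc.held.Nodup)
    (hunl : ∀ x ∈ (c.thread t).pc.unlinked, x ∈ s'.pc.unlinked)
    (hres : ∀ x ∈ (c.thread t).pc.resizing, x ∈ s'.pc.resizing)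
    (hdirty : ∀ x ∈ (c.thread t).pc.dirty, x ∈ g.once → x ∉ g.dead → x ∈ s'.pc.dirty ∨
      m'.ReachableUnlocked x) :
    Preserved a b g D c ⟨m',
      Function.update c.thread t s'⟩ := by
  have hE : Extends g c.mem g m' :=
    { next_le := hn.ge
      kind := fun x _ => (hsame x).1
      range := fun _ _ => rfl
      weight := fun _ _ => rfl
      once := fun _ hx => hx
      dead := fun _ hx => hx
      inner := fun x _ _ => by rw [(hsame x).2.1]; exact ⟨rfl, rfl⟩
      ptrs := fun x _ i n hi => by rw [(hsame x).2.1]; exact .inl hi }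
  refine h.advance (h.mem.congr hn fun x => ⟨(hsame x).1, (hsame x).2.1⟩) hE
    (fun x _ _ => (hsame x).2) (fun x _ hx => by rw [(hsame x).2.2]; exact hx)
    (fun _ _ _ => Iff.rfl) (fun x hx t' ht' => ?_) (fun x hx => hlockt x (hn ▸ hx)) ?_
    (fun r hr => hE.routineOK (hstack r hr)) hheld hnodup (fun x h1 h2 => absurd h1 h2)
    (fun x hx => .inr (hunl x hx)) (fun x hx _ h1 => .inr (hres x (h1 (hn ▸ hx) (hsame x).2.1)))
    (fun x _ h1 => absurd (hsame x).2.1 h1) (fun x h1 h2 h3 h4 => ?_) (fun x h1 h2 => absurd h1 h2)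
  · rw [hn] at hx
    rw [hlock' x hx t' ht']
    exact ⟨fun h1 => ⟨hx, h1⟩, fun h1 => h1.2⟩
  · exact hpc.frame hE h.mem hheld (fun x _ => (hsame x).2) (fun _ => Iff.rfl)
      fun x _ => (hsame x).2.1
  · refine (hdirty x h1 h2 h4).imp_left fun h5 => ⟨h5, ?_, h4⟩
    rw [(hsame x).2.2]; exact h3

/-- A step that does not change the memory. -/
theorem CInv.advance_local (h : CInv a b g D c) (hheld : s'.pc.held = (c.thread t).pc.held)
    (hpc : PCInv a b g c.mem t s'.pc) (hstack : ∀ r ∈ s'.stack, RoutineOK c.mem r)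
    (hunl : ∀ x ∈ (c.thread t).pc.unlinked, x ∈ s'.pc.unlinked)
    (hres : ∀ x ∈ (c.thread t).pc.resizing, x ∈ s'.pc.resizing)
    (hdirty : ∀ x ∈ (c.thread t).pc.dirty, x ∈ s'.pc.dirty) :
    Preserved a b g D c ⟨c.mem, Function.update c.thread t s'⟩ :=
  h.advance_soft rfl (fun _ => ⟨rfl, rfl, rfl⟩) (fun _ _ _ _ => Iff.rfl)
    (fun x hx => by rw [hheld]; exact h.lock x hx t) hpc hstack (by rw [hheld]; exact h.held t)
    (by rw [hheld]; exact h.nodup t) hunl hres fun x hx _ _ => .inl (hdirty x hx)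

/-- A step that increments the version of a node. -/
theorem CInv.advance_ver (h : CInv a b g D c) (x : Addr) (n : ℕ)
    (hheld : s'.pc.held = (c.thread t).pc.held)
    (hpc : PCInv a b g c.mem t s'.pc) (hstack : ∀ r ∈ s'.stack, RoutineOK c.mem r)
    (hunl : ∀ x ∈ (c.thread t).pc.unlinked, x ∈ s'.pc.unlinked)
    (hres : ∀ x ∈ (c.thread t).pc.resizing, x ∈ s'.pc.resizing)
    (hdirty : ∀ x ∈ (c.thread t).pc.dirty, x ∈ s'.pc.dirty) :
    Preserved a b g D c ⟨c.mem.modify x fun nd => { nd with ver := nd.ver + n },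
      Function.update c.thread t s'⟩ := by
  have hs : ∀ y, ((c.mem.modify x fun nd => { nd with ver := nd.ver + n }).node y).kind =
      (c.mem.node y).kind ∧ ((c.mem.modify x fun nd => { nd with ver := nd.ver + n }).node y).data =
      (c.mem.node y).data ∧ ((c.mem.modify x fun nd => { nd with ver := nd.ver + n }).node y).marked
      = (c.mem.node y).marked ∧
      ((c.mem.modify x fun nd => { nd with ver := nd.ver + n }).node y).lock =
      (c.mem.node y).lock := by
    intro y
    by_cases hy : y = x
    · subst hy; simp [Memory.modify]
    · simp [Memory.modify, hy]
  exact h.advance_soft rfl (fun y => ⟨(hs y).1, (hs y).2.1, (hs y).2.2.1⟩)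
    (fun y _ _ _ => by rw [(hs y).2.2.2])
    (fun y hy => by rw [hheld, (hs y).2.2.2]; exact h.lock y hy t) hpc hstack
    (by rw [hheld]; exact h.held t)
    (by rw [hheld]; exact h.nodup t) hunl hres fun x hx _ _ => .inl (hdirty x hx)

theorem Memory.modify_lock (m : Memory K V T) (x : Addr) (l : Option T) (y : Addr) :
    ((m.modify x fun nd => { nd with lock := l }).node y).kind = (m.node y).kind ∧
    ((m.modify x fun nd => { nd with lock := l }).node y).data = (m.node y).data ∧
    ((m.modify x fun nd => { nd with lock := l }).node y).marked = (m.node y).marked ∧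
    ((m.modify x fun nd => { nd with lock := l }).node y).lock =
      if y = x then l else (m.node y).lock := by
  by_cases hy : y = x
  · subst hy; simp [Memory.modify]
  · simp [Memory.modify, hy]

/-- A step that acquires the lock of `x`. -/
theorem CInv.advance_lock (h : CInv a b g D c) {x : Addr} (hx : x ∈ g.once)
    (hfree : (c.mem.node x).lock = none)
    (hheld : s'.pc.held = (c.thread t).pc.held ++ [x])
    (hpc : PCInv a b g c.mem t s'.pc) (hstack : ∀ r ∈ s'.stack, RoutineOK c.mem r)
    (hunl : ∀ x ∈ (c.thread t).pc.unlinked, x ∈ s'.pc.unlinked)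
    (hres : ∀ x ∈ (c.thread t).pc.resizing, x ∈ s'.pc.resizing)
    (hdirty : ∀ x ∈ (c.thread t).pc.dirty, x ∈ s'.pc.dirty) :
    Preserved a b g D c ⟨c.mem.modify x fun nd => { nd with lock := some t },
      Function.update c.thread t s'⟩ := by
  have hs := c.mem.modify_lock x (some t)
  have hnot : x ∉ (c.thread t).pc.held := by
    intro hh
    rw [h.lock_of_held hh] at hfree
    cases hfree
  refine h.advance_soft rfl (fun y => ⟨(hs y).1, (hs y).2.1, (hs y).2.2.1⟩)
    (fun y _ t' ht' => ?_) (fun y hy => ?_) hpc hstack (fun y hy => ?_) ?_ hunl hres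
    fun x hx _ _ => .inl (hdirty x hx)
  · rw [(hs y).2.2.2]
    split_ifs with hyx
    · subst hyx
      rw [hfree]
      simp [Ne.symm ht']
    · rfl
  · rw [hheld, (hs y).2.2.2, List.mem_append, List.mem_singleton, ← h.lock y hy t]
    split_ifs with hyx
    · simp [hyx]
    · simp [hyx]
  · rw [hheld, List.mem_append, List.mem_singleton] at hy
    rcases hy with hy | rfl
    · exact h.held t y hy
    · exact hx
  · rw [hheld]
    refine List.Nodup.append (h.nodup t) (List.nodup_singleton x) ?_
    intro y hy hyx
    rw [List.mem_singleton.1 hyx] at hy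
    exact hnot hy

/-- A step that releases the lock of `x`. -/
theorem CInv.advance_unlock (h : CInv a b g D c) {x : Addr} {todo : List Addr} {after : PC K V}
    (hs : (c.thread t).pc = .release (x :: todo) after) :
    Preserved a b g D c ⟨c.mem.modify x fun nd => { nd with lock := none },
      Function.update c.thread t ((c.thread t).goto (.release todo after))⟩ := by
  have hm := c.mem.modify_lock x none
  have hnd := h.nodup t
  have hhd := h.held t
  have hpc := h.pc t
  rw [hs] at hnd hhd hpc
  have hnd' : x ∉ todo ∧ todo.Nodup := List.nodup_cons.1 hnd
  have hxl : (c.mem.node x).lock = some t := h.lock_of_held (by rw [hs]; exact List.mem_cons_self)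
  refine h.advance_soft rfl (fun y => ⟨(hm y).1, (hm y).2.1, (hm y).2.2.1⟩)
    (fun y _ t' ht' => ?_) (fun y hy => ?_) hpc (h.stack t)
    (fun y hy => hhd y (List.mem_cons_of_mem x hy)) hnd'.2 ?_ ?_ ?_
  · rw [(hm y).2.2.2]
    split_ifs with hyx
    · subst hyx
      rw [hxl]
      simp [Ne.symm ht']
    · rfl
  · have := h.lock y hy t
    rw [hs] at this
    rw [(hm y).2.2.2]
    show _ ↔ y ∈ todo
    split_ifs with hyx
    · subst hyx
      simp [hnd'.1]
    · rw [this]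
      show y ∈ x :: todo ↔ _
      simp [hyx]
  · rw [hs]; simp [PC.unlinked]
  · rw [hs]; simp [PC.resizing]
  · rw [hs]
    intro y hy hyo hyd
    rcases List.mem_cons.1 (show y ∈ x :: todo from hy) with rfl | hy
    · right
      refine ⟨(h.mem.live y hyo hyd).congr fun z i n hz => ?_, by rw [(hm y).2.2.2]; simp⟩
      unfold Memory.Child at hz ⊢
      rw [(hm z).1, (hm z).2.1]
      exact hz
    · exact .inl hy

theorem Memory.modify_marked (m : Memory K V T) (x y : Addr) :
    ((m.modify x fun nd => { nd with marked := true }).node y).kind = (m.node y).kind ∧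
    ((m.modify x fun nd => { nd with marked := true }).node y).data = (m.node y).data ∧
    ((m.modify x fun nd => { nd with marked := true }).node y).lock = (m.node y).lock ∧
    ((m.modify x fun nd => { nd with marked := true }).node y).marked =
      if y = x then true else (m.node y).marked := by
  by_cases hy : y = x
  · subst hy; simp [Memory.modify]
  · simp [Memory.modify, hy]

theorem Extends.modify_marked (m : Memory K V T) (x : Addr) :
    Extends g m g (m.modify x fun nd => { nd with marked := true }) where
  next_le := le_rfl
  kind := fun y _ => (m.modify_marked x y).1
  range := fun _ _ => rfl
  weight := fun _ _ => rfl
  once := fun _ hx => hx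
  dead := fun _ hx => hx
  inner := fun y _ _ => by rw [(m.modify_marked x y).2.1]; exact ⟨rfl, rfl⟩
  ptrs := fun y _ i n hi => by rw [(m.modify_marked x y).2.1]; exact .inl hi

/-- A step that marks the locked node `x`, which the thread has not changed. -/
theorem CInv.advance_mark (h : CInv a b g D c) {x : Addr} (hx : x ∈ (c.thread t).pc.held)
    (hheld : s'.pc.held = (c.thread t).pc.held)
    (hpc : PCInv a b g (c.mem.modify x fun nd => { nd with marked := true }) t s'.pc)
    (hstack : s'.stack = (c.thread t).stack)
    (hunl : ∀ y ∈ (c.thread t).pc.unlinked, y = x ∨ y ∈ s'.pc.unlinked)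
    (hres : (c.thread t).pc.resizing = [])
    (hdirty : ∀ y ∈ (c.thread t).pc.dirty, y ≠ x ∧ y ∈ s'.pc.dirty) :
    Preserved a b g D c ⟨c.mem.modify x fun nd => { nd with marked := true },
      Function.update c.thread t s'⟩ := by
  have hs := c.mem.modify_marked x
  have hE := Extends.modify_marked (g := g) c.mem x
  refine h.advance (h.mem.congr rfl fun y => ⟨(hs y).1, (hs y).2.1⟩) hE
    (fun y _ hy => ⟨(hs y).2.1, ?_⟩) (fun y _ hy => ?_) (fun _ _ _ => Iff.rfl)
    (fun y hy t' _ => ?_) (fun y hy => ?_) hpc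
    (fun r hr => hE.routineOK (h.stack t r (hstack ▸ hr))) (by rw [hheld]; exact h.held t)
    (by rw [hheld]; exact h.nodup t) (fun y h1 h2 => absurd h1 h2) (fun y hy => ?_)
    (fun y hy _ h1 => ?_) (fun y _ h1 => absurd (hs y).2.1 h1) (fun y h1 h2 h3 h4 => ?_)
    (fun y h1 h2 => absurd h1 h2)
  · rw [(hs y).2.2.2, if_neg]
    rintro rfl
    exact hy (h.lock_of_held hx)
  · rw [(hs y).2.2.2, hy]; simp
  · rw [(hs y).2.2.1]
    exact ⟨fun h1 => ⟨hy, h1⟩, fun h1 => h1.2⟩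
  · rw [(hs y).2.2.1, hheld]; exact h.lock y hy t
  · rw [(hs y).2.2.2]
    exact (hunl y hy).imp_left fun hyx => by simp [hyx]
  · have := h1 hy (hs y).2.1
    rw [hres] at this
    simp at this
  · obtain ⟨q1, q2⟩ := hdirty y h1
    refine .inl ⟨q2, ?_, h4⟩
    rw [(hs y).2.2.2, if_neg q1]; exact h3

/-- A step that changes the contents of a locked and unmarked leaf. -/
theorem CInv.advance_leaf (h : CInv a b g D c) {x : Addr} {f : Contents K V → Contents K V}
    (hl : LiveLeaf g c.mem x) (hx : (c.thread t).pc.held = [x]) (hheld : s'.pc.held = [x])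
    (hf : LeafOK b (g.range x) (f (c.mem.node x).data))
    (hu : (c.thread t).pc.unlinked = [])
    (hres : (f (c.mem.node x).data).numKeys b = (f (c.mem.node x).data).size ∨
      s'.pc.resizing = [x])
    (hdirty : s'.pc.dirty = [x]) (hstack : s'.stack = (c.thread t).stack)
    (hpc : ((c.mem.modifyData x f).node x).data = f (c.mem.node x).data →
      LiveLeaf g (c.mem.modifyData x f) x → PCInv a b g (c.mem.modifyData x f) t s'.pc) :
    Preserved a b g D c ⟨c.mem.modifyData x f,
      Function.update c.thread t s'⟩ := by
  have hxh : x ∈ (c.thread t).pc.held := by rw [hx]; exact List.mem_singleton_self _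
  have hxd := h.not_dead hxh hl.2.2 hu
  have hs : ∀ y, ((c.mem.modifyData x f).node y).kind = (c.mem.node y).kind ∧
      ((c.mem.modifyData x f).node y).marked = (c.mem.node y).marked ∧
      ((c.mem.modifyData x f).node y).lock = (c.mem.node y).lock ∧
      ((c.mem.modifyData x f).node y).data =
        if y = x then f (c.mem.node y).data else (c.mem.node y).data := by
    intro y
    by_cases hy : y = x
    · subst hy; simp [Memory.modifyData, Memory.modify]
    · simp [Memory.modifyData, Memory.modify, hy]
  have hlf := ((h.mem.node x (h.mem.once_lt x hl.1)).leaf hl.2.1).2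
  have hE : Extends g c.mem g (c.mem.modifyData x f) :=
    { next_le := le_rfl
      kind := fun y _ => (hs y).1
      range := fun _ _ => rfl
      weight := fun _ _ => rfl
      once := fun _ hx => hx
      dead := fun _ hx => hx
      inner := fun y _ hy => by
        have : y ≠ x := by rintro rfl; exact hy hl.2.1
        rw [(hs y).2.2.2, if_neg this]; exact ⟨rfl, rfl⟩
      ptrs := fun y _ i n hi => by
        have : y ≠ x := by
          rintro rfl
          rw [hlf.ptrs i] at hi
          cases hi
        rw [(hs y).2.2.2, if_neg this]; exact .inl hi }
  have hne : ∀ y, ((c.mem.modifyData x f).node y).data ≠ (c.mem.node y).data → y = x := by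
    intro y hy
    by_contra hyx
    rw [(hs y).2.2.2, if_neg hyx] at hy
    exact hy rfl
  refine h.advance (h.mem.modifyLeaf hl.2.1 hf) hE (fun y _ hy => ⟨?_, (hs y).2.1⟩)
    (fun y _ hy => by rw [(hs y).2.1]; exact hy) (fun _ _ _ => Iff.rfl)
    (fun y hy t' _ => ?_) (fun y hy => ?_)
    (hpc (by rw [(hs x).2.2.2, if_pos rfl])
      ⟨hl.1, by rw [(hs x).1]; exact hl.2.1, by rw [(hs x).2.1]; exact hl.2.2⟩)
    (fun r hr => hE.routineOK (h.stack t r (hstack ▸ hr)))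
    (by rw [hheld, ← hx]; exact h.held t)
    (by rw [hheld]; exact List.nodup_singleton x) (fun y h1 h2 => absurd h1 h2)
    (fun y hy => by rw [hu] at hy; simp at hy)
    (fun y hy hk h1 => ?_) (fun y _ h1 => ?_) (fun y h1 h2 h3 h4 => ?_)
    (fun y h1 h2 => absurd h1 h2)
  · rw [(hs y).2.2.2, if_neg]
    rintro rfl
    exact hy (h.lock_of_held hxh)
  · rw [(hs y).2.2.1]
    exact ⟨fun h1 => ⟨hy, h1⟩, fun h1 => h1.2⟩
  · rw [(hs y).2.2.1, hheld, ← hx]; exact h.lock y hy t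
  · have hyx : y = x := by
      by_contra hyx
      have := PC.resizing_subset (h1 hy (by rw [(hs y).2.2.2, if_neg hyx]))
      rw [hx] at this
      exact hyx (List.mem_singleton.1 this)
    subst hyx
    rw [(hs y).2.2.2, if_pos rfl]
    exact hres.imp_right fun h2 => by rw [h2]; exact List.mem_singleton_self _
  · obtain rfl := hne y h1
    exact ⟨by rw [hdirty]; exact List.mem_singleton_self _, by rw [(hs y).2.1]; exact hl.2.2, hxd⟩
  · have := PC.dirty_subset h1
    rw [hx] at this
    obtain rfl := List.mem_singleton.1 this
    exact .inl ⟨by rw [hdirty]; exact List.mem_singleton_self _,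
      by rw [(hs y).2.1]; exact hl.2.2, hxd⟩

/-- The step in which an update creates its new nodes. -/
theorem CInv.advance_alloc (h : CInv a b g D c) {u : Update K V}
    {buf : Addr → Contents K V} (hs : (c.thread t).pc = .copy u [] buf)
    {news : List (Kind × Contents K V)} {r : Addr} {rs : ℕ → Range K} {ws : ℕ → ℕ} {i : ℕ}
    (hF : Fragment b g c.mem news u.target r u.sources rs ws) {sk : ℕ → K}
    (ht : u.target ∉ u.sources) (hu : (c.mem.node u.target).marked = false) (hr : r ∈ u.sources)
    (hi : c.mem.Child u.target i r) (hsr : ∀ z ∈ u.sources, z ≠ r → ∃ j, c.mem.Child r j z)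
    (hmk : ∀ z ∈ u.sources, (c.mem.node z).marked = true ∨ z ∈ u.postmarks)
    (hpc : s'.pc = .link u u.target i c.mem.next)
    (hstack : ∀ r ∈ s'.stack, RoutineOK (c.mem.alloc sk news) r) :
    Preserved a b g D c ⟨c.mem.alloc sk news,
      Function.update c.thread t s'⟩ := by
  have hhd := h.held t
  have hnd := h.nodup t
  rw [hs] at hhd hnd
  have hlock : ∀ x < (c.mem.alloc sk news).next, ∀ t',
      ((c.mem.alloc sk news).node x).lock = some t' ↔
        x < c.mem.next ∧ (c.mem.node x).lock = some t' := by
    intro x hx t'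
    rcases Nat.lt_or_ge x c.mem.next with hlt | hge
    · rw [Memory.alloc_lt hlt]; simp [hlt]
    · obtain ⟨j, hj, rfl⟩ := exists_offset hge hx
      rw [Memory.alloc_add (kd := news[j].1) (d := news[j].2) (by simp [hj])]
      simp
  refine h.advance (h.mem.alloc hF sk (t := t)) Extends.alloc
    (fun x hx _ => by rw [Memory.alloc_lt hx]; exact ⟨rfl, rfl⟩)
    (fun x hx hm => by rw [Memory.alloc_lt hx]; exact hm) (fun t' ht' x => ?_)
    (fun x hx t' _ => hlock x hx t') (fun x hx => ?_) ?_ hstack (by rw [hpc]; exact hhd)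
    (by rw [hpc]; exact hnd) (fun x h1 h2 => absurd h1 h2)
    (fun x hx => by rw [hs] at hx; simp [PC.unlinked] at hx) (fun x hx hk h1 => ?_)
    (fun x hx h1 => ?_) (fun x hx => by rw [hs] at hx; simp [PC.dirty] at hx)
    (fun x h1 h2 => absurd h1 h2)
  · simp only [Ghost.alloc]
    split_ifs with h1 h2
    · constructor
      · intro h3; exact absurd (Option.some_injective _ h3).symm ht'
      · intro h3
        exact absurd (h.mem.owner_lt x t' h3).1 (not_lt.2 h1.1)
    · rw [h2]
      constructor
      · intro h3; cases h3
      · intro h3; exact absurd (Option.some_injective _ h3).symm ht'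
    · rfl
  · rw [hlock x hx, hpc]
    constructor
    · rintro ⟨h1, h2⟩
      have := (h.lock x h1 t).1 h2
      rw [hs] at this
      exact this
    · intro h1
      refine ⟨h.mem.once_lt x (hhd x h1), h.lock_of_held ?_⟩
      rw [hs]; exact h1
  · rw [hpc]
    exact ⟨r, LinkReady.ofFragment h.mem hF (fun x hx => hhd x (u.sources_subset x hx)) ht hu hr
      (hhd _ u.target_mem) hi hsr hmk⟩
  · rcases Nat.lt_or_ge x c.mem.next with hlt | hge
    · have := h1 hlt (by rw [Memory.alloc_lt hlt])
      rw [hs] at this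
      simp [PC.resizing] at this
    · obtain ⟨j, hj, rfl⟩ := exists_offset hge hx
      have e : news[j]? = some (news[j].1, news[j].2) := by simp [hj]
      rw [Memory.alloc_add e] at hk ⊢
      rw [show news[j].1 = .leaf from hk] at e
      exact .inl (hF.size j _ e)
  · rw [Memory.alloc_lt (h.mem.once_lt x hx)] at h1
    exact absurd rfl h1

/-- The pointer write of an update. -/
theorem CInv.advance_link (h : CInv a b g D c) {u : Update K V} {x new : Addr} {i : ℕ}
    (hs : (c.thread t).pc = .link u x i new) :
    Preserved a b g D c ⟨c.mem.link x i new,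
      Function.update c.thread t
      ((c.thread t).goto (.postmark u u.postmarks))⟩ := by
  have hhd := h.held t
  have hnd := h.nodup t
  have hpc := h.pc t
  have hlk : ∀ y ∈ u.locks, (c.mem.node y).lock = some t := fun y hy =>
    h.lock_of_held (by rw [hs]; exact hy)
  rw [hs] at hhd hnd hpc
  obtain ⟨r, hL⟩ := hpc
  have hxh : x ∈ u.locks := hL.target ▸ u.target_mem
  have hxo : x ∈ g.once := hhd x hxh
  have hxd : x ∉ g.dead :=
    h.not_dead (t := t) (by rw [hs]; exact hxh) hL.unmarked (by rw [hs]; rfl)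
  have hso : ∀ y ∈ u.sources, y ∈ g.once := fun y hy => hhd y (u.sources_subset y hy)
  have hM := h.mem.link hL hxo hxd hso
  have hml : ∀ y, ((c.mem.link x i new).node y).marked = (c.mem.node y).marked ∧
      ((c.mem.link x i new).node y).lock = (c.mem.node y).lock := by
    intro y
    by_cases hy : y = x
    · subst hy; rw [Memory.link_self]; exact ⟨rfl, rfl⟩
    · rw [Memory.link_of_ne hy]; exact ⟨rfl, rfl⟩
  refine h.advance hM (Extends.link hL) (fun y _ hy => ⟨?_, (hml y).1⟩)
    (fun y _ hy => by rw [(hml y).1]; exact hy) (fun t' ht' y => ?_) (fun y hy t' _ => ?_)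
    (fun y hy => ?_) (fun y hy => hy) (fun r hr => (Extends.link hL).routineOK (h.stack t r hr))
    (fun y hy => .inl (hhd y hy)) hnd (fun y h1 h2 => ?_)
    (fun y hy => by rw [hs] at hy; simp [PC.unlinked] at hy) (fun y hy hk h1 => ?_)
    (fun y hy h1 => ?_) (fun y hy => by rw [hs] at hy; simp [PC.dirty] at hy)
    (fun y h1 h2 => ?_)
  · rw [Memory.link_of_ne]
    rintro rfl
    exact hy (hlk y hxh)
  · simp only [Ghost.link]
    split_ifs with h1
    · rw [h1]
      constructor
      · intro h3; cases h3
      · intro h3; exact absurd (Option.some_injective _ h3).symm ht'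
    · rfl
  · rw [(hml y).2]
    exact ⟨fun h1 => ⟨hy, h1⟩, fun h1 => h1.2⟩
  · rw [(hml y).2, h.lock y hy t, hs]; rfl
  · have hys : y ∈ u.sources := h1.resolve_left h2
    refine ⟨hlk y (u.sources_subset y hys), ?_⟩
    rw [(hml y).1]
    exact hL.marks y hys
  · have hyx : y ≠ x := by
      rintro rfl
      rw [Memory.link_kind] at hk
      exact hL.kind hk
    have := h1 hy (by rw [Memory.link_of_ne hyx])
    rw [hs] at this
    simp [PC.resizing] at this
  · have hyx : y = x := by
      by_contra hyx
      rw [Memory.link_of_ne hyx] at h1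
      exact h1 rfl
    subst hyx
    refine ⟨?_, by rw [(hml y).1]; exact hL.unmarked, fun h3 => h3.elim hxd hL.not_source⟩
    show y ∈ [u.target]
    rw [hL.target]; exact List.mem_singleton_self _
  · have hy : g.owner y = some t := h1.resolve_left h2
    have hyl := (h.mem.owner_lt y t hy).1
    refine ⟨(h.mem.reachable_link hL (h.mem.live x hxo hxd)).2 y hy, ?_⟩
    rw [(hml y).2]
    rcases hl : (c.mem.node y).lock with _ | t'
    · rfl
    · exact absurd (h.held t' y ((h.lock y hyl t').1 hl)) h2

end ConfigInvariant

/-! ### Steps of searches and of operations on a leaf -/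

section Operations

variable {K V T : Type*} [LinearOrder K] [DecidableEq T]
variable {a b : ℕ} {g : Ghost K T} {D : Addr → Contents K V} {c : Config K V T} {t : T}
  {ch : Choice K V} {m' : Memory K V T} {s' : Thread K V}

/-- A step that does not change the memory, from a program point at which the thread has changed
none of its locked nodes. -/
theorem CInv.advance_clean (h : CInv a b g D c) {pc : PC K V} (hs : (c.thread t).pc = pc)
    (hclean : pc.unlinked = [] ∧ pc.resizing = [] ∧ pc.dirty = [])
    (hheld : s'.pc.held = pc.held) (hpc : PCInv a b g c.mem t s'.pc)
    (hstack : ∀ r ∈ s'.stack, r ∈ (c.thread t).stack ∨ RoutineOK c.mem r) :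
    Preserved a b g D c ⟨c.mem, Function.update c.thread t s'⟩ := by
  obtain ⟨h1, h2, h3⟩ := hclean
  refine h.advance_local (by rw [hs, hheld]) hpc
    (fun r hr => (hstack r hr).elim (h.stack t r) id) ?_ ?_ ?_ <;> rw [hs]
  · simp [h1]
  · simp [h2]
  · simp [h3]

/-- An acquisition of a lock, at a program point at which the thread has changed none of its
locked nodes. -/
theorem CInv.advance_lock_clean (h : CInv a b g D c) {pc pc' : PC K V} {x : Addr}
    (hs : (c.thread t).pc = pc) (hx : x ∈ g.once) (hfree : (c.mem.node x).lock.isNone = true)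
    (hclean : pc.unlinked = [] ∧ pc.resizing = [] ∧ pc.dirty = [])
    (hheld : pc'.held = pc.held ++ [x]) (hpc : PCInv a b g c.mem t pc') :
    Preserved a b g D c ⟨c.mem.modify x fun nd => { nd with lock := some t },
      Function.update c.thread t ((c.thread t).goto pc')⟩ := by
  obtain ⟨h1, h2, h3⟩ := hclean
  refine h.advance_lock hx (Option.isNone_iff_eq_none.1 hfree) (by rw [hs]; exact hheld) hpc
    (h.stack t) ?_ ?_ ?_ <;> rw [hs]
  · simp [h1]
  · simp [h2]
  · simp [h3]

theorem CInv.step_start (h : CInv a b g D c) {r : Routine K V} (hs : (c.thread t).pc = .start r)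
    (hst : step a b ch t c.mem (c.thread t) = some (m', s')) :
    Preserved a b g D c ⟨m', Function.update c.thread t s'⟩ := by
  have hpc := h.pc t
  rw [hs] at hpc
  unfold step at hst
  rw [hs] at hst
  cases r <;> simp only at hst
  case fixUnderfull x =>
    split_ifs at hst <;> cases hst
    · exact h.advance_clean hs ⟨rfl, rfl, rfl⟩ rfl trivial fun r hr => .inl hr
    · exact h.advance_clean hs ⟨rfl, rfl, rfl⟩ rfl hpc fun r hr => .inl hr
  all_goals
    cases hst
    exact h.advance_clean hs ⟨rfl, rfl, rfl⟩ rfl hpc fun r hr => .inl hr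

theorem CInv.step_retry (h : CInv a b g D c) {r : Routine K V} (hs : (c.thread t).pc = .retry r)
    (hst : step a b ch t c.mem (c.thread t) = some (m', s')) :
    Preserved a b g D c ⟨m', Function.update c.thread t s'⟩ := by
  have hpc := h.pc t
  rw [hs] at hpc
  unfold step at hst
  rw [hs] at hst
  have hent : ∀ k : K, (g.range entry).Contains k := fun k => by
    rw [h.mem.entry_range]
    exact ⟨bot_le, WithTop.coe_lt_top k⟩
  have hpath : PathOK g c.mem Path.start :=
    ⟨h.mem.entry_once, fun p hp => by simp [Path.start] at hp,
      fun p hp => by simp [Path.start] at hp⟩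
  cases r <;> simp only at hst
  case fixTagged x =>
    split_ifs at hst with h1 <;> cases hst
    · exact h.advance_clean hs ⟨rfl, rfl, rfl⟩ rfl trivial fun r hr => .inl hr
    · simp only [not_or, not_not] at h1
      exact h.advance_clean hs ⟨rfl, rfl, rfl⟩ rfl ⟨⟨hpc, h1.2⟩, hent _, hpath⟩
        fun r hr => .inl hr
  case fixUnderfull x =>
    cases hst
    exact h.advance_clean hs ⟨rfl, rfl, rfl⟩ rfl ⟨hpc, hent _, hpath⟩ fun r hr => .inl hr
  all_goals
    cases hst
    exact h.advance_clean hs ⟨rfl, rfl, rfl⟩ rfl ⟨⟨rfl, rfl⟩, hent _, hpath⟩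
      fun r hr => .inl hr

theorem CInv.step_ret (h : CInv a b g D c) (hs : (c.thread t).pc = .ret)
    (hst : step a b ch t c.mem (c.thread t) = some (m', s')) :
    Preserved a b g D c ⟨m', Function.update c.thread t s'⟩ := by
  unfold step at hst
  rw [hs] at hst
  simp only at hst
  have hstk := h.stack t
  split at hst <;> cases hst
  · exact h.advance_clean hs ⟨rfl, rfl, rfl⟩ rfl trivial fun r hr => .inl hr
  · rename_i r rs hrs
    exact h.advance_clean hs ⟨rfl, rfl, rfl⟩ rfl (hstk r (by rw [hrs]; exact List.mem_cons_self))
      fun r' hr' => .inl (by rw [hrs]; exact List.mem_cons_of_mem r hr')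

/-- The result of a search is correct for the routine that has called it. -/
theorem PCInv.afterSearch {r : Routine K V} {key : K} {target : Option Addr}
    {path : Path} (hargs : SearchArgs c.mem key target r) (hpath : PathOK g c.mem path)
    (hkey : (g.range path.n).Contains key)
    (hend : (c.mem.node path.n).kind = .leaf ∨ target = some path.n) :
    (afterSearch r key path).held = [] ∧
      PCInv a b g c.mem t (OCCABTree.afterSearch r key path) := by
  obtain ⟨h1, h2, h3⟩ := hpath
  have hleaf : target = none → LeafPath g c.mem key path := fun ht =>
    ⟨⟨h1, h2, h3⟩, hend.resolve_right (by simp [ht]), hkey⟩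
  cases r <;> simp only [OCCABTree.afterSearch]
  case find k => exact ⟨rfl, by simp, hleaf hargs.2⟩
  case insert k v => exact ⟨rfl, by rintro _ _ ⟨⟩; exact hargs.1, hleaf hargs.2⟩
  case delete k => exact ⟨rfl, by simp, hleaf hargs.2⟩
  case fixTagged x =>
    split_ifs with hx
    · subst hx
      split
      · rename_i p gp hp hgp
        obtain ⟨p', hp', h4⟩ := h3 gp hgp
        obtain rfl : p = p' := Option.some_injective _ (hp.symm.trans hp')
        exact ⟨rfl, ⟨hargs.2, h1, h2 p hp, h4⟩, [], rfl⟩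
      · exact ⟨rfl, trivial⟩
    · exact ⟨rfl, trivial⟩
  case fixUnderfull x =>
    by_cases hx : path.n = x
    · subst hx
      rw [if_pos rfl]
      split
      · rename_i p gp hp hgp
        obtain ⟨p', hp', h4⟩ := h3 gp hgp
        obtain rfl : p = p' := Option.some_injective _ (hp.symm.trans hp')
        exact ⟨rfl, h1, h2 p hp, h4, rfl⟩
      · exact ⟨rfl, trivial⟩
    · rw [if_neg hx]
      exact ⟨rfl, trivial⟩

theorem CInv.step_search (h : CInv a b g D c) {r : Routine K V} {key : K} {target : Option Addr}
    {path : Path} {pt : SearchPoint} (hs : (c.thread t).pc = .search r key target path pt)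
    (hst : step a b ch t c.mem (c.thread t) = some (m', s')) :
    Preserved a b g D c ⟨m', Function.update c.thread t s'⟩ := by
  have hpc := h.pc t
  rw [hs] at hpc
  unfold step at hst
  rw [hs] at hst
  obtain ⟨hargs, hkey, hpt⟩ := hpc
  cases pt <;> simp only at hst hpt
  case head =>
    split_ifs at hst with h1 <;> cases hst
    · obtain ⟨h2, h3⟩ := PCInv.afterSearch (a := a) (b := b) (t := t) hargs hpt hkey h1
      exact h.advance_clean hs ⟨rfl, rfl, rfl⟩ h2 h3 fun r hr => .inl hr
    · simp only [not_or] at h1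
      obtain ⟨h2, h3, h4⟩ := hpt
      obtain ⟨ks, cs, e1, e2, -⟩ := h.mem.inner (h.mem.once_lt _ h2) h1.1
      refine h.advance_clean hs ⟨rfl, rfl, rfl⟩ rfl ⟨hargs, hkey, ⟨h2, h1.1, rfl, h3⟩, ?_, hkey.1⟩
        fun r hr => .inl hr
      show 0 < (c.mem.node path.n).data.size
      rw [e1]
      show 0 < cs.length
      have := e2.length_eq
      omega
  case size =>
    obtain ⟨h1, h2, h3⟩ := hpt
    split_ifs at hst with h4 <;> cases hst
    · exact h.advance_clean hs ⟨rfl, rfl, rfl⟩ rfl ⟨hargs, hkey, h1, by omega, h3⟩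
        fun r hr => .inl hr
    · obtain ⟨ks, cs, e1, e2, -⟩ := h.mem.inner (h.mem.once_lt _ h1.1) h1.2.1
      refine h.advance_clean hs ⟨rfl, rfl, rfl⟩ rfl ⟨hargs, hkey, h1, h3, ?_⟩ fun r hr => .inl hr
      have e3 : (c.mem.node path.n).data.keys path.nIdx = none := by
        rw [e1] at h4 ⊢
        have := e2.length_eq
        simp only [innerOf] at h4 ⊢
        exact List.getElem?_eq_none (by omega)
      simp only [childRange, e3]
      exact hkey.2
  case key =>
    obtain ⟨h1, h2, h3⟩ := hpt
    split at hst
    · rename_i k hk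
      split_ifs at hst with h4 <;> cases hst
      · refine h.advance_clean hs ⟨rfl, rfl, rfl⟩ rfl ⟨hargs, hkey, h1, h2, ?_⟩
          fun r hr => .inl hr
        simp only [childRange, hk]
        exact_mod_cast h4
      · refine h.advance_clean hs ⟨rfl, rfl, rfl⟩ rfl ⟨hargs, hkey, h1, h3, ?_⟩
          fun r hr => .inl hr
        simp only [childRange, hk]
        exact_mod_cast lt_of_not_ge h4
    · cases hst
  case ptr =>
    obtain ⟨⟨h1, h2, h3, h4⟩, h5⟩ := hpt
    split at hst
    · rename_i n hn
      cases hst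
      have hc : c.mem.Child path.n path.nIdx n := ⟨h2, hn⟩
      refine h.advance_clean hs ⟨rfl, rfl, rfl⟩ rfl ⟨hargs, ?_, h.mem.closed _ h1 _ _ hc,
        fun p hp => ?_, fun gp hgp => ⟨path.n, h3, h4 gp hgp⟩⟩ fun r hr => .inl hr
      · show (g.range n).Contains key
        rw [h.mem.child_range (h.mem.once_lt _ h1) hc]
        exact h5
      · obtain rfl : path.n = p := Option.some_injective _ (h3.symm.trans hp)
        exact ⟨h1, h2, .inl hn⟩
    · cases hst

theorem CInv.step_leafVer (h : CInv a b g D c) {r : Routine K V} {key : K} {path : Path}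
    (hs : (c.thread t).pc = .leafVer r key path)
    (hst : step a b ch t c.mem (c.thread t) = some (m', s')) :
    Preserved a b g D c ⟨m', Function.update c.thread t s'⟩ := by
  have hpc := h.pc t
  unfold step at hst
  rw [hs] at hst
  simp only at hst
  split_ifs at hst <;> cases hst
  · exact h.advance_clean rfl (by rw [hs]; exact ⟨rfl, rfl, rfl⟩) rfl hpc fun r hr => .inl hr
  · rw [hs] at hpc
    exact h.advance_clean hs ⟨rfl, rfl, rfl⟩ rfl hpc fun r hr => .inl hr

theorem CInv.step_leafKey (h : CInv a b g D c) {r : Routine K V} {key : K} {path : Path}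
    {v i : ℕ} (hs : (c.thread t).pc = .leafKey r key path v i)
    (hst : step a b ch t c.mem (c.thread t) = some (m', s')) :
    Preserved a b g D c ⟨m', Function.update c.thread t s'⟩ := by
  have hpc := h.pc t
  rw [hs] at hpc
  unfold step at hst
  rw [hs] at hst
  simp only at hst
  split_ifs at hst <;> cases hst <;>
    exact h.advance_clean hs ⟨rfl, rfl, rfl⟩ rfl hpc fun r hr => .inl hr

theorem CInv.step_leafVer2 (h : CInv a b g D c) {r : Routine K V} {key : K} {path : Path}
    {v : ℕ} {val : Option V} (hs : (c.thread t).pc = .leafVer2 r key path v val)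
    (hst : step a b ch t c.mem (c.thread t) = some (m', s')) :
    Preserved a b g D c ⟨m', Function.update c.thread t s'⟩ := by
  have hpc := h.pc t
  rw [hs] at hpc
  unfold step at hst
  rw [hs] at hst
  simp only at hst
  split_ifs at hst
  · cases hst
    exact h.advance_clean hs ⟨rfl, rfl, rfl⟩ rfl hpc fun r hr => .inl hr
  · obtain ⟨h1, h2⟩ := hpc
    have hret : ∀ w, Preserved a b g D c ⟨c.mem,
        Function.update c.thread t { c.thread t with pc := .ret, result := w }⟩ := fun w =>
      h.advance_clean hs ⟨rfl, rfl, rfl⟩ rfl trivial fun r hr => .inl hr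
    cases r with
    | find k => cases val <;> cases hst <;> exact hret _
    | insert k v =>
        cases val <;> cases hst
        · obtain rfl := h1 k v rfl
          exact h.advance_clean hs ⟨rfl, rfl, rfl⟩ rfl h2 fun r hr => .inl hr
        · exact hret _
    | delete k =>
        cases val <;> cases hst
        · exact hret _
        · exact h.advance_clean hs ⟨rfl, rfl, rfl⟩ rfl ⟨h2.1.1, h2.2.1⟩ fun r hr => .inl hr
    | fixTagged x => cases val <;> cases hst
    | fixUnderfull x => cases val <;> cases hst

theorem CInv.step_insMarked (h : CInv a b g D c) {k : K} {v : V} {path : Path}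
    (hs : (c.thread t).pc = .insMarked k v path)
    (hst : step a b ch t c.mem (c.thread t) = some (m', s')) :
    Preserved a b g D c ⟨m', Function.update c.thread t s'⟩ := by
  have hpc := h.pc t
  rw [hs] at hpc
  unfold step at hst
  rw [hs] at hst
  simp only at hst
  split_ifs at hst with h1 <;> cases hst
  · exact h.advance_clean hs ⟨rfl, rfl, rfl⟩ rfl (.inr ⟨_, rfl, trivial⟩) fun r hr => .inl hr
  · exact h.advance_clean hs ⟨rfl, rfl, rfl⟩ rfl
      ⟨hpc, by simpa using h1, fun j hj => absurd hj (Nat.not_lt_zero j)⟩ fun r hr => .inl hr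

theorem CInv.step_insScan (h : CInv a b g D c) {k : K} {v : V} {path : Path} {i : ℕ}
    (hs : (c.thread t).pc = .insScan k v path i)
    (hst : step a b ch t c.mem (c.thread t) = some (m', s')) :
    Preserved a b g D c ⟨m', Function.update c.thread t s'⟩ := by
  have hpc := h.pc t
  rw [hs] at hpc
  obtain ⟨h1, h2, h3⟩ := hpc
  unfold step at hst
  rw [hs] at hst
  simp only at hst
  split_ifs at hst with h4 h5 <;> cases hst
  · exact h.advance_clean hs ⟨rfl, rfl, rfl⟩ rfl h1.1.1 fun r hr => .inl hr
  · refine h.advance_clean hs ⟨rfl, rfl, rfl⟩ rfl ⟨h1, h2, fun j hj => ?_⟩ fun r hr => .inl hr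
    rcases Nat.lt_succ_iff_lt_or_eq.1 hj with hj | rfl
    · exact h3 j hj
    · exact h5
  · refine h.advance_clean hs ⟨rfl, rfl, rfl⟩ rfl ⟨h1, h2, fun j hj => ?_⟩ fun r hr => .inl hr
    have hlf := ((h.mem.node _ (h.mem.once_lt _ h1.1.1)).leaf h1.2.1).2
    exact h3 j ((hlf.lt j k hj).trans_le (not_lt.1 h4)) hj

theorem CInv.step_insSize (h : CInv a b g D c) {k : K} {v : V} {path : Path}
    (hs : (c.thread t).pc = .insSize k v path)
    (hst : step a b ch t c.mem (c.thread t) = some (m', s')) :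
    Preserved a b g D c ⟨m', Function.update c.thread t s'⟩ := by
  have hpc := h.pc t
  rw [hs] at hpc
  obtain ⟨h1, h2, h3⟩ := hpc
  unfold step at hst
  rw [hs] at hst
  simp only at hst
  split_ifs at hst with h4
  · cases hst
    exact h.advance_clean hs ⟨rfl, rfl, rfl⟩ rfl ⟨h1, h2, h3⟩ fun r hr => .inl hr
  · split at hst
    · rename_i p hp
      cases hst
      exact h.advance_clean hs ⟨rfl, rfl, rfl⟩ rfl
        ⟨⟨⟨h1.1.1, h1.2.1, h2⟩, h1.2.2, h3, not_lt.1 h4, h1.1.2.1 p hp⟩, [], rfl⟩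
        fun r hr => .inl hr
    · cases hst

theorem CInv.step_insEmpty (h : CInv a b g D c) {k : K} {v : V} {path : Path} {i : ℕ}
    (hs : (c.thread t).pc = .insEmpty k v path i)
    (hst : step a b ch t c.mem (c.thread t) = some (m', s')) :
    Preserved a b g D c ⟨m', Function.update c.thread t s'⟩ := by
  have hpc := h.pc t
  rw [hs] at hpc
  obtain ⟨h1, h2, h3⟩ := hpc
  unfold step at hst
  rw [hs] at hst
  simp only at hst
  split_ifs at hst with h4 h5 <;> cases hst
  · exact h.advance_clean hs ⟨rfl, rfl, rfl⟩ rfl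
      ⟨⟨h1.1.1, h1.2.1, h2⟩, h1.2.2, h3, h4, h5⟩ fun r hr => .inl hr
  · exact h.advance_clean hs ⟨rfl, rfl, rfl⟩ rfl ⟨h1, h2, h3⟩ fun r hr => .inl hr
  · exact h.advance_clean hs ⟨rfl, rfl, rfl⟩ rfl (.inl rfl) fun r hr => .inl hr

theorem Contents.numKeys_insert {d : Contents K V} {i : ℕ} (hi : i < b) (hn : d.keys i = none)
    (k : K) : ({ d with keys := Function.update d.keys i (some k) } : Contents K V).numKeys b =
      d.numKeys b + 1 := by
  unfold Contents.numKeys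
  rw [← Finset.card_insert_of_notMem (a := i) (by simp [hn])]
  congr 1
  ext j
  by_cases hj : j = i
  · subst hj; simp [hi]
  · simp [hj]

theorem Contents.numKeys_erase {d : Contents K V} {i : ℕ} (hi : i < b)
    (hn : (d.keys i).isSome = true) :
    d.numKeys b =
      ({ d with keys := Function.update d.keys i none } : Contents K V).numKeys b + 1 := by
  unfold Contents.numKeys
  rw [← Finset.card_insert_of_notMem (a := i) (by simp)]
  congr 1
  ext j
  by_cases hj : j = i
  · subst hj; simp [hi, hn]
  · simp [hj]

theorem LeafOK.insert {I : Range K} {d : Contents K V} (hd : LeafOK b I d) {i : ℕ} (hi : i < b)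
    {k : K} (hk : I.Contains k) (hnew : ∀ j, d.keys j ≠ some k) :
    LeafOK b I { d with keys := Function.update d.keys i (some k) } := by
  have hcase : ∀ j k', Function.update d.keys i (some k) j = some k' →
      (j = i ∧ k' = k) ∨ d.keys j = some k' := by
    intro j k' h
    by_cases hj : j = i
    · subst hj; simp at h; exact .inl ⟨rfl, h.symm⟩
    · rw [Function.update_of_ne hj] at h; exact .inr h
  refine ⟨fun j k' h => ?_, hd.ptrs, fun j l k' h h' => ?_, fun j k' h => ?_⟩
  · rcases hcase j k' h with ⟨rfl, -⟩ | h
    · exact hi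
    · exact hd.lt j k' h
  · rcases hcase j k' h with ⟨e1, e2⟩ | h1 <;> rcases hcase l k' h' with ⟨e3, e4⟩ | h2
    · rw [e1, e3]
    · exact absurd (e2 ▸ h2) (hnew l)
    · exact absurd (e4 ▸ h1) (hnew j)
    · exact hd.inj j l k' h1 h2
  · rcases hcase j k' h with ⟨rfl, rfl⟩ | h
    · exact hk
    · exact hd.mem j k' h

theorem LeafOK.erase {I : Range K} {d : Contents K V} (hd : LeafOK b I d) (i : ℕ) :
    LeafOK b I { d with keys := Function.update d.keys i none } := by
  have hcase : ∀ j k', Function.update d.keys i none j = some k' → d.keys j = some k' := by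
    intro j k' h
    by_cases hj : j = i
    · subst hj; simp at h
    · rwa [Function.update_of_ne hj] at h
  exact ⟨fun j k' h => hd.lt j k' (hcase j k' h), hd.ptrs,
    fun j l k' h h' => hd.inj j l k' (hcase j k' h) (hcase l k' h'),
    fun j k' h => hd.mem j k' (hcase j k' h)⟩

theorem CInv.leafOK (h : CInv a b g D c) {x : Addr} (hx : LiveLeaf g c.mem x) :
    LeafOK b (g.range x) (c.mem.node x).data :=
  ((h.mem.node x (h.mem.once_lt x hx.1)).leaf hx.2.1).2

/-- The write of the key, or of the value, or to the size of an insertion into a leaf. -/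
theorem CInv.step_insWrite (h : CInv a b g D c)
    (hs : (∃ k v leaf i, (c.thread t).pc = .insKey k v leaf i) ∨
      (∃ v leaf i, (c.thread t).pc = .insVal v leaf i) ∨
      ∃ leaf, (c.thread t).pc = .insInc leaf)
    (hst : step a b ch t c.mem (c.thread t) = some (m', s')) :
    Preserved a b g D c ⟨m', Function.update c.thread t s'⟩ := by
  have hpc := h.pc t
  unfold step at hst
  rcases hs with ⟨k, v, leaf, i, hs⟩ | ⟨v, leaf, i, hs⟩ | ⟨leaf, hs⟩ <;>
    rw [hs] at hpc hst <;> cases hst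
  · obtain ⟨h1, h2, h3, h4, h5⟩ := hpc
    have hsz := h.size_of_held (t := t) (x := leaf)
      (by rw [hs]; exact List.mem_singleton_self _) h1.2.1 (by rw [hs]; rfl)
    refine h.advance_leaf h1 (by rw [hs]; rfl) rfl ((h.leafOK h1).insert h4 h2 h3)
      (by rw [hs]; rfl) (.inr rfl) rfl rfl fun e hl => ⟨hl, ?_⟩
    rw [e, Contents.numKeys_insert h4 h5, ← hsz]
  · obtain ⟨h1, h2⟩ := hpc
    have hd := h.leafOK h1
    exact h.advance_leaf h1 (by rw [hs]; rfl) rfl ⟨hd.lt, hd.ptrs, hd.inj, hd.mem⟩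
      (by rw [hs]; rfl) (.inr rfl) rfl rfl fun e hl => ⟨hl, by rw [e]; exact h2⟩
  · obtain ⟨h1, h2⟩ := hpc
    have hd := h.leafOK h1
    exact h.advance_leaf h1 (by rw [hs]; rfl) rfl ⟨hd.lt, hd.ptrs, hd.inj, hd.mem⟩
      (by rw [hs]; rfl) (.inl h2) rfl rfl fun e hl => hl

theorem CInv.step_delMarked (h : CInv a b g D c) {k : K} {leaf : Addr}
    (hs : (c.thread t).pc = .delMarked k leaf)
    (hst : step a b ch t c.mem (c.thread t) = some (m', s')) :
    Preserved a b g D c ⟨m', Function.update c.thread t s'⟩ := by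
  have hpc := h.pc t
  rw [hs] at hpc
  unfold step at hst
  rw [hs] at hst
  simp only at hst
  split_ifs at hst with h1 <;> cases hst
  · exact h.advance_clean hs ⟨rfl, rfl, rfl⟩ rfl (.inr ⟨_, rfl, trivial⟩) fun r hr => .inl hr
  · exact h.advance_clean hs ⟨rfl, rfl, rfl⟩ rfl ⟨hpc.1, hpc.2, by simpa using h1⟩
      fun r hr => .inl hr

theorem CInv.step_delScan (h : CInv a b g D c) {k : K} {leaf : Addr} {i : ℕ}
    (hs : (c.thread t).pc = .delScan k leaf i)
    (hst : step a b ch t c.mem (c.thread t) = some (m', s')) :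
    Preserved a b g D c ⟨m', Function.update c.thread t s'⟩ := by
  have hpc := h.pc t
  rw [hs] at hpc
  unfold step at hst
  rw [hs] at hst
  simp only at hst
  split_ifs at hst with h1 h2 <;> cases hst
  · exact h.advance_clean hs ⟨rfl, rfl, rfl⟩ rfl ⟨hpc, h1, by rw [h2]; rfl⟩ fun r hr => .inl hr
  · exact h.advance_clean hs ⟨rfl, rfl, rfl⟩ rfl hpc fun r hr => .inl hr
  · exact h.advance_clean hs ⟨rfl, rfl, rfl⟩ rfl (.inl rfl) fun r hr => .inl hr

/-- The write of the key, or to the size of a deletion from a leaf. -/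
theorem CInv.step_delWrite (h : CInv a b g D c)
    (hs : (∃ leaf i, (c.thread t).pc = .delKey leaf i) ∨ ∃ leaf, (c.thread t).pc = .delDec leaf)
    (hst : step a b ch t c.mem (c.thread t) = some (m', s')) :
    Preserved a b g D c ⟨m', Function.update c.thread t s'⟩ := by
  have hpc := h.pc t
  unfold step at hst
  rcases hs with ⟨leaf, i, hs⟩ | ⟨leaf, hs⟩ <;> rw [hs] at hpc hst <;> cases hst
  · obtain ⟨h1, h2, h3⟩ := hpc
    have hsz := h.size_of_held (t := t) (x := leaf)
      (by rw [hs]; exact List.mem_singleton_self _) h1.2.1 (by rw [hs]; rfl)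
    refine h.advance_leaf h1 (by rw [hs]; rfl) rfl ((h.leafOK h1).erase i)
      (by rw [hs]; rfl) (.inr rfl) rfl rfl fun e hl => ⟨hl, ?_⟩
    rw [e, ← Contents.numKeys_erase h2 h3, ← hsz]
  · obtain ⟨h1, h2⟩ := hpc
    have hd := h.leafOK h1
    refine h.advance_leaf h1 (by rw [hs]; rfl) rfl ⟨hd.lt, hd.ptrs, hd.inj, hd.mem⟩
      (by rw [hs]; rfl) (.inl ?_) rfl rfl fun e hl => hl
    show (c.mem.node leaf).data.numKeys b = (c.mem.node leaf).data.size - 1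
    omega

theorem CInv.step_delSize (h : CInv a b g D c) {leaf : Addr}
    (hs : (c.thread t).pc = .delSize leaf)
    (hst : step a b ch t c.mem (c.thread t) = some (m', s')) :
    Preserved a b g D c ⟨m', Function.update c.thread t s'⟩ := by
  have hpc := h.pc t
  rw [hs] at hpc
  unfold step at hst
  rw [hs] at hst
  simp only at hst
  have hlt := h.mem.once_lt leaf hpc.1
  split_ifs at hst with h1 <;> cases hst
  · refine h.advance_local (by rw [hs]; rfl) (.inl rfl) (fun r hr => ?_)
      (by rw [hs]; exact fun x hx => hx) (by rw [hs]; exact fun x hx => hx)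
      (by rw [hs]; exact fun x hx => hx)
    rcases List.mem_cons.1 hr with rfl | hr
    · exact hlt
    · exact h.stack t r hr
  · exact h.advance_local (by rw [hs]; rfl) (.inl rfl) (h.stack t)
      (by rw [hs]; exact fun x hx => hx) (by rw [hs]; exact fun x hx => hx)
      (by rw [hs]; exact fun x hx => hx)

end Operations

/-! ### Steps of the updates that replace nodes -/

section Updates

variable {K V T : Type*} [LinearOrder K] [DecidableEq T]
variable {a b : ℕ} {g : Ghost K T} {D : Addr → Contents K V} {c : Config K V T} {t : T}
  {ch : Choice K V} {m m' : Memory K V T} {s' : Thread K V} {u : Update K V}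

theorem Update.OK.once (h : u.OK b g m) : ∀ x ∈ u.locks, x ∈ g.once := by
  intro x hx
  cases u with
  | split k v leaf p nIdx =>
      obtain ⟨h1, -, -, -, h2⟩ := h
      simp only [Update.locks, List.mem_cons, List.not_mem_nil, or_false] at hx
      rcases hx with rfl | rfl
      exacts [h1.1, h2.1]
  | tagged y p gp nIdx pIdx =>
      obtain ⟨-, h1, h2, h3⟩ := h
      simp only [Update.locks, List.mem_cons, List.not_mem_nil, or_false] at hx
      rcases hx with rfl | rfl | rfl
      exacts [h1, h2.1, h3.1]
  | underfull y s p gp nIdx sIdx pIdx =>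
      obtain ⟨h1, h2, -, h3, -⟩ := h
      have hx' : x = y ∨ x = s ∨ x = p ∨ x = gp := by
        simp only [Update.locks] at hx
        split_ifs at hx <;> (simp only [List.mem_cons, List.not_mem_nil, or_false] at hx; tauto)
      rcases hx' with rfl | rfl | rfl | rfl
      exacts [h1.1, h1.2, h2.1, h3.1]

theorem Update.OK.routineOK (hI : MInv b g m) (h : u.OK b g m) : RoutineOK m u.routine := by
  cases u with
  | split k v leaf p nIdx => trivial
  | tagged x p gp nIdx pIdx => exact hI.once_lt x h.2.1
  | underfull x s p gp nIdx sIdx pIdx => exact hI.once_lt x h.1.1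

theorem Update.target_not_source (h : u.locks.Nodup) : u.target ∉ u.sources := by
  cases u with
  | split k v leaf p nIdx =>
      simp only [Update.locks, List.nodup_cons, List.mem_cons, List.not_mem_nil, or_false] at h
      simp only [Update.target, Update.sources, List.mem_singleton]
      tauto
  | tagged x p gp nIdx pIdx =>
      simp only [Update.locks, List.nodup_cons, List.mem_cons, List.not_mem_nil, or_false] at h
      simp only [Update.target, Update.sources, List.mem_cons, List.not_mem_nil, or_false]
      tauto
  | underfull x s p gp nIdx sIdx pIdx =>
      simp only [Update.locks] at h
      simp only [Update.target, Update.sources, List.mem_cons, List.not_mem_nil, or_false]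
      split_ifs at h <;>
        (simp only [List.nodup_cons, List.mem_cons, List.not_mem_nil, or_false] at h; tauto)

/-- Marks on locked nodes and the absence of a mark on a child imply that it has not been unlinked. -/
theorem CInv.ptr_of_edge (h : CInv a b g D c) {p n : Addr} {i : ℕ} (he : Edge g c.mem p i n)
    (hn : n ∈ (c.thread t).pc.held) (hm : (c.mem.node n).marked = false)
    (hu : (c.thread t).pc.unlinked = []) : (c.mem.node p).data.ptrs i = some n :=
  he.resolve_right (h.not_dead hn hm hu)

theorem take_length_sub {α : Type*} (l : List α) (x : α) (xs : List α) :
    (l ++ x :: xs).take ((l ++ x :: xs).length - xs.length) =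
      (l ++ x :: xs).take ((l ++ x :: xs).length - (x :: xs).length) ++ [x] := by
  have e : (l ++ x :: xs).take ((l ++ x :: xs).length - (x :: xs).length) = l :=
    List.take_left' (by simp)
  rw [e, show l ++ x :: xs = (l ++ [x]) ++ xs by simp]
  exact List.take_left' (by simp; omega)

theorem CInv.step_acquire (h : CInv a b g D c) {todo : List Addr}
    (hs : (c.thread t).pc = .acquire u todo)
    (hst : step a b ch t c.mem (c.thread t) = some (m', s')) :
    Preserved a b g D c ⟨m', Function.update c.thread t s'⟩ := by
  have hpc := h.pc t
  rw [hs] at hpc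
  obtain ⟨h1, done, h2⟩ := hpc
  unfold step at hst
  rw [hs] at hst
  cases todo with
  | nil =>
      cases hst
      refine h.advance_clean hs ⟨rfl, rfl, rfl⟩ ?_ ⟨h1, fun c hc => .inl hc⟩ fun r hr => .inl hr
      show u.locks = u.locks.take (u.locks.length - 0)
      rw [Nat.sub_zero, List.take_length]
  | cons x xs =>
      simp only at hst
      split_ifs at hst with hl
      cases hst
      refine h.advance_lock_clean hs (h1.once x (by rw [h2]; simp)) hl ⟨rfl, rfl, rfl⟩ ?_
        ⟨h1, done ++ [x], by rw [h2]; simp⟩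
      show u.locks.take (u.locks.length - xs.length) =
        u.locks.take (u.locks.length - (x :: xs).length) ++ [x]
      rw [h2]
      exact take_length_sub _ x xs

/-- When all tests have succeeded, the nodes of the update are the children of one another. -/
theorem CInv.tested (h : CInv a b g D c) (hs : (c.thread t).pc = .test u []) :
    u.Tested c.mem := by
  have hpc := h.pc t
  rw [hs] at hpc
  obtain ⟨h1, h2⟩ := hpc
  have hedge : ∀ {p n : Addr} {i : ℕ}, Edge g c.mem p i n → n ∈ u.locks →
      (c.mem.node n).marked = false → (c.mem.node p).data.ptrs i = some n := fun he hn hm =>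
    h.ptr_of_edge (t := t) he (by rw [hs]; exact hn) hm (by rw [hs]; rfl)
  have h3 : ∀ c' ∈ u.tests, c'.holds a c.mem = true := fun c' hc' =>
    (h2 c' hc').resolve_left List.not_mem_nil
  cases u with
  | split k v leaf p nIdx =>
      simp only [Update.tests, List.mem_cons, List.not_mem_nil, or_false, forall_eq,
        Test.holds, Bool.not_eq_true'] at h3
      exact ⟨hedge h1.2.2.2.2.2.2 (by simp [Update.locks]) h1.1.2.2, h3⟩
  | tagged x p gp nIdx pIdx =>
      simp only [Update.tests, List.mem_cons, List.not_mem_nil, or_false, forall_eq_or_imp,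
        forall_eq, Test.holds, Bool.not_eq_true', decide_eq_true_eq] at h3
      obtain ⟨q1, q2, q3, q4⟩ := h3
      obtain ⟨-, -, h4, h5⟩ := h1
      exact ⟨hedge h4.2.2 (by simp [Update.locks]) q1, hedge h5.2.2 (by simp [Update.locks]) q2,
        q3, q4⟩
  | underfull x s p gp nIdx sIdx pIdx =>
      simp only [Update.tests, List.mem_cons, List.not_mem_nil, or_false, forall_eq_or_imp,
        forall_eq, Test.holds, Bool.not_eq_true', decide_eq_true_eq] at h3
      obtain ⟨-, -, q1, q2, q3, q4, q5, q6, q7⟩ := h3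
      obtain ⟨-, h4, h5, h6, -⟩ := h1
      have hl : ∀ y, y = x ∨ y = s ∨ y = p →
          y ∈ (Update.underfull x s p gp nIdx sIdx pIdx : Update K V).locks := by
        intro y hy
        simp only [Update.locks]
        split_ifs <;> (simp only [List.mem_cons, List.not_mem_nil, or_false]; tauto)
      exact ⟨hedge h4.2.2 (hl x (by simp)) q1, hedge h5.2.2 (hl s (by simp)) q2,
        hedge h6.2.2 (hl p (by simp)) q3, q4, q5, q6, q7⟩

theorem CInv.step_test (h : CInv a b g D c) {todo : List Test}
    (hs : (c.thread t).pc = .test u todo)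
    (hst : step a b ch t c.mem (c.thread t) = some (m', s')) :
    Preserved a b g D c ⟨m', Function.update c.thread t s'⟩ := by
  have hpc := h.pc t
  rw [hs] at hpc
  obtain ⟨h1, h2⟩ := hpc
  unfold step at hst
  rw [hs] at hst
  cases todo with
  | nil =>
      cases hst
      exact h.advance_clean hs ⟨rfl, rfl, rfl⟩ rfl
        ⟨h1, h.tested hs, fun x hx => hx, fun x hx => .inl hx⟩ fun r hr => .inl hr
  | cons c' cs =>
      simp only at hst
      split_ifs at hst with h3 <;> cases hst
      · refine h.advance_clean hs ⟨rfl, rfl, rfl⟩ rfl ⟨h1, fun c'' hc => ?_⟩ fun r hr => .inl hr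
        rcases h2 c'' hc with h4 | h4
        · rcases List.mem_cons.1 h4 with rfl | h4
          · exact .inr h3
          · exact .inl h4
        · exact .inr h4
      · refine h.advance_clean hs ⟨rfl, rfl, rfl⟩ rfl ?_ fun r hr => .inl hr
        cases c'
        case sizeBelow x => exact .inl rfl
        all_goals exact .inr ⟨_, rfl, h1.routineOK h.mem⟩

theorem CInv.step_premark (h : CInv a b g D c) {todo : List Addr}
    (hs : (c.thread t).pc = .premark u todo)
    (hst : step a b ch t c.mem (c.thread t) = some (m', s')) :
    Preserved a b g D c ⟨m', Function.update c.thread t s'⟩ := by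
  have hpc := h.pc t
  have hnd := h.nodup t
  rw [hs] at hpc hnd
  obtain ⟨h1, h2, h3, h4⟩ := hpc
  unfold step at hst
  rw [hs] at hst
  cases todo with
  | nil =>
      cases hst
      refine h.advance_clean hs ⟨rfl, rfl, rfl⟩ rfl ⟨h1, h2,
        fun x hx => (h4 x hx).resolve_left List.not_mem_nil, fun x hx c hc => .inl ?_⟩
        fun r hr => .inl hr
      exact List.mem_flatMap.2 ⟨x, hx, List.mem_map.2 ⟨c, hc, rfl⟩⟩
  | cons x xs =>
      cases hst
      have hx := h3 x List.mem_cons_self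
      have hxs := u.premarks_subset x hx
      have hmod := c.mem.modify_marked x
      have hE := Extends.modify_marked (g := g) c.mem x
      refine h.advance_mark (by rw [hs]; exact u.sources_subset x hxs) (by rw [hs]; rfl)
        ⟨?_, ?_, fun y hy => h3 y (List.mem_cons_of_mem x hy), fun y hy => ?_⟩ rfl
        (by rw [hs]; simp [PC.unlinked]) (by rw [hs]; rfl) (by rw [hs]; simp [PC.dirty])
      · -- only `fixTagged` marks nodes at this point, and it has no initial locks
        have : u.initialLocks = [] := by
          cases u <;> simp [Update.premarks, Update.initialLocks] at hx ⊢
        exact h1.frame hE h.mem (by simp [this])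
      · refine h2.frame (fun y _ => ⟨(hmod y).2.1, (hmod y).1⟩) ?_
        rw [(hmod _).2.2.2, if_neg]
        intro e
        exact Update.target_not_source hnd (e ▸ hxs)
      · rw [(hmod y).2.2.2]
        split_ifs with hyx
        · exact .inr rfl
        · exact (h4 y hy).imp_left fun h5 => (List.mem_cons.1 h5).resolve_left hyx

theorem Cell.same_copyCell (src dst : Contents K V) (c : Cell) :
    c.Same (Contents.copyCell src dst c) src := by
  cases c <;> simp [Cell.Same, Contents.copyCell]

theorem Cell.Same.copyCell {src dst : Contents K V} {c : Cell} (h : c.Same dst src) (c' : Cell) :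
    c.Same (Contents.copyCell src dst c') src := by
  cases c' with
  | size => cases c <;> first | rfl | exact h
  | key i =>
      cases c with
      | key j =>
          by_cases hj : j = i
          · subst hj; simp [Cell.Same, Contents.copyCell]
          · simpa [Cell.Same, Contents.copyCell, hj] using h
      | _ => exact h
  | val i =>
      cases c with
      | val j =>
          by_cases hj : j = i
          · subst hj; simp [Cell.Same, Contents.copyCell]
          · simpa [Cell.Same, Contents.copyCell, hj] using h
      | _ => exact h
  | ptr i =>
      cases c with
      | ptr j =>
          by_cases hj : j = i
          · subst hj; simp [Cell.Same, Contents.copyCell]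
          · simpa [Cell.Same, Contents.copyCell, hj] using h
      | _ => exact h

/-- The parts of the contents from which the new nodes are constructed are determined by the cells
below `b`. -/
theorem parts_eq_of_same {d d' : Contents K V} (h : ∀ c ∈ cells b, c.Same d d')
    (hb : d'.size ≤ b) : d.size = d'.size ∧ d.entries b = d'.entries b ∧
      d.routing = d'.routing ∧ d.children = d'.children := by
  have hsz : d.size = d'.size := h .size List.mem_cons_self
  have hc : ∀ i < b, ∀ c ∈ [Cell.key i, .val i, .ptr i], c.Same d d' := fun i hi c hc =>
    h c (List.mem_cons_of_mem _ (List.mem_flatMap.2 ⟨i, List.mem_range.2 hi, hc⟩))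
  have hk : ∀ i < b, d.keys i = d'.keys i := fun i hi => hc i hi (.key i) (by simp)
  have hv : ∀ i < b, d.vals i = d'.vals i := fun i hi => hc i hi (.val i) (by simp)
  have hp : ∀ i < b, d.ptrs i = d'.ptrs i := fun i hi => hc i hi (.ptr i) (by simp)
  refine ⟨hsz, ?_, ?_, ?_⟩
  · refine List.filterMap_congr fun i hi => ?_
    rw [hk i (List.mem_range.1 hi), hv i (List.mem_range.1 hi)]
  · unfold Contents.routing
    rw [hsz]
    refine List.filterMap_congr fun i hi => hk i ?_
    have := List.mem_range.1 hi
    omega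
  · unfold Contents.children
    rw [hsz]
    refine List.filterMap_congr fun i hi => hp i ?_
    have := List.mem_range.1 hi
    omega

theorem plan_congr {half : ℕ → ℕ} {kind : Addr → Kind} {buf buf' : Addr → Contents K V}
    {base : Addr} (h : ∀ x ∈ u.sources, (buf x).size = (buf' x).size ∧
      (buf x).entries b = (buf' x).entries b ∧ (buf x).routing = (buf' x).routing ∧
      (buf x).children = (buf' x).children) :
    plan a b half kind buf base u = plan a b half kind buf' base u := by
  cases u with
  | split k v leaf p nIdx =>
      obtain ⟨-, h1, -⟩ := h leaf (by simp [Update.sources])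
      simp only [plan, h1]
  | tagged x p gp nIdx pIdx =>
      obtain ⟨h1, h2, h3, h4⟩ := h x (by simp [Update.sources])
      obtain ⟨p1, p2, p3, p4⟩ := h p (by simp [Update.sources])
      simp only [plan, h3, h4, p1, p3, p4]
  | underfull x s p gp nIdx sIdx pIdx =>
      obtain ⟨h1, h2, h3, h4⟩ := h x (by simp [Update.sources])
      obtain ⟨s1, s2, s3, s4⟩ := h s (by simp [Update.sources])
      obtain ⟨p1, p2, p3, p4⟩ := h p (by simp [Update.sources])
      by_cases hlt : nIdx < sIdx
      · simp only [plan, hlt, if_true, h1, h2, h3, h4, s1, s2, s3, s4, p1, p3, p4]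
      · simp only [plan, hlt, if_false, h1, h2, h3, h4, s1, s2, s3, s4, p1, p3, p4]

/-- The index of the pointer that an update overwrites. -/
def Update.idx : Update K V → ℕ
  | .split _ _ _ _ nIdx => nIdx
  | .tagged _ _ _ _ pIdx => pIdx
  | .underfull _ _ _ _ _ _ pIdx => pIdx

theorem plan_target_idx {half : ℕ → ℕ} {kind : Addr → Kind} {buf : Addr → Contents K V}
    {base : Addr} : (plan a b half kind buf base u).target = u.target ∧
      (plan a b half kind buf base u).idx = u.idx := by
  cases u <;> dsimp only [plan, Update.target, Update.idx] <;> (repeat' split) <;> exact ⟨rfl, rfl⟩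

/-- An update calls rebalancing steps for its new nodes only. -/
theorem plan_calls {half : ℕ → ℕ} {kind : Addr → Kind} {buf : Addr → Contents K V}
    {sk : ℕ → K} : ∀ r ∈ (plan a b half kind buf m.next u).calls,
      RoutineOK (m.alloc sk (plan a b half kind buf m.next u).news) r := by
  intro r hr
  cases u <;> simp only [plan] at hr ⊢ <;> split_ifs at hr ⊢ <;>
    simp only [List.mem_cons, List.not_mem_nil, or_false] at hr <;>
    first
    | (subst hr; simp [RoutineOK, Memory.alloc])
    | (rcases hr with rfl | rfl <;> simp [RoutineOK, Memory.alloc])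

theorem CInv.size_le (h : CInv a b g D c) {x : Addr} (hx : x ∈ (c.thread t).pc.held)
    (hr : (c.thread t).pc.resizing = []) : (c.mem.node x).data.size ≤ b := by
  by_cases hk : (c.mem.node x).kind = .leaf
  · rw [h.size_of_held hx hk hr]
    exact (Finset.card_filter_le _ _).trans (Finset.card_range b).le
  · obtain ⟨ks, cs, h1, -, h3, -⟩ := h.mem.inner (h.mem.once_lt x (h.held t x hx)) hk
    rw [h1]
    exact h3

/-- The new nodes of an update that has copied its nodes can replace the nodes that it is going to
unlink, the topmost one of which is `r`. -/
theorem CInv.copied (ha : 2 ≤ a) (hab : 2 * a ≤ b) (h : CInv a b g D c)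
    {buf : Addr → Contents K V} (hs : (c.thread t).pc = .copy u [] buf) {half : ℕ → ℕ}
    (hh : ∀ n, half n = n / 2 ∨ half n = (n + 1) / 2) :
    ∃ r rs ws, Fragment b g c.mem (plan a b half (fun x => (c.mem.node x).kind)
        (fun x => (c.mem.node x).data) c.mem.next u).news u.target r u.sources rs ws ∧
      (c.mem.node u.target).marked = false ∧ r ∈ u.sources ∧ c.mem.Child u.target u.idx r ∧
      (∀ z ∈ u.sources, z ≠ r → ∃ j, c.mem.Child r j z) ∧
      ∀ z ∈ u.sources, (c.mem.node z).marked = true ∨ z ∈ u.postmarks := by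
  have hpc := h.pc t
  rw [hs] at hpc
  obtain ⟨h1, h2, h3, -⟩ := hpc
  have hsz : ∀ x ∈ u.locks, (c.mem.node x).kind = .leaf →
      (c.mem.node x).data.size = (c.mem.node x).data.numKeys b := fun x hx hk =>
    h.size_of_held (t := t) (by rw [hs]; exact hx) hk (by rw [hs]; rfl)
  have hne : ∀ {gp p : Addr} {i : ℕ}, gp ∈ g.once → c.mem.Child gp i p → p ≠ entry :=
    fun hg hc => (h.mem.child_facts (h.mem.once_lt _ hg) hc).2.1
  have hint : ∀ {p : Addr}, (c.mem.node p).kind ≠ .leaf → (c.mem.node p).kind ≠ .tagged →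
      (c.mem.node p).kind = .internal := by
    intro p q1 q2
    cases hk : (c.mem.node p).kind with
    | leaf => exact absurd hk q1
    | internal => rfl
    | tagged => exact absurd hk q2
  cases u with
  | split k v leaf p nIdx =>
      obtain ⟨q1, q2, q3, q4, q5⟩ := h1
      have hfull : (c.mem.node leaf).data.numKeys b = b := by
        refine le_antisymm ((Finset.card_filter_le _ _).trans (Finset.card_range b).le) ?_
        rw [← hsz leaf (by simp [Update.locks]) q1.2.1]
        exact q4
      obtain ⟨rs, ws, hF⟩ := fragment_split (a := a) (v := v) (p := p) (nIdx := nIdx) h.mem hh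
        (by omega) q1.1 q1.2.1 q2 q3 hfull
      refine ⟨leaf, rs, ws, hF, h2.2, by simp [Update.sources], ⟨q5.2.1, h2.1⟩,
        fun z hz hzr => ?_, fun z hz => .inr hz⟩
      exact absurd (List.mem_singleton.1 hz) hzr
  | tagged x p gp nIdx pIdx =>
      obtain ⟨q1, q2, q3, q4⟩ := h1
      obtain ⟨r1, r2, r3, r4⟩ := h2
      obtain ⟨rs, ws, hF⟩ := fragment_tagged (a := a) (gp := gp) (pIdx := pIdx) h.mem hh
        (by omega) q3.1 (hne q4.1 ⟨q4.2.1, r2⟩) (hint q3.2.1 r4) ⟨q3.2.1, r1⟩ q1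
      refine ⟨p, rs, ws, hF, r3, by simp [Update.sources], ⟨q4.2.1, r2⟩, fun z hz hzp => ?_,
        fun z hz => .inl (h3 z hz)⟩
      simp only [Update.sources, List.mem_cons, List.not_mem_nil, or_false] at hz
      obtain rfl := hz.resolve_right hzp
      exact ⟨nIdx, q3.2.1, r1⟩
  | underfull x s p gp nIdx sIdx pIdx =>
      obtain ⟨q1, q2, q3, q4, q5⟩ := h1
      obtain ⟨r1, r2, r3, r4, r5, r6, r7⟩ := h2
      have hl : ∀ y, y = x ∨ y = s →
          y ∈ (Update.underfull x s p gp nIdx sIdx pIdx : Update K V).locks := by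
        intro y hy
        simp only [Update.locks]
        split_ifs <;> (simp only [List.mem_cons, List.not_mem_nil, or_false]; tauto)
      obtain ⟨rs, ws, hF⟩ := fragment_underfull (gp := gp) (pIdx := pIdx) h.mem hh ha hab q2.1
        (hne q4.1 ⟨q4.2.1, r3⟩) (hint q2.2.1 r7) ⟨q2.2.1, r1⟩ ⟨q2.2.1, r2⟩ q5 r5 r6
        (hsz x (hl x (by simp))) (hsz s (hl s (by simp)))
      refine ⟨p, rs, ws, hF, r4, by simp [Update.sources], ⟨q4.2.1, r3⟩, fun z hz hzp => ?_,
        fun z hz => .inr ?_⟩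
      · simp only [Update.sources, List.mem_cons, List.not_mem_nil, or_false] at hz
        rcases hz with rfl | rfl | rfl
        · exact ⟨nIdx, q2.2.1, r1⟩
        · exact ⟨sIdx, q2.2.1, r2⟩
        · exact absurd rfl hzp
      · simp only [Update.sources, Update.postmarks, List.mem_cons, List.not_mem_nil,
          or_false] at hz ⊢
        tauto

theorem CInv.step_copy (ha : 2 ≤ a) (hab : 2 * a ≤ b) (h : CInv a b g D c)
    {todo : List (Addr × Cell)} {buf : Addr → Contents K V}
    (hs : (c.thread t).pc = .copy u todo buf)
    (hst : step a b ch t c.mem (c.thread t) = some (m', s')) :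
    Preserved a b g D c ⟨m', Function.update c.thread t s'⟩ := by
  have hpc := h.pc t
  have hnd := h.nodup t
  rw [hs] at hpc hnd
  obtain ⟨h1, h2, h3, h4⟩ := hpc
  unfold step at hst
  rw [hs] at hst
  rcases todo with _ | ⟨⟨x, cl⟩, cs⟩
  · have hh : ∀ n, (fun n => if ch.extraLeft then (n + 1) / 2 else n / 2) n = n / 2 ∨
        (fun n => if ch.extraLeft then (n + 1) / 2 else n / 2) n = (n + 1) / 2 := by
      intro n
      cases ch.extraLeft <;> simp
    obtain ⟨r, rs, ws, hF, q1, q2, q3, q4, q5⟩ := h.copied ha hab hs hh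
    have hcongr := plan_congr (a := a) (b := b) (u := u) (buf := buf)
      (buf' := fun x => (c.mem.node x).data) (base := c.mem.next)
      (kind := fun x => (c.mem.node x).kind)
      (half := fun n => if ch.extraLeft then (n + 1) / 2 else n / 2)
      fun x hx => parts_eq_of_same
        (fun cl hcl => (h4 x hx cl hcl).resolve_left List.not_mem_nil)
        (h.size_le (t := t) (by rw [hs]; exact u.sources_subset x hx) (by rw [hs]; rfl))
    simp only [hcongr] at hst
    cases hst
    refine h.advance_alloc hs hF (Update.target_not_source hnd) q1 q2 q3 q4 q5 ?_ fun r hr => ?_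
    · rw [plan_target_idx.1, plan_target_idx.2]
    · rcases List.mem_append.1 hr with hr | hr
      · exact plan_calls r hr
      · exact (Extends.alloc (g := g) (t := t) (rs := rs) (ws := ws)).routineOK (h.stack t r hr)
  · cases hst
    refine h.advance_clean hs ⟨rfl, rfl, rfl⟩ rfl ⟨h1, h2, h3, fun y hy cl' hcl => ?_⟩
      fun r hr => .inl hr
    by_cases hyx : y = x
    · subst hyx
      rw [Function.update_self]
      rcases h4 y hy cl' hcl with h5 | h5
      · rcases List.mem_cons.1 h5 with h6 | h6
        · obtain rfl : cl' = cl := (Prod.mk.inj h6).2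
          exact .inr (Cell.same_copyCell _ _ _)
        · exact .inl h6
      · exact .inr (h5.copyCell cl)
    · rw [Function.update_of_ne hyx]
      refine (h4 y hy cl' hcl).imp_left fun h5 => (List.mem_cons.1 h5).resolve_left fun h6 => ?_
      exact hyx (Prod.mk.inj h6).1

theorem CInv.step_postmark (h : CInv a b g D c) {todo : List Addr}
    (hs : (c.thread t).pc = .postmark u todo)
    (hst : step a b ch t c.mem (c.thread t) = some (m', s')) :
    Preserved a b g D c ⟨m', Function.update c.thread t s'⟩ := by
  have hpc := h.pc t
  have hnd := h.nodup t
  rw [hs] at hpc hnd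
  unfold step at hst
  rw [hs] at hst
  cases todo with
  | nil =>
      have key : ∀ w, Preserved a b g D c ⟨c.mem, Function.update c.thread t
          { c.thread t with pc := .release u.locks .ret, result := w }⟩ := fun w => by
        refine h.advance_local (by rw [hs]; rfl) (.inl rfl) (h.stack t) ?_ ?_ ?_ <;> rw [hs]
        · simp [PC.unlinked]
        · simp [PC.resizing]
        · intro x hx
          obtain rfl : x = u.target := List.mem_singleton.1 hx
          exact u.target_mem
      cases u <;> cases hst <;> exact key _
  | cons x xs =>
      cases hst
      have hx : x ∈ u.sources := u.postmarks_subset x (hpc x List.mem_cons_self)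
      refine h.advance_mark (by rw [hs]; exact u.sources_subset x hx) (by rw [hs]; rfl)
        (fun y hy => hpc y (List.mem_cons_of_mem x hy)) rfl ?_ (by rw [hs]; rfl) ?_ <;> rw [hs]
      · exact fun y hy => List.mem_cons.1 hy
      · intro y hy
        obtain rfl : y = u.target := List.mem_singleton.1 hy
        exact ⟨fun e => Update.target_not_source hnd (e ▸ hx), List.mem_singleton_self _⟩

/-- The invariant is preserved in every step. -/
theorem CInv.step (ha : 2 ≤ a) (hab : 2 * a ≤ b) (h : CInv a b g D c)
    (hst : step a b ch t c.mem (c.thread t) = some (m', s')) :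
    Preserved a b g D c ⟨m', Function.update c.thread t s'⟩ := by
  have hpc := h.pc t
  have hst' := hst
  unfold OCCABTree.step at hst
  cases hs : (c.thread t).pc with
  | idle =>
      rw [hs] at hst; cases hst
      refine h.advance_clean hs ⟨rfl, rfl, rfl⟩ rfl ?_ fun r hr => .inl hr
      cases ch.op <;> simp [Thread.goto, Operation.routine, PCInv, RoutineOK]
  | start r => exact h.step_start hs hst'
  | retry r => exact h.step_retry hs hst'
  | ret => exact h.step_ret hs hst'
  | search r key target path pt => exact h.step_search hs hst'
  | leafVer r key path => exact h.step_leafVer hs hst'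
  | leafKey r key path ver1 i => exact h.step_leafKey hs hst'
  | leafVal r key path ver1 i =>
      rw [hs] at hst hpc; cases hst
      exact h.advance_clean hs ⟨rfl, rfl, rfl⟩ rfl hpc fun r hr => .inl hr
  | leafVer2 r key path ver1 val => exact h.step_leafVer2 hs hst'
  | insLock k v path =>
      rw [hs] at hst hpc; simp only at hst
      split_ifs at hst with hl
      cases hst
      exact h.advance_lock_clean hs hpc.1.1 hl ⟨rfl, rfl, rfl⟩ rfl hpc
  | insMarked k v path => exact h.step_insMarked hs hst'
  | insScan k v path i => exact h.step_insScan hs hst'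
  | insFound path i =>
      rw [hs] at hst hpc; cases hst
      exact h.advance_clean hs ⟨rfl, rfl, rfl⟩ rfl (.inl rfl) fun r hr => .inl hr
  | insSize k v path => exact h.step_insSize hs hst'
  | insEmpty k v path i => exact h.step_insEmpty hs hst'
  | insBegin k v leaf i =>
      rw [hs] at hst hpc; cases hst
      refine h.advance_ver leaf 1 (by rw [hs]; rfl) hpc (h.stack t) ?_ ?_ ?_ <;>
        (rw [hs]; exact fun x hx => hx)
  | insKey k v leaf i => exact h.step_insWrite (.inl ⟨_, _, _, _, hs⟩) hst'
  | insVal v leaf i => exact h.step_insWrite (.inr (.inl ⟨_, _, _, hs⟩)) hst'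
  | insInc leaf => exact h.step_insWrite (.inr (.inr ⟨_, hs⟩)) hst'
  | insEnd leaf =>
      rw [hs] at hst; cases hst
      refine h.advance_ver leaf 1 (by rw [hs]; rfl) (.inl rfl) (h.stack t) ?_ ?_ ?_ <;>
        (rw [hs]; exact fun x hx => hx)
  | delLock k leaf =>
      rw [hs] at hst hpc; simp only at hst
      split_ifs at hst with hl
      cases hst
      exact h.advance_lock_clean hs hpc.1 hl ⟨rfl, rfl, rfl⟩ rfl hpc
  | delMarked k leaf => exact h.step_delMarked hs hst'
  | delScan k leaf i => exact h.step_delScan hs hst'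
  | delVal leaf i =>
      rw [hs] at hst hpc; cases hst
      exact h.advance_clean hs ⟨rfl, rfl, rfl⟩ rfl hpc fun r hr => .inl hr
  | delBegin leaf i =>
      rw [hs] at hst hpc; cases hst
      refine h.advance_ver leaf 1 (by rw [hs]; rfl) hpc (h.stack t) ?_ ?_ ?_ <;>
        (rw [hs]; exact fun x hx => hx)
  | delKey leaf i => exact h.step_delWrite (.inl ⟨_, _, hs⟩) hst'
  | delDec leaf => exact h.step_delWrite (.inr ⟨_, hs⟩) hst'
  | delEnd leaf =>
      rw [hs] at hst hpc; cases hst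
      refine h.advance_ver leaf 1 (by rw [hs]; rfl) hpc (h.stack t) ?_ ?_ ?_ <;>
        (rw [hs]; exact fun x hx => hx)
  | delSize leaf => exact h.step_delSize hs hst'
  | sibling x p gp nIdx sIdx pIdx =>
      rw [hs] at hst hpc; simp only at hst
      obtain ⟨h1, h2, h3, h4⟩ := hpc
      split at hst <;> cases hst
      · rename_i s hsib
        refine h.advance_clean hs ⟨rfl, rfl, rfl⟩ ?_
          ⟨⟨⟨h1, h.mem.closed p h2.1 _ _ ⟨h2.2.1, hsib⟩⟩, h2, ⟨h2.1, h2.2.1, .inl hsib⟩, h3, h4⟩,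
            [], rfl⟩ fun r hr => .inl hr
        show List.take (_ - _) _ = []
        rw [Nat.sub_self, List.take_zero]
      · exact h.advance_clean hs ⟨rfl, rfl, rfl⟩ rfl (h.mem.once_lt x h1) fun r hr => .inl hr
  | acquire u todo => exact h.step_acquire hs hst'
  | test u todo => exact h.step_test hs hst'
  | premark u todo => exact h.step_premark hs hst'
  | copy u todo buf => exact h.step_copy ha hab hs hst'
  | link u x i new =>
      rw [hs] at hst; cases hst
      exact h.advance_link hs
  | postmark u todo => exact h.step_postmark hs hst'
  | release todo after =>
      rw [hs] at hst hpc
      cases todo with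
      | nil =>
          cases hst
          rcases hpc with rfl | ⟨r, rfl, h1⟩
          · exact h.advance_clean hs ⟨rfl, rfl, rfl⟩ rfl trivial fun r hr => .inl hr
          · exact h.advance_clean hs ⟨rfl, rfl, rfl⟩ rfl h1 fun r hr => .inl hr
      | cons x xs =>
          cases hst
          exact h.advance_unlock hs

end Updates

/-! ### Executions -/

section Executions

variable {K V T : Type*} [LinearOrder K] [DecidableEq T]
variable {a b : ℕ} {g : Ghost K T} {D : Addr → Contents K V} {e : ℕ → Config K V T} {N : ℕ}

/-- The invariant of the last configuration `e N`, with auxiliary data that describe the execution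
up to `e N`. -/
structure History (a b : ℕ) (e : ℕ → Config K V T) (N : ℕ) (g : Ghost K T)
    (D : Addr → Contents K V) : Prop where
  inv : CInv a b g D (e N)
  saved : ∀ x ∈ g.once, ∃ i ≤ N, (e i).mem.ReachableUnlocked x ∧
    (∀ j ≤ N, i < j → ¬ (e j).mem.ReachableUnlocked x) ∧ D x = ((e i).mem.node x).data
  once : ∀ i ≤ N, ∀ x, (e i).mem.Reachable x → x ∈ g.once
  range : ∀ i ≤ N, ∀ x I, (e i).mem.KeyRange x I → x ∈ g.once ∧ I = g.range x
  keyRange : ∀ x ∈ g.once, ∃ i ≤ N, (e i).mem.KeyRange x (g.range x)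

/-- The auxiliary data for the initial configuration: the sentinel node and the root. -/
def Ghost.initial : Ghost K T where
  range := fun _ => ⟨⊥, ⊤⟩
  weight := fun _ => 1
  once := {entry, 1}
  dead := ∅
  owner := fun _ => none

theorem History.initial {c : Config K V T} (hb : 1 ≤ b) (hc : c.IsInitial) (he : e 0 = c) :
    History a b e 0 Ghost.initial fun x => (c.mem.node x).data := by
  obtain ⟨⟨k₀, h0⟩, ⟨k₁, h1⟩, hn, hth⟩ := hc
  have hchild : c.mem.Child entry 0 1 := by simp [Memory.Child, h0, innerOf]
  have hr0 : c.mem.Reachable entry := .refl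
  have hr1 : c.mem.Reachable 1 := hr0.tail ⟨0, hchild⟩
  have hru : ∀ x ∈ (Ghost.initial : Ghost K T).once, c.mem.ReachableUnlocked x := by
    rintro x (rfl | rfl)
    · exact ⟨hr0, by rw [h0]⟩
    · exact ⟨hr1, by rw [h1]⟩
  have hlt : ∀ x < c.mem.next, x = entry ∨ x = 1 := by
    intro x hx
    rw [hn] at hx
    exact Nat.le_one_iff_eq_zero_or_eq_one.1 (Nat.lt_succ_iff.1 hx)
  have hne : (⟨⊥, ⊤⟩ : Range K).Nonempty := ⟨k₀, bot_le, WithTop.coe_lt_top k₀⟩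
  have hM : MInv b Ghost.initial c.mem :=
    { entry_once := .inl rfl
      entry_kind := by rw [h0]
      entry_size := by rw [h0]; rfl
      entry_range := rfl
      entry_live := id
      once_lt := by
        rintro x (rfl | rfl) <;> rw [hn]
        · exact Nat.zero_lt_two
        · exact Nat.one_lt_two
      dead_once := fun x hx => hx.elim
      owner_lt := fun x t hx => by cases hx
      node := by
        intro x hx
        rcases hlt x hx with rfl | rfl
        · rw [h0]
          refine ⟨le_rfl, hne, fun h => (by cases h), fun _ => ⟨[], [1], rfl, .single rfl, hb,
            fun h => (by cases h), fun x hx => ?_⟩⟩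
          obtain rfl := List.mem_singleton.1 hx
          exact ⟨by rw [hn]; exact Nat.one_lt_two, Nat.one_ne_zero, hne, fun h => absurd rfl h⟩
        · rw [h1]
          refine ⟨le_rfl, hne, fun _ => ⟨rfl, leafOK_leafOf (Nat.zero_le b) List.nodup_nil ?_⟩,
            fun h => absurd rfl h⟩
          simp
      closed := by
        rintro x (rfl | rfl) i y ⟨hk, hy⟩
        · rw [h0] at hy
          exact .inr (List.mem_singleton.1 (List.mem_of_getElem? hy))
        · rw [h1] at hk
          exact absurd rfl hk
      live := fun x hx _ => (hru x hx).1 }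
  subst he
  refine ⟨⟨hM, fun t => ?_, fun t => ?_, fun x hx t => ?_, fun t => ?_, fun t => ?_,
    fun x hx => hx.elim, fun x hx hk => .inl ?_, fun x _ => .inl rfl⟩,
    fun x hx => ⟨0, le_rfl, hru x hx, fun j hj hj' => absurd hj (not_le.2 hj'), rfl⟩,
    fun i hi x hx => ?_, fun i hi x I hx => ?_,
    fun x hx => ⟨0, le_rfl, hM.keyRange (hru x hx).1⟩⟩
  · rw [hth t]; trivial
  · rw [hth t]; simp
  · rw [hth t]
    rcases hlt x hx with rfl | rfl
    · rw [h0]; simp [PC.held]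
    · rw [h1]; simp [PC.held]
  · rw [hth t]; simp [PC.held]
  · rw [hth t]; simp [PC.held]
  · rcases hlt x hx with rfl | rfl
    · rw [h0] at hk; cases hk
    · rw [h1]; exact numKeys_leafOf (Nat.zero_le b)
  · obtain rfl := Nat.le_zero.1 hi
    exact hM.once_of_reachable hx
  · obtain rfl := Nat.le_zero.1 hi
    exact hM.keyRange_eq hx

theorem History.step (ha : 2 ≤ a) (hab : 2 * a ≤ b) (h : History a b e N g D)
    (hst : (e N).Step a b (e (N + 1))) : ∃ g' D', History a b e (N + 1) g' D' := by
  obtain ⟨t, ch, m', s', hst, hc⟩ := hst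
  obtain ⟨g', D', h1, h2, h3⟩ := h.inv.step ha hab hst
  rw [← hc] at h1 h2 h3
  have hrange : ∀ x ∈ g.once, g'.range x = g.range x := fun x hx =>
    h2.range x (h.inv.mem.once_lt x hx)
  refine ⟨g', D', h1, fun x hx => ?_, fun i hi x hx => ?_, fun i hi x I hx => ?_, fun x hx => ?_⟩
  · rcases h3 x hx with ⟨q1, q2⟩ | ⟨q1, q2, q3⟩
    · exact ⟨N + 1, le_rfl, q1, fun j hj hj' => absurd hj (not_le.2 hj'), q2⟩
    · obtain ⟨i, hi, r1, r2, r3⟩ := h.saved x q2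
      refine ⟨i, hi.trans N.le_succ, r1, fun j hj hij => ?_, q3.trans r3⟩
      rcases Nat.le_succ_iff.1 hj with hj | rfl
      · exact r2 j hj hij
      · exact q1
  · rcases Nat.le_succ_iff.1 hi with hi | rfl
    · exact h2.once x (h.once i hi x hx)
    · exact h1.mem.once_of_reachable hx
  · rcases Nat.le_succ_iff.1 hi with hi | rfl
    · obtain ⟨q1, q2⟩ := h.range i hi x I hx
      exact ⟨h2.once x q1, q2.trans (hrange x q1).symm⟩
    · exact h1.mem.keyRange_eq hx
  · by_cases hxo : x ∈ g.once
    · obtain ⟨i, hi, q⟩ := h.keyRange x hxo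
      exact ⟨i, hi.trans N.le_succ, by rw [hrange x hxo]; exact q⟩
    · rcases h3 x hx with ⟨q1, -⟩ | ⟨-, q2, -⟩
      · exact ⟨N + 1, le_rfl, h1.mem.keyRange q1.1⟩
      · exact absurd q2 hxo

theorem exists_history (ha : 2 ≤ a) (hab : 2 * a ≤ b) :
    ∀ {N : ℕ}, IsExecution a b e N → ∃ g D, History a b e N g D := by
  intro N
  induction N with
  | zero => exact fun he => ⟨_, _, History.initial (by omega) he.1 rfl⟩
  | succ N ih =>
      intro he
      obtain ⟨g, D, h⟩ := ih ⟨he.1, fun i hi => he.2 i (hi.trans N.lt_succ_self)⟩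
      exact h.step ha hab (he.2 N N.lt_succ_self)

theorem CInv.sizeCorrect {c : Config K V T} (h : CInv a b g D c) {x : Addr} (hx : x < c.mem.next)
    (hl : (c.mem.node x).lock = none) : (c.mem.node x).SizeCorrect b := by
  unfold Node.SizeCorrect
  split_ifs with hk
  · rcases h.size x hx hk with h1 | ⟨t, h1⟩
    · exact h1.symm
    · have := (h.lock x hx t).2 (PC.resizing_subset h1)
      rw [hl] at this
      cases this
  · obtain ⟨ks, cs, h1, h2, h3, -⟩ := h.mem.inner hx hk
    have := h2.length_eq
    rw [h1, numPtrs_innerOf h3, numKeys_innerOf (by omega)]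
    exact ⟨rfl, this⟩

theorem CInv.aboutToMark {c : Config K V T} (h : CInv a b g D c) {x : Addr} {t : T}
    (hx : x ∈ (c.thread t).pc.unlinked) : c.AboutToMark x := by
  have hl := h.lock_of_held ((h.pc t).unlinked_subset hx)
  cases hs : (c.thread t).pc with
  | postmark u todo =>
      rw [hs] at hx
      exact ⟨t, u, todo, hl, hs, hx⟩
  | _ => rw [hs] at hx; simp [PC.unlinked] at hx

theorem PCInv.search_once {m : Memory K V T} {t : T} {r : Routine K V} {key : K}
    {target : Option Addr} {path : Path} {pt : SearchPoint}
    (h : PCInv a b g m t (.search r key target path pt)) :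
    path.n ∈ g.once ∧ (g.range path.n).Contains key := by
  obtain ⟨-, h1, h2⟩ := h
  cases pt
  exacts [⟨h2.1, h1⟩, ⟨h2.1.1, h1⟩, ⟨h2.1.1, h1⟩, ⟨h2.1.1, h1⟩]

end Executions

end OCCABTree

/-- The invariants of the OCC-ABtree, in every configuration `e N` of every execution. -/
theorem mainTheorem1 {K V T : Type*} [LinearOrder K] [DecidableEq T]
    (a b : ℕ) (ha : 2 ≤ a) (hab : 2 * a ≤ b)
    (e : ℕ → OCCABTree.Config K V T) (N : ℕ) (he : OCCABTree.IsExecution a b e N) :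
    -- (1) The reachable nodes form a relaxed `(a,b)`-tree.
    (e N).mem.IsRelaxedABTree b ∧
    -- (2) The key range of a node that was once reachable is constant.
    (∀ i ≤ N, ∀ j ≤ N, ∀ x I J,
      (e i).mem.KeyRange x I → (e j).mem.KeyRange x J → I = J) ∧
    -- (3) A once reachable node that is not reachable has the contents that it had when it was
    -- last reachable and unlocked.
    (∀ x, OCCABTree.OnceReachable e N x → ¬ (e N).mem.Reachable x →
      ∃ i ≤ N, (e i).mem.ReachableUnlocked x ∧
        (∀ j ≤ N, i < j → ¬ (e j).mem.ReachableUnlocked x) ∧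
        ((e N).mem.node x).data = ((e i).mem.node x).data) ∧
    -- (4) A key appears at most once in a leaf.
    (∀ x < (e N).mem.next, ((e N).mem.node x).kind = .leaf →
      ∀ i j k, ((e N).mem.node x).data.keys i = some k →
        ((e N).mem.node x).data.keys j = some k → i = j) ∧
    -- (5) A once reachable node that is unmarked is still reachable, unless the update that has
    -- just unlinked it is about to mark it.
    (∀ x, OCCABTree.OnceReachable e N x → ((e N).mem.node x).marked = false →
      (e N).mem.Reachable x ∨ (e N).AboutToMark x) ∧
    -- (6) The size field of a once reachable node that is unlocked is correct.
    (∀ x, OCCABTree.OnceReachable e N x → ((e N).mem.node x).lock = none →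
      ((e N).mem.node x).SizeCorrect b) ∧
    -- (7) The key range of the node `n` in `search(key, target)` contains `key`.
    (∀ t r key target path pt, ((e N).thread t).pc = .search r key target path pt →
      ∃ i ≤ N, ∃ I, (e i).mem.KeyRange path.n I ∧ I.Contains key) := by
  obtain ⟨g, D, h⟩ := OCCABTree.exists_history ha hab he
  have hM := h.inv.mem
  have honce : ∀ x, OCCABTree.OnceReachable e N x → x ∈ g.once := fun x ⟨i, hi, hx⟩ =>
    h.once i hi x hx
  refine ⟨hM.isRelaxedABTree, fun i hi j hj x I J hI hJ => ?_, fun x hx hnr => ?_,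
    fun x hx hk i j k => ?_, fun x hx hm => ?_, fun x hx hl => ?_,
    fun t r key target path pt hs => ?_⟩
  · rw [(h.range i hi x I hI).2, (h.range j hj x J hJ).2]
  · obtain ⟨i, hi, q1, q2, q3⟩ := h.saved x (honce x hx)
    refine ⟨i, hi, q1, q2, ?_⟩
    rcases h.inv.saved x (honce x hx) with h1 | ⟨-, -, h1⟩
    · rw [← h1, q3]
    · exact absurd (hM.live x (honce x hx) h1) hnr
  · exact ((hM.node x hx).leaf hk).2.inj i j k
  · by_cases hd : x ∈ g.dead
    · rcases h.inv.dead x hd with h1 | ⟨t, h1⟩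
      · rw [hm] at h1
        cases h1
      · exact .inr (h.inv.aboutToMark h1)
    · exact .inl (hM.live x (honce x hx) hd)
  · exact h.inv.sizeCorrect (hM.once_lt x (honce x hx)) hl
  · have hpc := h.inv.pc t
    rw [hs] at hpc
    obtain ⟨h1, h2⟩ := hpc.search_once
    obtain ⟨i, hi, h3⟩ := h.keyRange _ h1
    exact ⟨i, hi, _, h3, h2⟩
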